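/- Let $\mathfrak g=\mathfrak{sl}_2\oplus\mathfrak{sl}_2$ over $\mathbb C$, $A=U(\mathfrak g)$, and let $e=e^{(1)}+e^{(2)}$, $f=f^{(1)}+f^{(2)}$, $h=h^{(1)}+h^{(2)}$ be the standard basis of the diagonal $\mathfrak{sl}_2$ ($[e,f]=h$, upper indices number the two copies); put $E=e^{(1)}-e^{(2)}$, $F=f^{(1)}-f^{(2)}$, $H=h^{(1)}-h^{(2)}$. Let $\bar A$ and $\bar U(\mathfrak h)$ be the rings of fractions of $A$ and of $U(\mathfrak h)=\mathbb C[h]$ with respect to the multiplicative set generated by the elements $h+l$, $l\in\mathbb Z$. Let $\bar I_+=\bar A e$, and let $\mathrm{DR}(\mathfrak{sl}_2)=\mathrm{Norm}(\bar I_+)/\bar I_+$, $\mathrm{Norm}(\bar I_+)=\{a\in\bar A:\bar I_+a\subseteq\bar I_+\}$, be the (localized) diagonal reduction algebra of $\mathfrak{sl}_2$. It contains $\bar U(\mathfrak h)$, and its generators $z_+,t,z_-$ are the classes of the elements of $\mathrm{Norm}(\bar I_+)$ $$E,\qquad H+2fE\,\frac1{h+2},\qquad F-fH\,\frac1h-f^2E\,\frac1{h(h+1)},$$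 which are congruent to $E,H,F$ modulo $f\bar A+\bar Ae$. An element $x$ has weight $\mu\in\mathbb C$ if $[h,x]=\mu x$. Consider the $\mathbb C$-algebra automorphisms $\varphi$ of $\mathrm{DR}(\mathfrak{sl}_2)$ such that (i) $\varphi$ maps every element of weight $\mu$ to an element of weight $-\mu$, for all $\mu$; and (ii) $\varphi$ is linear over $\bar U(\mathfrak h)$ in the generators, that is, $\varphi(h)\in\bar U(\mathfrak h)$ and each of $\varphi(z_+),\varphi(z_-),\varphi(t)$ lies in $z_+\bar U(\mathfrak h)+z_-\bar U(\mathfrak h)+t\,\bar U(\mathfrak h)$. Every such automorphism is of the form $$h\mapsto -h-2,\qquad t\mapsto \beta\,t\,\frac{h+2}{h},\qquad z_+\mapsto z_-\,\frac{1}{(h-1)\gamma(h)},\qquad z_-\mapsto z_+\,(h+3)\,\gamma(h+2)$$ for some $\beta\in\{1,-1\}$ and some invertible element $\gamma=\gamma(h)$ of $\bar U(\mathfrak h)$. Conversely, for every $\beta\in\{1,-1\}$ and every invertible $\gamma\in\bar U(\mathfrak h)$ there is exactly one automorphism of this class given by these formulas. -/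

import Mathlib

namespace DiagonalReduction

noncomputable section

open Polynomial LieAlgebra.SpecialLinear

attribute [local instance 100] LieRing.ofAssociativeRing

/-! ### The Lie algebra `sl₂ ⊕ sl₂` and its universal enveloping algebra -/

/-- The Lie algebra `sl₂` over the complex numbers. -/
abbrev Sl2 : Type := sl (Fin 2) ℂ

/-- The Lie algebra `sl₂ ⊕ sl₂`. -/
abbrev G : Type := Sl2 × Sl2

/-- The algebra `A = U(sl₂ ⊕ sl₂) = U(sl₂) ⊗ U(sl₂)`. -/
abbrev A : Type := UniversalEnvelopingAlgebra ℂ G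

/-- The matrix `(0 1; 0 0)` of `sl₂`. -/
def slE : Sl2 := single 0 1 (by decide) (1 : ℂ)

/-- The matrix `(0 0; 1 0)` of `sl₂`. -/
def slF : Sl2 := single 1 0 (by decide) (1 : ℂ)

/-- The matrix `(1 0; 0 -1)` of `sl₂`. -/
def slH : Sl2 := singleSubSingle 0 1 (1 : ℂ)

/-- The image in `A` of the element `(x, x)` of the diagonal `sl₂`. -/
def diag (x : Sl2) : A := UniversalEnvelopingAlgebra.ι ℂ ((x, x) : G)

/-- The image in `A` of the element `(x, -x)` of the complement of the diagonal `sl₂`. -/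
def anti (x : Sl2) : A := UniversalEnvelopingAlgebra.ι ℂ ((x, -x) : G)

/-- The Cartan element `h` of the diagonal `sl₂`, as an element of `A`. -/
def hA : A := diag slH

/-! ### Localization with respect to the elements `h + l`, `l ∈ ℤ` -/

section Ore

variable {B : Type*} [Ring B] [Algebra ℂ B]

/-- The multiplicative set generated by the elements `h + l`, `l ∈ ℤ`. -/
def shiftedMonoid (h : B) : Submonoid B :=
  Submonoid.closure (Set.range fun l : ℤ => h + algebraMap ℂ B (l : ℂ))

/-- The elements `a` with `[h, a] = m a`. -/
def weightSpace (h : B) (m : ℤ) : Submodule ℂ B :=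
  Module.End.eigenspace (LinearMap.mulLeft ℂ h - LinearMap.mulRight ℂ h) (m : ℂ)

theorem mem_weightSpace {h a : B} {m : ℤ} :
    a ∈ weightSpace h m ↔ h * a - a * h = (m : ℂ) • a := by
  simp [weightSpace]

theorem commute_of_mem {h s : B} (hs : s ∈ shiftedMonoid h) : Commute h s := by
  refine Submonoid.closure_induction ?_ (Commute.one_right h) (fun x y _ _ hx hy => hx.mul_right hy) hs
  rintro _ ⟨l, rfl⟩
  exact (Commute.refl h).add_right (Algebra.commutes _ h).symm

theorem commute_of_mem_of_mem {h s t : B} (hs : s ∈ shiftedMonoid h) (ht : t ∈ shiftedMonoid h) :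
    Commute s t := by
  refine Submonoid.closure_induction ?_ (Commute.one_left t) (fun x y _ _ hx hy => hx.mul_left hy) hs
  rintro _ ⟨l, rfl⟩
  exact (commute_of_mem ht).add_left (Algebra.commutes _ t)

theorem exists_shift {h s : B} (hs : s ∈ shiftedMonoid h) (m : ℤ) :
    ∃ s' ∈ shiftedMonoid h, ∀ a ∈ weightSpace h m, s' * a = a * s := by
  induction hs using Submonoid.closure_induction with
  | mem x hx =>
    obtain ⟨l, rfl⟩ := hx
    refine ⟨h + algebraMap ℂ B ((l - m : ℤ) : ℂ), Submonoid.subset_closure ⟨_, rfl⟩, ?_⟩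
    intro a ha
    have := mem_weightSpace.1 ha
    have h1 : h * a = a * h + (m : ℂ) • a := by rw [← this]; abel
    rw [add_mul, mul_add, h1, ← Algebra.smul_def, ← Algebra.commutes, ← Algebra.smul_def]
    push_cast
    rw [sub_smul]
    abel
  | one => exact ⟨1, one_mem _, fun a _ => by simp⟩
  | mul x y _ _ hx hy =>
    obtain ⟨x', hx', h1⟩ := hx
    obtain ⟨y', hy', h2⟩ := hy
    refine ⟨x' * y', mul_mem hx' hy', fun a ha => ?_⟩
    have hax : x' * a ∈ weightSpace h m := by
      rw [mem_weightSpace] at ha ⊢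
      have hc := commute_of_mem hx'
      rw [← mul_assoc, hc.eq, mul_assoc, mul_assoc, ← mul_sub, ha, mul_smul_comm]
    rw [(commute_of_mem_of_mem hx' hy').eq, mul_assoc, h2 _ hax, h1 a ha, mul_assoc]

theorem ore_condition {h : B} (htop : ⨆ m, weightSpace h m = ⊤) (r : B) {s : B}
    (hs : s ∈ shiftedMonoid h) : ∃ r' : B, ∃ s' ∈ shiftedMonoid h, s' * r = r' * s := by
  have hr : r ∈ ⨆ m, weightSpace h m := htop ▸ Submodule.mem_top
  induction hr using Submodule.iSup_induction' with
  | mem m x hx =>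
    obtain ⟨s', hs', h1⟩ := exists_shift hs m
    exact ⟨x, s', hs', h1 x hx⟩
  | zero => exact ⟨0, 1, one_mem _, by simp⟩
  | add x y _ _ hx hy =>
    obtain ⟨x', s', hs', h1⟩ := hx
    obtain ⟨y', t', ht', h2⟩ := hy
    refine ⟨t' * x' + s' * y', s' * t', mul_mem hs' ht', ?_⟩
    rw [mul_add, mul_assoc, mul_assoc, h2, ← mul_assoc s' t' x, (commute_of_mem_of_mem hs' ht').eq,
      mul_assoc, h1, add_mul, mul_assoc, mul_assoc]

theorem ore_cancel {h : B} (htop : ⨆ m, weightSpace h m = ⊤) {r s : B}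
    (hs : s ∈ shiftedMonoid h) (hrs : r * s = 0) : ∃ s' ∈ shiftedMonoid h, s' * r = 0 := by
  have hr : r ∈ ⨆ m, weightSpace h m := htop ▸ Submodule.mem_top
  obtain ⟨f, hf, rfl⟩ := (Submodule.mem_iSup_iff_exists_finsupp _ _).1 hr
  have hind : iSupIndep (weightSpace h) :=
    (Module.End.eigenspaces_iSupIndep (LinearMap.mulLeft ℂ h - LinearMap.mulRight ℂ h)).comp
      (f := fun m : ℤ => (m : ℂ)) Int.cast_injective
  have hz : ∀ m, f m * s = 0 := by
    intro m
    by_cases hm : m ∈ f.support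
    · refine (iSupIndep_iff_finsetSum_eq_zero_imp_eq_zero _).1 hind f.support
        (fun i => f i * s) ?_ ?_ m hm
      · intro i _
        have := mem_weightSpace.1 (hf i)
        rw [mem_weightSpace, mul_assoc, ← (commute_of_mem hs).eq, ← mul_assoc, ← mul_assoc,
          ← sub_mul, this, smul_mul_assoc]
      · rw [← Finset.sum_mul]; exact hrs
    · simp [Finsupp.notMem_support_iff.1 hm]
  have key : ∀ F : Finset ℤ, ∃ s' ∈ shiftedMonoid h, ∀ m ∈ F, s' * f m = 0 := by
    intro F
    induction F using Finset.induction_on with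
    | empty => exact ⟨1, one_mem _, by simp⟩
    | insert k F _ ih =>
      obtain ⟨s', hs', h1⟩ := ih
      obtain ⟨t', ht', h2⟩ := exists_shift hs k
      refine ⟨s' * t', mul_mem hs' ht', fun m hm => ?_⟩
      rcases Finset.mem_insert.1 hm with rfl | hm
      · rw [mul_assoc, h2 _ (hf m), hz, mul_zero]
      · rw [(commute_of_mem_of_mem hs' ht').eq, mul_assoc, h1 m hm, mul_zero]
  obtain ⟨s', hs', h1⟩ := key f.support
  refine ⟨s', hs', ?_⟩
  rw [Finsupp.sum, Finset.mul_sum]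
  exact Finset.sum_eq_zero h1

theorem nonempty_oreSet {h : B} (htop : ⨆ m, weightSpace h m = ⊤) :
    Nonempty (OreLocalization.OreSet (shiftedMonoid h)) := by
  rw [OreLocalization.nonempty_oreSet_iff]
  refine ⟨fun r₁ r₂ s hr => ?_, fun r s => ?_⟩
  · obtain ⟨s', hs', h1⟩ := ore_cancel htop s.2 (r := r₁ - r₂) (by rw [sub_mul, hr, sub_self])
    exact ⟨⟨s', hs'⟩, by rwa [mul_sub, sub_eq_zero] at h1⟩
  · obtain ⟨r', s', hs', h1⟩ := ore_condition htop r s.2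
    exact ⟨r', ⟨s', hs'⟩, h1⟩

theorem mul_mem_weightSpace {h a b : B} {m n : ℤ} (ha : a ∈ weightSpace h m)
    (hb : b ∈ weightSpace h n) : a * b ∈ weightSpace h (m + n) := by
  rw [mem_weightSpace] at *
  have : h * (a * b) - a * b * h = (h * a - a * h) * b + a * (h * b - b * h) := by noncomm_ring
  rw [this, ha, hb, smul_mul_assoc, mul_smul_comm, ← add_smul]
  push_cast
  rfl

/-- The subalgebra of sums of elements of integral weight. -/
def weightSubalgebra (h : B) : Subalgebra ℂ B :=
  (⨆ m, weightSpace h m).toSubalgebra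
    (Submodule.mem_iSup_of_mem 0 (mem_weightSpace.2 (by simp)))
    (by
      intro x y hx hy
      induction hx using Submodule.iSup_induction' with
      | mem m x hx =>
        induction hy using Submodule.iSup_induction' with
        | mem n y hy => exact Submodule.mem_iSup_of_mem (m + n) (mul_mem_weightSpace hx hy)
        | zero => simp
        | add y z _ _ h1 h2 => rw [mul_add]; exact add_mem h1 h2
      | zero => simp
      | add x z _ _ h1 h2 => rw [add_mul]; exact add_mem h1 h2)

end Ore

theorem sl2_decomp (x : Sl2) :
    x = (x.val 0 1) • slE + (x.val 1 0) • slF + (x.val 0 0) • slH := by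
  have hx : x.val 0 0 + x.val 1 1 = 0 := by
    have := x.2
    change Matrix.trace x.val = 0 at this
    rwa [Matrix.trace_fin_two] at this
  ext i j
  fin_cases i <;> fin_cases j <;> simp [slE, slF, slH]
  linear_combination hx

theorem lie_slH_slE : ⁅slH, slE⁆ = (2 : ℂ) • slE := by
  ext i j
  fin_cases i <;> fin_cases j <;>
    simp [slE, slH, Ring.lie_def] <;> norm_num

theorem lie_slH_slF : ⁅slH, slF⁆ = (-2 : ℂ) • slF := by
  ext i j
  fin_cases i <;> fin_cases j <;>
    simp [slF, slH, Ring.lie_def] <;> norm_num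

theorem lie_slE_slF : ⁅slE, slF⁆ = slH := by
  ext i j
  fin_cases i <;> fin_cases j <;>
    simp [slE, slF, slH, Ring.lie_def]

theorem ι_mem_weightSubalgebra (x : G) :
    UniversalEnvelopingAlgebra.ι ℂ x ∈ weightSubalgebra hA := by
  have hw : ∀ (y : G) (m : ℤ), ⁅((slH, slH) : G), y⁆ = (m : ℂ) • y →
      UniversalEnvelopingAlgebra.ι ℂ y ∈ weightSubalgebra hA := by
    intro y m hy
    refine Submodule.mem_iSup_of_mem m (mem_weightSpace.2 ?_)
    have := congrArg (UniversalEnvelopingAlgebra.ι ℂ) hy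
    rw [LieHom.map_lie, LinearMapClass.map_smul, Ring.lie_def] at this
    exact this
  have hx : x = ((x.1.val 0 1) • (slE, 0) + (x.1.val 1 0) • (slF, 0) + (x.1.val 0 0) • (slH, 0))
      + ((x.2.val 0 1) • (0, slE) + (x.2.val 1 0) • (0, slF) + (x.2.val 0 0) • (0, slH)) := by
    ext1
    · simpa using sl2_decomp x.1
    · simpa using sl2_decomp x.2
  rw [hx]
  simp only [map_add, LinearMapClass.map_smul]
  have e1 := hw (slE, 0) 2 (by simp [lie_slH_slE])
  have e2 := hw (0, slE) 2 (by simp [lie_slH_slE])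
  have f1 := hw (slF, 0) (-2) (by simp [lie_slH_slF])
  have f2 := hw (0, slF) (-2) (by simp [lie_slH_slF])
  have h1 := hw (slH, 0) 0 (by simp)
  have h2 := hw (0, slH) 0 (by simp)
  exact add_mem (add_mem (add_mem (Subalgebra.smul_mem _ e1 _) (Subalgebra.smul_mem _ f1 _))
    (Subalgebra.smul_mem _ h1 _))
    (add_mem (add_mem (Subalgebra.smul_mem _ e2 _) (Subalgebra.smul_mem _ f2 _))
    (Subalgebra.smul_mem _ h2 _))

theorem iSup_weightSpace : ⨆ m, weightSpace hA m = ⊤ := by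
  let g : G →ₗ⁅ℂ⁆ weightSubalgebra hA :=
    { toFun := fun x => ⟨_, ι_mem_weightSubalgebra x⟩
      map_add' := fun x y => Subtype.ext (map_add _ _ _)
      map_smul' := fun c x => Subtype.ext (LinearMapClass.map_smul _ _ _)
      map_lie' := fun {x y} => Subtype.ext (LieHom.map_lie _ _ _) }
  have hg : (weightSubalgebra hA).val.comp (UniversalEnvelopingAlgebra.lift ℂ g)
      = AlgHom.id ℂ A := by
    apply UniversalEnvelopingAlgebra.hom_ext
    ext x <;> simp [g]
  refine eq_top_iff.2 fun a _ => ?_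
  have : (UniversalEnvelopingAlgebra.lift ℂ g a : A) = a := DFunLike.congr_fun hg a
  rw [← this]
  exact (UniversalEnvelopingAlgebra.lift ℂ g a).2

instance instOreSet : OreLocalization.OreSet (shiftedMonoid hA) :=
  (nonempty_oreSet iSup_weightSpace).some

/-- The algebra `Ā`: the ring of fractions of `A = U(sl₂ ⊕ sl₂)` with respect to the multiplicative
set generated by the elements `h + l`, `l ∈ ℤ`. -/
def Abar : Type := OreLocalization (shiftedMonoid hA) A

instance : Ring Abar := inferInstanceAs (Ring (OreLocalization (shiftedMonoid hA) A))

instance : Algebra ℂ Abar := inferInstanceAs (Algebra ℂ (OreLocalization (shiftedMonoid hA) A))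

/-- The canonical map `A → Ā`. -/
def toAbar : A →+* Abar :=
  (OreLocalization.numeratorRingHom : A →+* OreLocalization (shiftedMonoid hA) A)

/-- The algebra `Ū(𝔥)`: the ring of fractions of the polynomial algebra `U(𝔥) = ℂ[h]` with respect
to the multiplicative set generated by the elements `h + l`, `l ∈ ℤ`. -/
def Uh : Type := Localization (shiftedMonoid (X : ℂ[X]))

instance : CommRing Uh := inferInstanceAs (CommRing (Localization (shiftedMonoid (X : ℂ[X]))))

instance : Algebra ℂ[X] Uh :=
  inferInstanceAs (Algebra ℂ[X] (Localization (shiftedMonoid (X : ℂ[X]))))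

instance : IsLocalization (shiftedMonoid (X : ℂ[X])) Uh :=
  inferInstanceAs (IsLocalization (shiftedMonoid (X : ℂ[X]))
    (Localization (shiftedMonoid (X : ℂ[X]))))

/-- The element `h` of `Ū(𝔥)`. -/
def hU : Uh := algebraMap ℂ[X] Uh X

theorem isUnit_hU_add (l : ℤ) : IsUnit (hU + (l : Uh)) := by
  have := IsLocalization.map_units Uh
    (⟨_, Submonoid.subset_closure ⟨l, rfl⟩⟩ : shiftedMonoid (X : ℂ[X]))
  simpa [hU] using this

/-- The invertible element `h + l` of `Ū(𝔥)`, for an integer `l`. -/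
def hUnit (l : ℤ) : Uhˣ := (isUnit_hU_add l).unit

theorem shiftedMonoid_le_comap (n : ℤ) : shiftedMonoid (X : ℂ[X]) ≤
    (shiftedMonoid (X : ℂ[X])).comap (compRingHom (X + C (n : ℂ))) := by
  refine Submonoid.closure_le.2 ?_
  rintro _ ⟨l, rfl⟩
  refine Submonoid.subset_closure ⟨n + l, ?_⟩
  simp [add_assoc]

/-- The shift `u(h) ↦ u(h + n)` of `Ū(𝔥)`, for an integer `n`. -/
def shift (n : ℤ) : Uh →+* Uh :=
  IsLocalization.map Uh (compRingHom (X + C (n : ℂ))) (shiftedMonoid_le_comap n)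

theorem isUnit_aeval (s : shiftedMonoid (X : ℂ[X])) :
    IsUnit (toAbar (aeval hA (s : ℂ[X]))) := by
  have : aeval hA (s : ℂ[X]) ∈ shiftedMonoid hA := by
    have h1 : shiftedMonoid (X : ℂ[X]) ≤ (shiftedMonoid hA).comap (aeval hA : ℂ[X] →ₐ[ℂ] A) := by
      refine Submonoid.closure_le.2 ?_
      rintro _ ⟨l, rfl⟩
      refine Submonoid.subset_closure ⟨l, ?_⟩
      simp
    exact h1 s.2
  exact OreLocalization.numerator_isUnit (⟨_, this⟩ : shiftedMonoid hA)

/-- The embedding `Ū(𝔥) → Ā`, `u(h) ↦ u(h)`. -/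
def uhToAbar : Uh →+* Abar :=
  OreLocalization.universalHom (toAbar.comp (aeval hA : ℂ[X] →ₐ[ℂ] A).toRingHom)
    (IsUnit.liftRight ((toAbar.comp (aeval hA : ℂ[X] →ₐ[ℂ] A).toRingHom : ℂ[X] →* Abar).comp
      (shiftedMonoid (X : ℂ[X])).subtype) isUnit_aeval)
    (fun _ => rfl)

theorem uhToAbar_algebraMap (p : ℂ[X]) :
    uhToAbar (algebraMap ℂ[X] Uh p) = toAbar (aeval hA p) :=
  OreLocalization.universalHom_commutes _ _ _

theorem uhToAbar_hU : uhToAbar hU = toAbar hA := by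
  rw [hU, uhToAbar_algebraMap, aeval_X]

/-! ### The reduction algebra -/

section Normalizer

variable {B : Type*} [Ring B] [Algebra ℂ B]

/-- The normalizer `Norm(I) = {a | I a ⊆ I}` of a left ideal `I`. -/
def normalizer (I : Ideal B) : Subalgebra ℂ B where
  carrier := {a | ∀ x ∈ I, x * a ∈ I}
  mul_mem' := fun ha hb x hx => by rw [← mul_assoc]; exact hb _ (ha x hx)
  add_mem' := fun ha hb x hx => by rw [mul_add]; exact add_mem (ha x hx) (hb x hx)
  algebraMap_mem' := fun c x hx => by rw [← Algebra.commutes]; exact I.mul_mem_left _ hx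

/-- A left ideal `I`, as an ideal of its normalizer. -/
def idealInNormalizer (I : Ideal B) : Ideal (normalizer I) := I.comap (normalizer I).val

instance (I : Ideal B) : (idealInNormalizer I).IsTwoSided :=
  ⟨fun {a} b (ha : (a : B) ∈ I) => b.2 a ha⟩

theorem mem_normalizer_span {e a : B} :
    a ∈ normalizer (Ideal.span {e}) ↔ e * a ∈ Ideal.span {e} := by
  refine ⟨fun h => h e (Ideal.subset_span rfl), fun h x hx => ?_⟩
  obtain ⟨y, rfl⟩ := Ideal.mem_span_singleton'.1 hx
  rw [mul_assoc]
  exact Ideal.mul_mem_left _ _ h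

end Normalizer

/-- The raising element `e` of the diagonal `sl₂`, in `Ā`. -/
def e : Abar := toAbar (diag slE)

/-- The lowering element `f` of the diagonal `sl₂`, in `Ā`. -/
def f : Abar := toAbar (diag slF)

/-- The element `E = e⁽¹⁾ - e⁽²⁾` of `Ā`. -/
def E : Abar := toAbar (anti slE)

/-- The element `F = f⁽¹⁾ - f⁽²⁾` of `Ā`. -/
def F : Abar := toAbar (anti slF)

/-- The element `H = h⁽¹⁾ - h⁽²⁾` of `Ā`. -/
def H : Abar := toAbar (anti slH)

/-- The left ideal `Ī₊ = Ā 𝔫` of `Ā`, where `𝔫 = ℂ e`. -/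
def Iplus : Ideal Abar := Ideal.span {e}

/-- The diagonal reduction algebra `DR(sl₂) = Norm(Ī₊) / Ī₊`. -/
def DR : Type := normalizer Iplus ⧸ idealInNormalizer Iplus

instance : Ring DR := inferInstanceAs (Ring (normalizer Iplus ⧸ idealInNormalizer Iplus))

instance : Algebra ℂ DR := inferInstanceAs (Algebra ℂ (normalizer Iplus ⧸ idealInNormalizer Iplus))

/-- The class in `DR(sl₂)` of an element of the normalizer. -/
def toDR : normalizer Iplus →+* DR := Ideal.Quotient.mk (idealInNormalizer Iplus)

/-! Commutation rules in `Ā`. -/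

theorem diag_mul_diag (x y : Sl2) : diag x * diag y = diag y * diag x + diag ⁅x, y⁆ := by
  have := LieHom.map_lie (UniversalEnvelopingAlgebra.ι ℂ) ((x, x) : G) (y, y)
  rw [Ring.lie_def] at this
  rw [← sub_eq_iff_eq_add']
  exact this.symm

theorem diag_mul_anti (x y : Sl2) : diag x * anti y = anti y * diag x + anti ⁅x, y⁆ := by
  have := LieHom.map_lie (UniversalEnvelopingAlgebra.ι ℂ) ((x, x) : G) (y, -y)
  rw [Ring.lie_def] at this
  rw [← sub_eq_iff_eq_add', anti, anti, diag, ← this]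
  simp

theorem diag_smul (c : ℂ) (x : Sl2) : diag (c • x) = c • diag x :=
  LinearMapClass.map_smul (UniversalEnvelopingAlgebra.ι ℂ) c ((x, x) : G)

theorem anti_smul (c : ℂ) (x : Sl2) : anti (c • x) = c • anti x := by
  rw [anti, anti, ← LinearMapClass.map_smul]
  simp

theorem hA_mul_diag_slE : hA * diag slE = diag slE * hA + (2 : ℤ) • diag slE := by
  rw [hA, diag_mul_diag, lie_slH_slE, diag_smul, ← Int.cast_smul_eq_zsmul ℂ]; norm_num

theorem hA_mul_anti_slE : hA * anti slE = anti slE * hA + (2 : ℤ) • anti slE := by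
  rw [hA, diag_mul_anti, lie_slH_slE, anti_smul, ← Int.cast_smul_eq_zsmul ℂ]; norm_num

theorem hA_mul_diag_slF : hA * diag slF = diag slF * hA + (-2 : ℤ) • diag slF := by
  rw [hA, diag_mul_diag, lie_slH_slF, diag_smul, ← Int.cast_smul_eq_zsmul ℂ]; norm_num

theorem hA_mul_anti_slH : hA * anti slH = anti slH * hA + (0 : ℤ) • anti slH := by
  have : anti (0 : Sl2) = 0 := by simpa using anti_smul 0 (0 : Sl2)
  rw [hA, diag_mul_anti, lie_self, this, zero_smul]

theorem e_mul_f : e * f = f * e + uhToAbar hU := by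
  rw [uhToAbar_hU, e, f, ← map_mul, diag_mul_diag, lie_slE_slF, map_add, map_mul]; rfl

theorem e_mul_E : e * E = E * e := by
  have : anti (0 : Sl2) = 0 := by simpa using anti_smul 0 (0 : Sl2)
  rw [e, E, ← map_mul, diag_mul_anti, lie_self, this, add_zero, map_mul]

theorem e_mul_F : e * F = F * e + H := by
  rw [e, F, ← map_mul, diag_mul_anti, lie_slE_slF, map_add, map_mul]; rfl

theorem e_mul_H : e * H = H * e - 2 * E := by
  have : ⁅slE, slH⁆ = (-2 : ℂ) • slE := by rw [← lie_skew, lie_slH_slE, neg_smul]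
  rw [e, H, ← map_mul, diag_mul_anti, this, anti_smul]
  have h2 : (-2 : ℂ) • anti slE = -(2 * anti slE) := by
    rw [neg_smul, two_smul, two_mul]
  rw [h2, map_add, map_neg, map_mul, map_mul, map_ofNat, sub_eq_add_neg]; rfl

theorem uhToAbar_mul {a : A} {m : ℤ} (ha : hA * a = a * hA + m • a) (u : Uh) :
    uhToAbar u * toAbar a = toAbar a * uhToAbar (shift m u) := by
  have hp : ∀ p : ℂ[X], aeval hA p * a = a * aeval hA (p.comp (X + C (m : ℂ))) := by
    intro p
    induction p using Polynomial.induction_on' with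
    | add p q hp hq => simp only [map_add, add_mul, add_comp, mul_add, hp, hq]
    | monomial n c =>
      have hX : hA ^ n * a = a * (hA + m) ^ n := by
        have : SemiconjBy a (hA + m) hA := by
          change a * (hA + m) = hA * a
          rw [ha, mul_add, zsmul_eq_mul, (Int.commute_cast a m).eq]
        exact ((this.pow_right n).eq).symm
      rw [← C_mul_X_pow_eq_monomial]
      simp only [map_mul, aeval_C, map_pow, aeval_X, mul_comp, C_comp, X_pow_comp, map_add,
        map_intCast]
      rw [mul_assoc, hX, ← mul_assoc, Algebra.commutes, mul_assoc]
  obtain ⟨p, s, rfl⟩ := IsLocalization.exists_mk'_eq (shiftedMonoid (X : ℂ[X])) u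
  have hs : ∀ q : ℂ[X], uhToAbar (algebraMap ℂ[X] Uh q) * toAbar a
      = toAbar a * uhToAbar (shift m (algebraMap ℂ[X] Uh q)) := by
    intro q
    rw [shift, IsLocalization.map_eq, uhToAbar_algebraMap, uhToAbar_algebraMap, ← map_mul, hp,
      map_mul]
    rfl
  have hu : IsUnit (uhToAbar (shift m (algebraMap ℂ[X] Uh s))) :=
    ((IsLocalization.map_units Uh s).map (shift m)).map uhToAbar
  refine hu.mul_right_cancel ?_
  rw [mul_assoc, ← hs, ← mul_assoc, ← map_mul, IsLocalization.mk'_spec, hs, mul_assoc, ← map_mul,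
    ← map_mul, IsLocalization.mk'_spec]

theorem shift_neg_shift (m : ℤ) (u : Uh) : shift m (shift (-m) u) = u := by
  have : (shift m).comp (shift (-m)) = RingHom.id Uh := by
    refine IsLocalization.ringHom_ext (shiftedMonoid (X : ℂ[X])) ?_
    ext x
    · simp [shift, IsLocalization.map_eq]
    · simp [shift, IsLocalization.map_eq]
  exact DFunLike.congr_fun this u

theorem uhToAbar_mul_e (u : Uh) : uhToAbar u * e = e * uhToAbar (shift 2 u) :=
  uhToAbar_mul hA_mul_diag_slE u

theorem uhToAbar_mul_E (u : Uh) : uhToAbar u * E = E * uhToAbar (shift 2 u) :=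
  uhToAbar_mul hA_mul_anti_slE u

theorem mul_e_mul_mem (a : Abar) (u : Uh) : a * e * uhToAbar u ∈ Iplus := by
  have := uhToAbar_mul_e (shift (-2) u)
  rw [shift_neg_shift] at this
  rw [mul_assoc, ← this, ← mul_assoc]
  exact Ideal.mul_mem_left _ _ (Ideal.subset_span rfl)

theorem mul_e_mem (a : Abar) : a * e ∈ Iplus := Ideal.mul_mem_left _ _ (Ideal.subset_span rfl)

/-! ### The subalgebra `Ū(𝔥)` and the generators of `DR(sl₂)` -/

theorem uhToAbar_mem (u : Uh) : uhToAbar u ∈ normalizer Iplus := by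
  refine mem_normalizer_span.2 ?_
  have := mul_e_mul_mem 1 u
  rwa [one_mul] at this

/-- The embedding `Ū(𝔥) → DR(sl₂)`, `u(h) ↦ u(h)`. -/
def ofUh : Uh →+* DR := toDR.comp (uhToAbar.codRestrict (normalizer Iplus) uhToAbar_mem)

/-- The representative `E` of `z₊`. -/
def zPlusLift : Abar := E

/-- The representative `H + 2 f E (h + 2)⁻¹` of `t`; it is the only element of the reduction algebra
congruent to `H` modulo `f Ā + Ā e`. -/
def tLift : Abar := H + f * E * uhToAbar (2 * ↑(hUnit 2)⁻¹)

/-- The representative `F - f H h⁻¹ - f² E (h (h + 1))⁻¹` of `z₋`; it is the only element of the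
reduction algebra congruent to `F` modulo `f Ā + Ā e`. -/
def zMinusLift : Abar :=
  F - f * H * uhToAbar ↑(hUnit 0)⁻¹ - f * f * E * uhToAbar ↑(hUnit 0 * hUnit 1)⁻¹

theorem zPlusLift_mem : zPlusLift ∈ normalizer Iplus := by
  refine mem_normalizer_span.2 ?_
  rw [zPlusLift, e_mul_E]
  exact mul_e_mem E

theorem shift_hU (n : ℤ) : shift n hU = hU + (n : Uh) := by
  simp [shift, hU, IsLocalization.map_eq]

theorem coe_hUnit (l : ℤ) : (hUnit l : Uh) = hU + (l : Uh) := rfl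

theorem tLift_mem : tLift ∈ normalizer Iplus := by
  refine mem_normalizer_span.2 ?_
  have h1 : E * uhToAbar (shift 2 hU) * uhToAbar (2 * ↑(hUnit 2)⁻¹) = 2 * E := by
    rw [mul_assoc, ← map_mul, shift_hU, ← coe_hUnit, mul_left_comm, Units.mul_inv, mul_one,
      map_ofNat, mul_two, two_mul]
  have : e * tLift = H * e + f * E * e * uhToAbar (2 * ↑(hUnit 2)⁻¹) := by
    rw [tLift, mul_add, e_mul_H, ← mul_assoc, ← mul_assoc, e_mul_f, add_mul, uhToAbar_mul_E,
      add_mul, h1, mul_assoc f e E, e_mul_E]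
    noncomm_ring
  rw [this]
  exact add_mem (mul_e_mem _) (mul_e_mul_mem _ _)

theorem zMinusLift_mem : zMinusLift ∈ normalizer Iplus := by
  refine mem_normalizer_span.2 ?_
  set a : Uh := ↑(hUnit 0)⁻¹ with ha
  set b : Uh := ↑(hUnit 0 * hUnit 1)⁻¹ with hb
  have hab : (hU + 1) * b = a := by
    have h0 : (hUnit 0 : Uh) * a = 1 := Units.mul_inv _
    have h1 : (hUnit 1 : Uh) = hU + 1 := by simp [coe_hUnit]
    have h2 : (hUnit 0 : Uh) * hUnit 1 * b = 1 := Units.mul_inv (hUnit 0 * hUnit 1)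
    rw [← h1]
    linear_combination a * h2 - hUnit 1 * b * h0
  have hha : hU * a = 1 := by
    have : (hUnit 0 : Uh) = hU := by simp [coe_hUnit]
    rw [ha, ← this, Units.mul_inv]
  have hH : uhToAbar hU * H * uhToAbar a = H := by
    have := uhToAbar_mul hA_mul_anti_slH hU
    rw [shift_hU, Int.cast_zero, add_zero] at this
    rw [H, this, mul_assoc, ← map_mul, hha, map_one, mul_one]
  have hE : uhToAbar hU * E = E * uhToAbar (hU + 2) := by
    rw [uhToAbar_mul_E, shift_hU]; norm_cast
  have hf : uhToAbar hU * f = f * uhToAbar (hU - 2) := by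
    rw [f, uhToAbar_mul hA_mul_diag_slF, shift_hU]
    push_cast
    rw [sub_eq_add_neg]
  have hE' : uhToAbar (hU - 2) * E = E * uhToAbar hU := by
    rw [map_sub, sub_mul, hE, map_add, mul_add, map_ofNat]
    noncomm_ring
  have h1 : e * (f * H * uhToAbar a) = f * H * e * uhToAbar a - 2 * (f * E * uhToAbar a) + H := by
    rw [← mul_assoc, ← mul_assoc, e_mul_f, add_mul, add_mul, hH, mul_assoc f e H, e_mul_H]
    noncomm_ring
  have h2 : e * (f * f * E * uhToAbar b) = f * f * E * e * uhToAbar b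
      + 2 * (f * E * uhToAbar a) := by
    have : e * (f * f * E) = f * f * E * e + f * E * uhToAbar (hU + 2) + f * E * uhToAbar hU := by
      calc e * (f * f * E) = e * f * f * E := by noncomm_ring
        _ = (f * e + uhToAbar hU) * f * E := by rw [e_mul_f]
        _ = f * (e * f) * E + uhToAbar hU * f * E := by noncomm_ring
        _ = f * (f * e + uhToAbar hU) * E + f * uhToAbar (hU - 2) * E := by rw [e_mul_f, hf]
        _ = f * f * (e * E) + f * (uhToAbar hU * E) + f * (uhToAbar (hU - 2) * E) := by
          noncomm_ring
        _ = _ := by rw [hE, hE', e_mul_E]; noncomm_ring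
    rw [← mul_assoc, this, add_mul, add_mul, add_assoc, mul_assoc (f * E), mul_assoc (f * E),
      ← map_mul, ← map_mul, ← mul_add, ← map_add, ← add_mul]
    have h3 : (hU + 2 + hU) * b = 2 * a := by rw [← hab]; ring
    rw [h3, map_mul, map_ofNat]
    noncomm_ring
  have : e * zMinusLift = F * e - f * H * e * uhToAbar a - f * f * E * e * uhToAbar b := by
    rw [zMinusLift, mul_sub, mul_sub, h1, h2, e_mul_F]
    noncomm_ring
  rw [this]
  exact sub_mem (sub_mem (mul_e_mem _) (mul_e_mul_mem _ _)) (mul_e_mul_mem _ _)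

/-- The generator `z₊` of `DR(sl₂)`. -/
def zPlus : DR := toDR ⟨zPlusLift, zPlusLift_mem⟩

/-- The generator `z₋` of `DR(sl₂)`. -/
def zMinus : DR := toDR ⟨zMinusLift, zMinusLift_mem⟩

/-- The generator `t` of `DR(sl₂)`. -/
def t : DR := toDR ⟨tLift, tLift_mem⟩

/-- The element `h` of `DR(sl₂)`. -/
def h : DR := ofUh hU

/-! ### Automorphisms of `DR(sl₂)` -/

/-- An automorphism reverses the weights, `μ ↦ -μ`, where `x` has weight `μ` if `[h, x] = μ x`. -/
def ReversesWeights (φ : DR ≃ₐ[ℂ] DR) : Prop :=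
  ∀ (μ : ℂ) (x : DR), h * x - x * h = μ • x → h * φ x - φ x * h = (-μ) • φ x

/-- An element is linear over `Ū(𝔥)` in the generators `z₊`, `z₋`, `t`. -/
def IsLinear (x : DR) : Prop :=
  ∃ a b c : Uh, x = zPlus * ofUh a + zMinus * ofUh b + t * ofUh c

/-- An automorphism is linear over `Ū(𝔥)` in the generators: it maps `h` to an element of `Ū(𝔥)`,
and each of `z₊`, `z₋`, `t` to an expression linear over `Ū(𝔥)` in them. -/
def LinearInGenerators (φ : DR ≃ₐ[ℂ] DR) : Prop :=
  (∃ u : Uh, φ h = ofUh u) ∧ IsLinear (φ zPlus) ∧ IsLinear (φ zMinus) ∧ IsLinear (φ t)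

/-- The formulas `h ↦ -h - 2`, `t ↦ β t (h + 2) / h`, `z₊ ↦ z₋ / ((h - 1) γ(h))`,
`z₋ ↦ z₊ (h + 3) γ(h + 2)`. -/
def HasForm (β : ℂ) (γ : Uhˣ) (φ : DR ≃ₐ[ℂ] DR) : Prop :=
  φ h = -h - 2 ∧
  φ t = β • (t * ofUh ↑(hUnit 2 * (hUnit 0)⁻¹)) ∧
  φ zPlus = zMinus * ofUh ↑(hUnit (-1) * γ)⁻¹ ∧
  φ zMinus = zPlus * ofUh (↑(hUnit 3) * shift 2 γ)

end

end DiagonalReduction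

namespace DiagonalReduction

noncomputable section

open Polynomial LieAlgebra.SpecialLinear

attribute [local instance 100] LieRing.ofAssociativeRing

/-! ### Commutation rules -/

/-! The proof rests on a presentation of `DR` and a faithful representation of it.

Modulo `Ā e`, the algebra `Ā` is the direct sum of the `f ^ i Norm(Ā e)`: multiplication by `e`
lowers the power of `f` up to the factor `(i + 1) (h - i)`, which localization makes invertible.
Hence a class in `DR` is determined by its representative modulo `f Ā + Ā e`
(`mem_Iplus_of_eq_f_mul_add`), relations may be computed modulo that sum, and `z₊`, `z₋`, `t`
generate `DR` over `Ū(𝔥)` (`subring_DR_eq_top`). The relations yield two central elements `casOne`,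
`casTwo`, and `DR` is spanned over `Ū(𝔥)[casOne, casTwo]` by the powers of `z₊` and of `z₋`
(`sumHom_surjective`).

For faithfulness, let the two copies of `sl₂` act by differential operators of highest weights `L`,
`M` in variables `x + y` and `x`. Then `e` is `∂_x`, its kernel is spanned formally by the powers `y
^ (s + n)`, and `DR` acts on that kernel: `z₊` and `z₋` shift `n`, `t` is diagonal, and the two
central elements act by `4 (L + 1)²` and `4 (M + 1)²`. With `h`, `L`, `M` algebraically independent,
all shift coefficients are nonzero and the action is faithful (`rep_injective`).

Existence of automorphisms: extend `h ↦ -h - 2` to the generic field, fixing or exchanging `L` and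
`M`, and combine this with `n ↦ -n` and a rescaling `κ`. The pairs of elements of `DR` intertwined
by this bijection form a subring of `DR × DR`; faithfulness and generation make it the graph of an
automorphism (`exists_ringEquiv`). The exchange gives `β = 1` and the trivial extension gives `β =
-1`, while `κ` realizes an arbitrary `γ`. Uniqueness is generation by the generators.

Conversely, reversing weights forces `h ↦ u`, `z₊ ↦ z₋ b`, `z₋ ↦ z₊ a`, `t ↦ t c`. As `z₋ z₊`, `t²`
and `1` are independent over `Ū(𝔥)`, the relation for `z₊ z₋` gives `(c h)² = u²` and an equation
for `a`, `b` (`coeff_relations`). The relation between `z₊` and `t` then leaves only `u = -h - 2`,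
and the remaining freedom is a sign and a unit. -/

theorem anti_mul_diag (x y : Sl2) : anti x * diag y = diag y * anti x + anti ⁅x, y⁆ := by
  have := LieHom.map_lie (UniversalEnvelopingAlgebra.ι ℂ) ((x, -x) : G) (y, y)
  rw [Ring.lie_def] at this
  rw [← sub_eq_iff_eq_add', anti, anti, diag, ← this]
  simp

theorem anti_mul_anti (x y : Sl2) : anti x * anti y = anti y * anti x + diag ⁅x, y⁆ := by
  have := LieHom.map_lie (UniversalEnvelopingAlgebra.ι ℂ) ((x, -x) : G) (y, -y)
  rw [Ring.lie_def] at this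
  rw [← sub_eq_iff_eq_add', anti, anti, diag, ← this]
  simp

theorem E_mul_f : E * f = f * E + H := by
  rw [E, f, ← map_mul, anti_mul_diag, lie_slE_slF, map_add, map_mul]; rfl

theorem F_mul_f : F * f = f * F := by
  have h0 : anti (0 : Sl2) = 0 := by simpa using anti_smul 0 (0 : Sl2)
  rw [F, f, ← map_mul, anti_mul_diag, lie_self, h0, add_zero, map_mul]

theorem H_mul_f : H * f = f * H - 2 * F := by
  have h2 : (-2 : ℂ) • anti slF = -(2 * anti slF) := by rw [neg_smul, two_smul, two_mul]
  rw [H, f, ← map_mul, anti_mul_diag, lie_slH_slF, anti_smul, h2, map_add, map_neg, map_mul,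
    map_mul, map_ofNat, sub_eq_add_neg]; rfl

theorem E_mul_F : E * F = F * E + uhToAbar hU := by
  rw [uhToAbar_hU, E, F, ← map_mul, anti_mul_anti, lie_slE_slF, map_add, map_mul]; rfl

theorem H_mul_E : H * E = E * H + 2 * e := by
  have h2 : (2 : ℂ) • diag slE = 2 * diag slE := by rw [two_smul, two_mul]
  rw [H, E, ← map_mul, anti_mul_anti, lie_slH_slE, diag_smul, h2, map_add, map_mul, map_mul,
    map_ofNat]; rfl

theorem H_mul_F : H * F = F * H - 2 * f := by
  have h2 : (-2 : ℂ) • diag slF = -(2 * diag slF) := by rw [neg_smul, two_smul, two_mul]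
  rw [H, F, ← map_mul, anti_mul_anti, lie_slH_slF, diag_smul, h2, map_add, map_neg, map_mul,
    map_mul, map_ofNat, sub_eq_add_neg]; rfl

theorem hA_mul_anti_slF : hA * anti slF = anti slF * hA + (-2 : ℤ) • anti slF := by
  rw [hA, diag_mul_anti, lie_slH_slF, anti_smul, ← Int.cast_smul_eq_zsmul ℂ]; norm_num

theorem uhToAbar_mul_f (u : Uh) : uhToAbar u * f = f * uhToAbar (shift (-2) u) :=
  uhToAbar_mul hA_mul_diag_slF u

theorem uhToAbar_mul_F (u : Uh) : uhToAbar u * F = F * uhToAbar (shift (-2) u) :=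
  uhToAbar_mul hA_mul_anti_slF u

theorem shift_zero (u : Uh) : shift 0 u = u := by
  have : shift 0 = RingHom.id Uh := by
    refine IsLocalization.ringHom_ext (shiftedMonoid (X : ℂ[X])) ?_
    ext x <;> simp [shift]
  exact DFunLike.congr_fun this u

theorem uhToAbar_mul_H (u : Uh) : uhToAbar u * H = H * uhToAbar u := by
  have := uhToAbar_mul hA_mul_anti_slH u
  rwa [shift_zero] at this

/-! ### Generation of `Ā` -/

theorem mem_of_shiftedMonoid_inv (s : shiftedMonoid hA) :
    ∃ u : Uh, uhToAbar u * toAbar s = 1 ∧ toAbar s * uhToAbar u = 1 := by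
  obtain ⟨s, hs⟩ := s
  induction hs using Submonoid.closure_induction with
  | mem x hx =>
    obtain ⟨l, rfl⟩ := hx
    have : toAbar (hA + algebraMap ℂ A (l : ℂ)) = uhToAbar (hUnit l : Uh) := by
      rw [coe_hUnit, map_add, map_add, uhToAbar_hU]; simp
    exact ⟨↑(hUnit l)⁻¹, by simp only [this, ← map_mul, Units.inv_mul, map_one],
      by simp only [this, ← map_mul, Units.mul_inv, map_one]⟩
  | one => exact ⟨1, by simp⟩
  | mul x y _ _ hx hy =>
    obtain ⟨u, hu, hu'⟩ := hx
    obtain ⟨v, hv, hv'⟩ := hy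
    refine ⟨u * v, ?_, ?_⟩
    · simp only at *
      rw [mul_comm u, map_mul, map_mul, mul_assoc, ← mul_assoc _ (toAbar x), hu, one_mul, hv]
    · simp only at *
      rw [mul_comm u, map_mul, map_mul, mul_assoc, ← mul_assoc _ (uhToAbar v), hv', one_mul, hu']

/-- The inverses of the Ore denominators already lie in the image of `Ū(𝔥)`, so generating `Ā`
reduces to generating `A`. -/
theorem exists_eq_uhToAbar_mul (a : Abar) : ∃ (u : Uh) (b : A), a = uhToAbar u * toAbar b := by
  induction a using OreLocalization.ind with
  | c r s =>
    obtain ⟨u, hu, -⟩ := mem_of_shiftedMonoid_inv s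
    refine ⟨u, r, ?_⟩
    have h1 : toAbar s * (show Abar from OreLocalization.oreDiv r s) = toAbar r :=
      (OreLocalization.oreDiv_mul_char _ _ _ _ 1 1 (by simp)).trans (by simp; rfl)
    rw [← h1, ← mul_assoc, hu, one_mul]

theorem ι_eq (x : G) : ∃ p q : Sl2, UniversalEnvelopingAlgebra.ι ℂ x = diag p + anti q := by
  refine ⟨(1 / 2 : ℂ) • (x.1 + x.2), (1 / 2 : ℂ) • (x.1 - x.2), ?_⟩
  rw [diag, anti, ← map_add]
  congr 1
  ext1
  · simp only [Prod.mk_add_mk]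
    rw [← smul_add, add_add_sub_cancel, ← two_smul ℂ x.1, smul_smul]; norm_num
  · simp only [Prod.mk_add_mk]
    rw [← sub_eq_add_neg, ← smul_sub, add_sub_sub_cancel, ← two_smul ℂ x.2, smul_smul]; norm_num

theorem diag_add (x y : Sl2) : diag (x + y) = diag x + diag y := by
  rw [diag, diag, diag, ← map_add]; rfl

theorem anti_add (x y : Sl2) : anti (x + y) = anti x + anti y := by
  rw [anti, anti, anti, ← map_add]
  congr 1
  ext1
  · rfl
  · simp [add_comm]

theorem toAbar_smul (c : ℂ) (a : A) : toAbar (c • a) = uhToAbar (algebraMap ℂ[X] Uh (C c)) * toAbar a := by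
  rw [uhToAbar_algebraMap, aeval_C, Algebra.smul_def, map_mul]

/-- The algebra `Ā` is generated by `Ū(𝔥)` and `e`, `f`, `E`, `F`, `H`. -/
theorem subring_eq_top (R : Subring Abar) (hu : ∀ u, uhToAbar u ∈ R) (he : e ∈ R) (hf : f ∈ R)
    (hE : E ∈ R) (hF : F ∈ R) (hH : H ∈ R) : R = ⊤ := by
  have hd : ∀ x, toAbar (diag x) ∈ R := by
    intro x
    rw [sl2_decomp x, diag_add, diag_add, diag_smul, diag_smul, diag_smul]
    simp only [map_add, toAbar_smul]
    refine add_mem (add_mem (mul_mem (hu _) he) (mul_mem (hu _) hf)) (mul_mem (hu _) ?_)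
    have := hu hU
    rwa [uhToAbar_hU] at this
  have ha : ∀ x, toAbar (anti x) ∈ R := by
    intro x
    rw [sl2_decomp x, anti_add, anti_add, anti_smul, anti_smul, anti_smul]
    simp only [map_add, toAbar_smul]
    exact add_mem (add_mem (mul_mem (hu _) hE) (mul_mem (hu _) hF)) (mul_mem (hu _) hH)
  let B : Subalgebra ℂ A :=
    { R.comap toAbar with
      algebraMap_mem' := fun c => by
        have := hu (algebraMap ℂ[X] Uh (C c))
        rwa [uhToAbar_algebraMap, aeval_C] at this }
  have hB : ∀ x : G, UniversalEnvelopingAlgebra.ι ℂ x ∈ B := by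
    intro x
    obtain ⟨p, q, h⟩ := ι_eq x
    rw [h]
    exact add_mem (hd p) (ha q)
  let g : G →ₗ⁅ℂ⁆ B :=
    { toFun := fun x => ⟨_, hB x⟩
      map_add' := fun x y => Subtype.ext (map_add _ _ _)
      map_smul' := fun c x => Subtype.ext (LinearMapClass.map_smul _ _ _)
      map_lie' := fun {x y} => Subtype.ext (LieHom.map_lie _ _ _) }
  -- The inclusion `ι` factors through `B`, so by the universal property the identity of `A` does
  -- too; hence `B` is everything.
  have hg : B.val.comp (UniversalEnvelopingAlgebra.lift ℂ g) = AlgHom.id ℂ A := by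
    apply UniversalEnvelopingAlgebra.hom_ext
    ext x <;> simp [g]
  have hA' : ∀ a : A, toAbar a ∈ R := by
    intro a
    have : (UniversalEnvelopingAlgebra.lift ℂ g a : A) = a := DFunLike.congr_fun hg a
    rw [← this]
    exact (UniversalEnvelopingAlgebra.lift ℂ g a).2
  refine eq_top_iff.2 fun a _ => ?_
  obtain ⟨u, b, rfl⟩ := exists_eq_uhToAbar_mul a
  exact mul_mem (hu u) (hA' b)

/-! ### The structure of `Ā / Ā e` -/

theorem e_mul_mem_of_mem_normalizer {n : Abar} (hn : n ∈ normalizer Iplus) : e * n ∈ Iplus :=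
  mem_normalizer_span.1 hn

theorem uhToAbar_mul_mem_normalizer {n : Abar} (u : Uh) (hn : n ∈ normalizer Iplus) :
    uhToAbar u * n ∈ normalizer Iplus := mul_mem (uhToAbar_mem u) hn

/-- The usual `sl₂` identity with `h` moved to the right. The factor `(i + 1) (h - i)` is a unit of
`Ū(𝔥)`, and this is what makes the decomposition by powers of `f` direct. -/
theorem e_mul_f_pow (i : ℕ) :
    e * f ^ (i + 1) = f ^ (i + 1) * e + f ^ i * uhToAbar ((i + 1) * (hU - i)) := by
  induction i with
  | zero => simp [e_mul_f]
  | succ i ih =>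
    have h1 : uhToAbar ((i + 1) * (hU - i)) * f = f * uhToAbar ((i + 1) * (hU - 2 - i)) := by
      rw [uhToAbar_mul_f, map_mul, map_sub, shift_hU]
      congr 2
      simp [sub_eq_add_neg]
    rw [pow_succ, ← mul_assoc, ih, add_mul, mul_assoc, e_mul_f, mul_assoc (f ^ i), h1, mul_add,
      ← mul_assoc, ← mul_assoc, ← pow_succ, add_assoc, ← pow_succ f i, ← mul_add, ← map_add]
    congr 3
    push_cast
    ring

theorem isUnit_natCast_uh (i : ℕ) : IsUnit ((i : Uh) + 1) := by
  have h0 : ((i : ℂ) + 1) ≠ 0 := by exact_mod_cast Nat.succ_ne_zero i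
  have := (IsUnit.mk0 _ h0).map ((algebraMap ℂ[X] Uh).comp C)
  simpa using this

/-- If `u n ∈ Ā e` with `u` invertible, then `n ∈ Ā e`. -/
theorem mem_of_uhToAbar_mul_mem {u : Uh} (hu : IsUnit u) {n : Abar}
    (h : uhToAbar u * n ∈ Iplus) : n ∈ Iplus := by
  obtain ⟨v, rfl⟩ := hu
  have := Ideal.mul_mem_left Iplus (uhToAbar ↑v⁻¹) h
  rwa [← mul_assoc, ← map_mul, Units.inv_mul, map_one, one_mul] at this

/-- The sum of the `f ^ i Norm(Ā e)` is direct modulo `Ā e`. -/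
theorem mem_of_sum_f_pow_mul_mem (k : ℕ) (n : ℕ → Abar) (hn : ∀ i, n i ∈ normalizer Iplus)
    (h : ∑ i ∈ Finset.range k, f ^ i * n i ∈ Iplus) : ∀ i < k, n i ∈ Iplus := by
  induction k generalizing n with
  | zero => simp
  | succ k ih =>
    -- Multiplication by `e` sends the term with `i = 0` into `Ā e` and lowers the power of `f` in
    -- the others by one, because `e` times an element of the normalizer lies in `Ā e`. The
    -- coefficients stay in the normalizer, so induction applies.
    have h1 : ∑ i ∈ Finset.range k, f ^ i * (uhToAbar ((i + 1) * (hU - i)) * n (i + 1)) ∈ Iplus := by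
      have h2 := Ideal.mul_mem_left Iplus e h
      rw [Finset.sum_range_succ', mul_add, pow_zero, one_mul] at h2
      have h3 := sub_mem (sub_mem h2 (e_mul_mem_of_mem_normalizer (hn 0)))
        (sum_mem (t := Finset.range k) fun i _ => Ideal.mul_mem_left Iplus (f ^ (i + 1))
          (e_mul_mem_of_mem_normalizer (hn (i + 1))))
      rw [add_sub_cancel_right, Finset.mul_sum, ← Finset.sum_sub_distrib] at h3
      convert h3 using 2 with i
      rw [← mul_assoc e, e_mul_f_pow, add_mul (f ^ _ * e), mul_assoc, mul_assoc, add_sub_cancel_left]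
    have h2 := ih _ (fun i => uhToAbar_mul_mem_normalizer _ (hn (i + 1))) h1
    have h3 : ∀ i < k, n (i + 1) ∈ Iplus := fun i hi => by
      refine mem_of_uhToAbar_mul_mem ((isUnit_natCast_uh i).mul ?_) (h2 i hi)
      simpa [sub_eq_add_neg] using isUnit_hU_add (-i)
    rw [Finset.sum_range_succ', pow_zero, one_mul] at h
    have h4 := (Submodule.add_mem_iff_right Iplus (sum_mem fun i hi =>
      Ideal.mul_mem_left Iplus (f ^ (i + 1)) (h3 i (Finset.mem_range.1 hi)))).1 h
    rintro (_ | i) hi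
    · exact h4
    · exact h3 i (by omega)

/-- The representatives of the elements of a subring of `DR(sl₂)`. -/
def lifts (S : Subring DR) : Subring Abar := (S.comap toDR).map (normalizer Iplus).val.toRingHom

theorem mem_lifts {S : Subring DR} {a : Abar} :
    a ∈ lifts S ↔ ∃ ha : a ∈ normalizer Iplus, toDR ⟨a, ha⟩ ∈ S := by
  constructor
  · rintro ⟨b, hb, rfl⟩
    exact ⟨b.2, hb⟩
  · rintro ⟨ha, h⟩
    exact ⟨⟨a, ha⟩, h, rfl⟩

theorem toDR_eq_zero {a : Abar} (ha : a ∈ normalizer Iplus) : toDR ⟨a, ha⟩ = 0 ↔ a ∈ Iplus :=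
  Ideal.Quotient.eq_zero_iff_mem

theorem mem_normalizer_of_mem {a : Abar} (ha : a ∈ Iplus) : a ∈ normalizer Iplus :=
  mem_normalizer_span.2 (Ideal.mul_mem_left _ _ ha)

theorem mem_lifts_of_mem (S : Subring DR) {a : Abar} (ha : a ∈ Iplus) : a ∈ lifts S :=
  mem_lifts.2 ⟨mem_normalizer_of_mem ha, by rw [(toDR_eq_zero _).2 ha]; exact zero_mem S⟩

/-- The sums of elements `f ^ i n`, where `n` represents an element of a subring of `DR(sl₂)`. -/
def lowerSpan (S : Subring DR) : AddSubgroup Abar :=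
  AddSubgroup.closure {x | ∃ (i : ℕ) (n : Abar), n ∈ lifts S ∧ x = f ^ i * n}

section

variable {S : Subring DR}

theorem mem_lowerSpan {n : Abar} (i : ℕ) (hn : n ∈ lifts S) : f ^ i * n ∈ lowerSpan S :=
  AddSubgroup.subset_closure ⟨i, n, hn, rfl⟩

theorem mem_lowerSpan_of_mem {n : Abar} (hn : n ∈ lifts S) : n ∈ lowerSpan S := by
  simpa using mem_lowerSpan 0 hn

theorem mul_mem_lowerSpan {a : Abar} (h : ∀ (i : ℕ) (n : Abar), n ∈ lifts S →
    a * (f ^ i * n) ∈ lowerSpan S) : ∀ x ∈ lowerSpan S, a * x ∈ lowerSpan S := by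
  intro x hx
  induction hx using AddSubgroup.closure_induction with
  | mem x hx => obtain ⟨i, n, hn, rfl⟩ := hx; exact h i n hn
  | zero => simp
  | add x y _ _ hx hy => rw [mul_add]; exact add_mem hx hy
  | neg x _ hx => rw [mul_neg]; exact neg_mem hx

theorem f_mul_mem_lowerSpan : ∀ x ∈ lowerSpan S, f * x ∈ lowerSpan S :=
  mul_mem_lowerSpan fun i n hn => by
    rw [← mul_assoc, ← pow_succ']; exact mem_lowerSpan _ hn

theorem two_mul_mem_lowerSpan {x : Abar} (hx : x ∈ lowerSpan S) : 2 * x ∈ lowerSpan S := by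
  rw [two_mul]; exact add_mem hx hx

/-- The span contains `1` and is stable under left multiplication by every generator of `Ā`.
Commuting past `f` turns `E` into `H`, `H` into `F`, and leaves `F` alone, so stability is proved
for `F`, then `H`, then `E`. On lifts, `H` and `F` are recovered from `tLift` and `zMinusLift` up to
terms beginning with `f`. -/
theorem lowerSpan_eq_top (hS : ∀ u, ofUh u ∈ S) (hzp : zPlus ∈ S) (hzm : zMinus ∈ S)
    (ht : t ∈ S) : lowerSpan S = ⊤ := by
  have hS' : ∀ u, uhToAbar u ∈ lifts S := fun u => mem_lifts.2 ⟨uhToAbar_mem u, hS u⟩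
  have hzp' : E ∈ lifts S := mem_lifts.2 ⟨zPlusLift_mem, hzp⟩
  have hzm' : zMinusLift ∈ lifts S := mem_lifts.2 ⟨zMinusLift_mem, hzm⟩
  have ht' : tLift ∈ lifts S := mem_lifts.2 ⟨tLift_mem, ht⟩
  have hf := f_mul_mem_lowerSpan (S := S)
  have hU : ∀ u : Uh, ∀ x ∈ lowerSpan S, uhToAbar u * x ∈ lowerSpan S := fun u =>
    mul_mem_lowerSpan fun i n hn => by
      induction i generalizing u with
      | zero => rw [pow_zero, one_mul]; exact mem_lowerSpan_of_mem (mul_mem (hS' u) hn)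
      | succ i ih =>
        rw [pow_succ', mul_assoc, ← mul_assoc, uhToAbar_mul_f, mul_assoc]
        exact hf _ (ih _)
  have he : ∀ x ∈ lowerSpan S, e * x ∈ lowerSpan S :=
    mul_mem_lowerSpan fun i n hn => by
      have hen : e * n ∈ lifts S :=
        mem_lifts_of_mem S (e_mul_mem_of_mem_normalizer (mem_lifts.1 hn).1)
      cases i with
      | zero => rw [pow_zero, one_mul]; exact mem_lowerSpan_of_mem hen
      | succ i =>
        rw [← mul_assoc, e_mul_f_pow, add_mul, mul_assoc, mul_assoc]
        exact add_mem (mem_lowerSpan _ hen) (mem_lowerSpan _ (mul_mem (hS' _) hn))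
  have hH0 : ∀ n ∈ lifts S, H * n ∈ lowerSpan S := fun n hn => by
    have : H * n = tLift * n - f * (E * uhToAbar (2 * ↑(hUnit 2)⁻¹) * n) := by
      rw [tLift]; noncomm_ring
    rw [this]
    exact sub_mem (mem_lowerSpan_of_mem (mul_mem ht' hn))
      (hf _ (mem_lowerSpan_of_mem (mul_mem (mul_mem hzp' (hS' _)) hn)))
  have hF0 : ∀ n ∈ lifts S, F * n ∈ lowerSpan S := fun n hn => by
    have : F * n = zMinusLift * n + f * (H * (uhToAbar ↑(hUnit 0)⁻¹ * n))
        + f * (f * (E * uhToAbar ↑(hUnit 0 * hUnit 1)⁻¹ * n)) := by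
      rw [zMinusLift]; noncomm_ring
    rw [this]
    exact add_mem (add_mem (mem_lowerSpan_of_mem (mul_mem hzm' hn))
      (hf _ (hH0 _ (mul_mem (hS' _) hn))))
      (hf _ (hf _ (mem_lowerSpan_of_mem (mul_mem (mul_mem hzp' (hS' _)) hn))))
  have hF : ∀ x ∈ lowerSpan S, F * x ∈ lowerSpan S :=
    mul_mem_lowerSpan fun i n hn => by
      induction i with
      | zero => rw [pow_zero, one_mul]; exact hF0 n hn
      | succ i ih =>
        rw [pow_succ', mul_assoc, ← mul_assoc, F_mul_f, mul_assoc]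
        exact hf _ ih
  have hH : ∀ x ∈ lowerSpan S, H * x ∈ lowerSpan S :=
    mul_mem_lowerSpan fun i n hn => by
      induction i with
      | zero => rw [pow_zero, one_mul]; exact hH0 n hn
      | succ i ih =>
        rw [pow_succ', mul_assoc, ← mul_assoc, H_mul_f, sub_mul, mul_assoc, mul_assoc 2]
        exact sub_mem (hf _ ih) (two_mul_mem_lowerSpan (hF _ (mem_lowerSpan _ hn)))
  have hE : ∀ x ∈ lowerSpan S, E * x ∈ lowerSpan S :=
    mul_mem_lowerSpan fun i n hn => by
      induction i with
      | zero => rw [pow_zero, one_mul]; exact mem_lowerSpan_of_mem (mul_mem hzp' hn)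
      | succ i ih =>
        rw [pow_succ', mul_assoc, ← mul_assoc, E_mul_f, add_mul, mul_assoc]
        exact add_mem (hf _ ih) (hH _ (mem_lowerSpan _ hn))
  let R : Subring Abar :=
    { carrier := {a | ∀ x ∈ lowerSpan S, a * x ∈ lowerSpan S}
      mul_mem' := fun ha hb x hx => by rw [mul_assoc]; exact ha _ (hb _ hx)
      one_mem' := fun x hx => by rwa [one_mul]
      add_mem' := fun ha hb x hx => by rw [add_mul]; exact add_mem (ha _ hx) (hb _ hx)
      zero_mem' := fun x hx => by rw [zero_mul]; exact zero_mem _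
      neg_mem' := fun ha x hx => by rw [neg_mul]; exact neg_mem (ha _ hx) }
  have hR : R = ⊤ := subring_eq_top R hU he hf hE hF hH
  refine eq_top_iff.2 fun a _ => ?_
  have ha : a ∈ R := hR ▸ Subring.mem_top a
  simpa using ha 1 (mem_lowerSpan_of_mem (one_mem _))

theorem exists_sum_of_mem_lowerSpan {x : Abar} (hx : x ∈ lowerSpan S) :
    ∃ (k : ℕ) (n : ℕ → Abar), (∀ i, n i ∈ lifts S) ∧ x = ∑ i ∈ Finset.range k, f ^ i * n i := by
  -- The vanishing of `n i` from `k` onwards allows two sums to be extended to a common range.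
  have key : ∃ (k : ℕ) (n : ℕ → Abar), (∀ i, n i ∈ lifts S) ∧ (∀ i, k ≤ i → n i = 0) ∧
      x = ∑ i ∈ Finset.range k, f ^ i * n i := by
    induction hx using AddSubgroup.closure_induction with
    | mem x hx =>
      obtain ⟨i, n, hn, rfl⟩ := hx
      refine ⟨i + 1, Pi.single i n, fun j => ?_, fun j hj => ?_, ?_⟩
      · rcases eq_or_ne j i with rfl | hj
        · simpa
        · simp [Pi.single_eq_of_ne hj]
      · rw [Pi.single_eq_of_ne (by omega)]
      · rw [Finset.sum_eq_single i]
        · simp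
        · intro j _ hj; simp [Pi.single_eq_of_ne hj]
        · simp
    | zero => exact ⟨0, 0, by simp⟩
    | add x y _ _ hx hy =>
      obtain ⟨k, n, h1, h2, rfl⟩ := hx
      obtain ⟨l, m, h3, h4, rfl⟩ := hy
      refine ⟨max k l, n + m, fun i => add_mem (h1 i) (h3 i), fun i hi => ?_, ?_⟩
      · simp [h2 i (by omega), h4 i (by omega)]
      · simp only [Pi.add_apply, mul_add, Finset.sum_add_distrib]
        congr 1
        · refine Finset.sum_subset (by simp) fun i _ hi => ?_
          rw [h2 i (by simpa using hi), mul_zero]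
        · refine Finset.sum_subset (by simp) fun i _ hi => ?_
          rw [h4 i (by simpa using hi), mul_zero]
    | neg x _ hx =>
      obtain ⟨k, n, h1, h2, rfl⟩ := hx
      exact ⟨k, -n, fun i => neg_mem (h1 i), fun i hi => by simp [h2 i hi], by simp⟩
  obtain ⟨k, n, h1, -, h2⟩ := key
  exact ⟨k, n, h1, h2⟩

end

/-- Expand `b` as a sum of terms `f ^ i n`. Then `f b - a` is such a sum with `-a` as coefficient of
`f ^ 0`, and directness puts that coefficient in `Ā e`. -/
theorem mem_Iplus_of_eq_f_mul_add {a b c : Abar} (ha : a ∈ normalizer Iplus) (hc : c ∈ Iplus)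
    (h : a = f * b + c) : a ∈ Iplus := by
  have hb : b ∈ lowerSpan ⊤ := by
    rw [lowerSpan_eq_top (by simp) (by simp) (by simp) (by simp)]; trivial
  obtain ⟨k, n, hn, rfl⟩ := exists_sum_of_mem_lowerSpan hb
  let m : ℕ → Abar := fun i => Nat.casesOn i (-a) n
  have h1 := mem_of_sum_f_pow_mul_mem (k + 1) m (fun i => by
    cases i with
    | zero => exact neg_mem ha
    | succ i => exact (mem_lifts.1 (hn i)).1) (by
    rw [Finset.sum_range_succ']
    simp only [m, pow_zero, one_mul]
    rw [h, Finset.mul_sum]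
    simp only [← mul_assoc, ← pow_succ']
    simpa using hc) 0 (by omega)
  exact neg_mem_iff.1 h1

/-- `DR(sl₂)` is generated by `Ū(𝔥)` and `z₊`, `z₋`, `t`. -/
theorem subring_DR_eq_top (S : Subring DR) (hS : ∀ u, ofUh u ∈ S) (hzp : zPlus ∈ S)
    (hzm : zMinus ∈ S) (ht : t ∈ S) : S = ⊤ := by
  refine eq_top_iff.2 fun x _ => ?_
  obtain ⟨⟨a, ha⟩, rfl⟩ := Ideal.Quotient.mk_surjective x
  have hb : a ∈ lowerSpan S := by rw [lowerSpan_eq_top hS hzp hzm ht]; trivial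
  obtain ⟨k, n, hn, h⟩ := exists_sum_of_mem_lowerSpan hb
  cases k with
  | zero => simp at h; subst h; exact zero_mem S
  | succ k =>
    rw [Finset.sum_range_succ', pow_zero, one_mul] at h
    -- Both `a` and `n 0` lie in the normalizer and differ by an element of `f Ā`, so they represent
    -- the same class, and `n 0` represents an element of `S`.
    have h1 : a - n 0 ∈ Iplus := by
      refine mem_Iplus_of_eq_f_mul_add (b := ∑ i ∈ Finset.range k, f ^ i * n (i + 1))
        (sub_mem ha (mem_lifts.1 (hn 0)).1) (zero_mem _) ?_
      rw [h, Finset.mul_sum]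
      simp [← mul_assoc, ← pow_succ']
    obtain ⟨h2, h3⟩ := mem_lifts.1 (hn 0)
    have : toDR ⟨a, ha⟩ = toDR ⟨n 0, h2⟩ := Ideal.Quotient.eq.2 h1
    change toDR ⟨a, ha⟩ ∈ S
    rwa [this]

/-! ### Computations in `Ū(𝔥)` -/

theorem shiftedMonoid_le : shiftedMonoid (X : ℂ[X]) ≤ nonZeroDivisors ℂ[X] := by
  refine Submonoid.closure_le.2 ?_
  rintro _ ⟨l, rfl⟩
  exact mem_nonZeroDivisors_of_ne_zero (X_add_C_ne_zero _)

instance : IsDomain Uh := IsLocalization.isDomain_of_le_nonZeroDivisors Uh shiftedMonoid_le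

/-- Equality in `Ū(𝔥)` may be checked in its field of fractions. -/
theorem uh_ext {a b : Uh} (h : algebraMap Uh (FractionRing Uh) a = algebraMap Uh (FractionRing Uh) b) :
    a = b := IsFractionRing.injective Uh (FractionRing Uh) h

/-- In a field the inverse of `h + l` becomes an ordinary inverse of a nonzero element, so that
`field_simp` can verify identities of `Ū(𝔥)`. -/
theorem map_coe_inv_hUnit {K : Type*} [Field K] (j : Uh →+* K) (l : ℤ) :
    j ↑(hUnit l)⁻¹ = (j hU + l)⁻¹ := by
  refine eq_inv_of_mul_eq_one_left ?_
  have : j hU + l = j (hUnit l) := by simp [coe_hUnit]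
  rw [this, ← map_mul, Units.inv_mul, map_one]

theorem map_hU_add_ne_zero {K : Type*} [Field K] (j : Uh →+* K) (l : ℤ) : j hU + l ≠ 0 := by
  have := ((hUnit l).isUnit.map j).ne_zero
  simpa [coe_hUnit] using this

theorem map_hU_add_ofNat_ne_zero {K : Type*} [Field K] (j : Uh →+* K) (l : ℕ) [l.AtLeastTwo] :
    j hU + (ofNat(l) : K) ≠ 0 := by
  exact_mod_cast map_hU_add_ne_zero j (l : ℤ)

theorem map_hU_add_one_ne_zero {K : Type*} [Field K] (j : Uh →+* K) : j hU + 1 ≠ 0 := by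
  simpa using map_hU_add_ne_zero j 1

theorem map_hU_ne_zero {K : Type*} [Field K] (j : Uh →+* K) : j hU ≠ 0 := by
  simpa using map_hU_add_ne_zero j 0

/-! ### Relations in `DR(sl₂)` -/

/-- This is how relations in `DR` are verified: terms beginning with `f` and terms ending in `e` may
both be discarded. -/
theorem toDR_eq {a b x c : Abar} (ha : a ∈ normalizer Iplus) (hb : b ∈ normalizer Iplus)
    (hc : c ∈ Iplus) (h : a = b + f * x + c) : toDR ⟨a, ha⟩ = toDR ⟨b, hb⟩ := by
  refine Ideal.Quotient.eq.2 (mem_Iplus_of_eq_f_mul_add (b := x) (sub_mem ha hb) hc ?_)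
  change a - b = _
  rw [h, add_assoc, add_sub_cancel_left]

theorem ofUh_apply (u : Uh) : ofUh u = toDR ⟨uhToAbar u, uhToAbar_mem u⟩ := rfl

theorem toDR_mul {a b : Abar} (ha : a ∈ normalizer Iplus) (hb : b ∈ normalizer Iplus) :
    toDR ⟨a, ha⟩ * toDR ⟨b, hb⟩ = toDR ⟨a * b, mul_mem ha hb⟩ := rfl

theorem toDR_add {a b : Abar} (ha : a ∈ normalizer Iplus) (hb : b ∈ normalizer Iplus) :
    toDR ⟨a, ha⟩ + toDR ⟨b, hb⟩ = toDR ⟨a + b, add_mem ha hb⟩ := rfl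

theorem toDR_sub {a b : Abar} (ha : a ∈ normalizer Iplus) (hb : b ∈ normalizer Iplus) :
    toDR ⟨a, ha⟩ - toDR ⟨b, hb⟩ = toDR ⟨a - b, sub_mem ha hb⟩ := rfl

theorem ofUh_mul_zPlus (u : Uh) : ofUh u * zPlus = zPlus * ofUh (shift 2 u) :=
  congrArg toDR (Subtype.ext (uhToAbar_mul_E u) :
    (⟨uhToAbar u, uhToAbar_mem u⟩ : normalizer Iplus) * ⟨zPlusLift, zPlusLift_mem⟩ =
      ⟨zPlusLift, zPlusLift_mem⟩ * ⟨uhToAbar (shift 2 u), uhToAbar_mem _⟩)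

theorem shift_shift (m n : ℤ) (u : Uh) : shift m (shift n u) = shift (m + n) u := by
  have : (shift m).comp (shift n) = shift (m + n) := by
    refine IsLocalization.ringHom_ext (shiftedMonoid (X : ℂ[X])) ?_
    ext x
    · simp [shift, IsLocalization.map_eq]
    · simp [shift, IsLocalization.map_eq]
      ring
  exact DFunLike.congr_fun this u

theorem ofUh_mul_zMinus (u : Uh) : ofUh u * zMinus = zMinus * ofUh (shift (-2) u) := by
  refine congrArg toDR (Subtype.ext ?_ :
    (⟨uhToAbar u, uhToAbar_mem u⟩ : normalizer Iplus) * ⟨zMinusLift, zMinusLift_mem⟩ =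
      ⟨zMinusLift, zMinusLift_mem⟩ * ⟨uhToAbar (shift (-2) u), uhToAbar_mem _⟩)
  change uhToAbar u * zMinusLift = zMinusLift * uhToAbar (shift (-2) u)
  have h1 : uhToAbar u * (f * H) = f * H * uhToAbar (shift (-2) u) := by
    rw [← mul_assoc, uhToAbar_mul_f, mul_assoc, uhToAbar_mul_H, mul_assoc]
  have h2 : uhToAbar u * (f * f * E) = f * f * E * uhToAbar (shift (-2) u) := by
    rw [← mul_assoc, ← mul_assoc, uhToAbar_mul_f, mul_assoc f, uhToAbar_mul_f, mul_assoc, mul_assoc,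
      uhToAbar_mul_E, shift_shift, shift_shift]
    norm_num
    noncomm_ring
  rw [zMinusLift, mul_sub, mul_sub, uhToAbar_mul_F, ← mul_assoc, h1, ← mul_assoc (uhToAbar u), h2, sub_mul,
    sub_mul, mul_assoc (f * H), ← map_mul, mul_assoc (f * H), ← map_mul, mul_assoc (f * f * E),
    ← map_mul, mul_assoc (f * f * E), ← map_mul, mul_comm (shift (-2) u), mul_comm (shift (-2) u)]

theorem ofUh_mul_t (u : Uh) : ofUh u * t = t * ofUh u := by
  refine congrArg toDR (Subtype.ext ?_ :
    (⟨uhToAbar u, uhToAbar_mem u⟩ : normalizer Iplus) * ⟨tLift, tLift_mem⟩ =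
      ⟨tLift, tLift_mem⟩ * ⟨uhToAbar u, uhToAbar_mem _⟩)
  change uhToAbar u * tLift = tLift * uhToAbar u
  have h1 : uhToAbar u * (f * E) = f * E * uhToAbar u := by
    rw [← mul_assoc, uhToAbar_mul_f, mul_assoc, uhToAbar_mul_E, mul_assoc, shift_shift]
    norm_num [shift_zero]
  rw [tLift, mul_add, add_mul, uhToAbar_mul_H, ← mul_assoc, h1, mul_assoc (f * E), ← map_mul,
    mul_assoc (f * E), ← map_mul, mul_comm u]

theorem zPlus_mul_t : zPlus * t = t * zPlus * ofUh ↑(hUnit 4 * (hUnit 2)⁻¹) := by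
  set r : Uh := ↑(hUnit 4 * (hUnit 2)⁻¹) with hr
  rw [zPlus, t, ofUh_apply, toDR_mul, toDR_mul, toDR_mul]
  have h1 : 1 + 2 * ↑(hUnit 2)⁻¹ = r := uh_ext (by
    have := map_hU_add_ofNat_ne_zero (algebraMap Uh (FractionRing Uh)) 2
    simp only [hr, Units.val_mul, map_add, map_mul, map_coe_inv_hUnit, coe_hUnit, map_intCast,
      map_one, map_ofNat]
    push_cast
    field_simp
    ring)
  -- Moving `E` past `f` in `tLift` leaves `H E` with factor `1 + 2 / (h + 2)`; the only
  -- contribution from `Ā e` is the commutator of `E` and `H`.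
  refine toDR_eq _ _ (x := E * E * uhToAbar (2 * ↑(hUnit 2)⁻¹)
    - E * uhToAbar (2 * ↑(hUnit 2)⁻¹) * E * uhToAbar r) (c := -2 * e)
    (Ideal.mul_mem_left _ _ (Ideal.subset_span rfl)) ?_
  have h2 : E * H = H * E - 2 * e := by rw [H_mul_E]; noncomm_ring
  have h3 : H * E * uhToAbar r = H * E + H * E * uhToAbar (2 * ↑(hUnit 2)⁻¹) := by
    rw [← h1, map_add, map_one, mul_add, mul_one]
  rw [zPlusLift, tLift, mul_add, add_mul, add_mul, h3, ← mul_assoc, ← mul_assoc, E_mul_f, h2]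
  noncomm_ring

theorem t_mul_zMinus : t * zMinus = zMinus * t * ofUh ↑(hUnit 2 * (hUnit 0)⁻¹) := by
  set r : Uh := ↑(hUnit 2 * (hUnit 0)⁻¹) with hr
  rw [zMinus, t, ofUh_apply, toDR_mul, toDR_mul, toDR_mul]
  -- The summand `2 / h` arises when `H` passes `f` in the term `f H h⁻¹` of `zMinusLift`.
  have h1 : 1 + 2 * ↑(hUnit 0)⁻¹ = r := uh_ext (by
    have := map_hU_ne_zero (algebraMap Uh (FractionRing Uh))
    simp only [hr, Units.val_mul, map_add, map_mul, map_coe_inv_hUnit, coe_hUnit, map_intCast,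
      map_one, map_ofNat]
    push_cast
    simp only [add_zero]
    field_simp)
  have h3 : F * H * uhToAbar r = F * H + 2 * (F * H * uhToAbar ↑(hUnit 0)⁻¹) := by
    rw [← h1, map_add, map_one, mul_add, mul_one, map_mul, map_ofNat]
    noncomm_ring
  set v := uhToAbar (2 * ↑(hUnit 2)⁻¹)
  set a := uhToAbar ↑(hUnit 0)⁻¹
  set b := uhToAbar ↑(hUnit 0 * hUnit 1)⁻¹
  have htl : tLift = H + f * E * v := rfl
  have hzl : zMinusLift = F - f * H * a - f * f * E * b := rfl
  clear_value v a b
  have h4 : H * zMinusLift = F * H + 2 * (F * H * a) +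
      f * (-2 - H * H * a - H * f * E * b + 2 * F * E * b) := by
    calc H * zMinusLift = H * F - H * f * H * a - H * f * f * E * b := by
          rw [hzl]; noncomm_ring
      _ = (F * H - 2 * f) - (f * H - 2 * F) * H * a - (f * H - 2 * F) * f * E * b := by
          rw [H_mul_F, H_mul_f]
      _ = F * H - 2 * f - f * H * H * a + 2 * (F * H * a) - f * H * f * E * b
          + 2 * (F * f) * E * b := by noncomm_ring
      _ = _ := by rw [F_mul_f]; noncomm_ring
  have h5 : zMinusLift * tLift * uhToAbar r = F * H + 2 * (F * H * a) + f * (F * E * v * uhToAbar r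
      - H * a * tLift * uhToAbar r - f * E * b * tLift * uhToAbar r) := by
    calc zMinusLift * tLift * uhToAbar r = F * H * uhToAbar r + F * f * E * v * uhToAbar r
          - f * H * a * tLift * uhToAbar r - f * f * E * b * tLift * uhToAbar r := by
            rw [hzl, sub_mul, sub_mul, sub_mul, sub_mul]
            nth_rw 1 [htl]
            noncomm_ring
      _ = _ := by rw [F_mul_f, h3]; noncomm_ring
  refine toDR_eq _ _ (x := E * v * zMinusLift
    + (-2 - H * H * a - H * f * E * b + 2 * F * E * b) - (F * E * v * uhToAbar r
      - H * a * tLift * uhToAbar r - f * E * b * tLift * uhToAbar r)) (c := 0) (zero_mem _) ?_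
  rw [h5]
  nth_rw 1 [htl]
  rw [add_mul, h4]
  noncomm_ring

theorem zPlus_mul_zMinus : zPlus * zMinus =
    zMinus * zPlus * ofUh ↑(hUnit 0 * hUnit 3 * (hUnit 1 * hUnit 2)⁻¹) + ofUh hU
      - t * t * ofUh ↑(hUnit 0)⁻¹ := by
  set r : Uh := ↑(hUnit 0 * hUnit 3 * (hUnit 1 * hUnit 2)⁻¹) with hr
  rw [zMinus, zPlus, t, ofUh_apply, ofUh_apply, ofUh_apply, toDR_mul, toDR_mul, toDR_mul, toDR_mul,
    toDR_mul, toDR_add, toDR_sub]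
  -- These are the coefficients of `F E` modulo `f Ā`: `1` from `E F`, `2 / (h (h + 1))` from the
  -- `f²` term of `zMinusLift`, and the last summand compensates the `F E` hidden in `t² / h`.
  have h1 : 1 + 2 * ↑(hUnit 0 * hUnit 1)⁻¹ - 2 * (2 * ↑(hUnit 2)⁻¹ * ↑(hUnit 0)⁻¹) = r := uh_ext (by
    have h0 := map_hU_ne_zero (algebraMap Uh (FractionRing Uh))
    have h1 := map_hU_add_one_ne_zero (algebraMap Uh (FractionRing Uh))
    have h2 := map_hU_add_ofNat_ne_zero (algebraMap Uh (FractionRing Uh)) 2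
    simp only [hr, mul_inv, Units.val_mul, map_add, map_sub, map_mul, map_coe_inv_hUnit, coe_hUnit,
      map_intCast, map_one, map_ofNat]
    push_cast
    simp only [add_zero]
    field_simp
    ring)
  have h3 : F * E * uhToAbar r = F * E + 2 * (F * E * uhToAbar ↑(hUnit 0 * hUnit 1)⁻¹) -
      2 * (F * E * uhToAbar (2 * ↑(hUnit 2)⁻¹) * uhToAbar ↑(hUnit 0)⁻¹) := by
    rw [← h1, map_sub, map_add, map_one, map_mul uhToAbar 2, map_mul uhToAbar 2, map_ofNat,
      map_mul uhToAbar (2 * _)]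
    noncomm_ring
  set v := uhToAbar (2 * ↑(hUnit 2)⁻¹)
  set a := uhToAbar ↑(hUnit 0)⁻¹ with ha
  set b := uhToAbar ↑(hUnit 0 * hUnit 1)⁻¹
  have htl : tLift = H + f * E * v := rfl
  have hzl : zMinusLift = F - f * H * a - f * f * E * b := rfl
  clear_value v a b
  have h4 : E * zMinusLift = F * E + uhToAbar hU - H * H * a + 2 * (F * E * b) -
      f * (E * H * a + E * f * E * b + H * E * b) := by
    calc E * zMinusLift = E * F - E * f * H * a - E * f * f * E * b := by
          rw [hzl]; noncomm_ring
      _ = (F * E + uhToAbar hU) - (f * E + H) * H * a - (f * E * f + H * f) * E * b := by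
          rw [E_mul_F, E_mul_f]; noncomm_ring
      _ = _ := by rw [H_mul_f]; noncomm_ring
  have h5 : tLift * tLift * a = H * H * a - 2 * (F * E * v * a) +
      f * (H * E * v * a + E * v * tLift * a) := by
    calc tLift * tLift * a = H * H * a + H * f * E * v * a + f * E * v * tLift * a := by
          nth_rw 1 [htl]
          rw [add_mul]
          nth_rw 1 [htl]
          noncomm_ring
      _ = _ := by rw [H_mul_f]; noncomm_ring
  refine toDR_eq _ _ (x := - (E * H * a + E * f * E * b + H * E * b) + (H * E * v * a + E * v * tLift * a)
    + (H * a * E * uhToAbar r + f * E * b * E * uhToAbar r)) (c := 0) (zero_mem _) ?_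
  have h6 : zMinusLift * E * uhToAbar r = F * E * uhToAbar r
      - f * (H * a * E * uhToAbar r + f * E * b * E * uhToAbar r) := by
    rw [hzl]; noncomm_ring
  rw [zPlusLift, ← ha, h4, h5, h6, h3]
  noncomm_ring

/-! ### Central elements of `DR(sl₂)` -/

theorem shift_coe_hUnit (n l : ℤ) : shift n ↑(hUnit l) = (hUnit (l + n) : Uh) := by
  simp only [coe_hUnit, map_add, shift_hU, map_intCast, Int.cast_add]
  ring

theorem shift_coe_inv_hUnit (n l : ℤ) : shift n ↑(hUnit l)⁻¹ = (↑(hUnit (l + n))⁻¹ : Uh) := by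
  refine Units.eq_inv_of_mul_eq_one_right ?_
  rw [← shift_coe_hUnit, ← map_mul, Units.inv_mul, map_one]

theorem ofUh_mul_ofUh (u v : Uh) : ofUh u * ofUh v = ofUh (u * v) := (map_mul _ _ _).symm

theorem mul_ofUh_mul_zPlus (x : DR) (u : Uh) :
    x * ofUh u * zPlus = x * zPlus * ofUh (shift 2 u) := by
  rw [mul_assoc, ofUh_mul_zPlus, mul_assoc]

theorem mul_ofUh_mul_zMinus (x : DR) (u : Uh) :
    x * ofUh u * zMinus = x * zMinus * ofUh (shift (-2) u) := by
  rw [mul_assoc, ofUh_mul_zMinus, mul_assoc]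

theorem mul_ofUh_mul_t (x : DR) (u : Uh) : x * ofUh u * t = x * t * ofUh u := by
  rw [mul_assoc, ofUh_mul_t, mul_assoc]

theorem mul_ofUh_mul_ofUh (x : DR) (u v : Uh) : x * ofUh u * ofUh v = x * ofUh (u * v) := by
  rw [mul_assoc, ofUh_mul_ofUh]

/-- An element of `DR(sl₂)` is central if it commutes with the generators. -/
theorem commute_of_generators {c : DR} (hU : ∀ u, Commute (ofUh u) c) (hp : Commute zPlus c)
    (hm : Commute zMinus c) (ht : Commute t c) (x : DR) : Commute x c := by
  have := subring_DR_eq_top (Subring.centralizer {c})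
    (fun u => Subring.mem_centralizer_iff.2 (by rintro _ rfl; exact (hU u).eq.symm))
    (Subring.mem_centralizer_iff.2 (by rintro _ rfl; exact hp.eq.symm))
    (Subring.mem_centralizer_iff.2 (by rintro _ rfl; exact hm.eq.symm))
    (Subring.mem_centralizer_iff.2 (by rintro _ rfl; exact ht.eq.symm))
  have hx : x ∈ Subring.centralizer {c} := this ▸ Subring.mem_top x
  exact (Subring.mem_centralizer_iff.1 hx c rfl).symm

/-- The central element `t (h + 2)`, proportional to the difference of the two Casimir elements. -/
def tau : DR := t * ofUh ↑(hUnit 2)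

/-- The factor `h + 2` becomes `h + 4` on passing `z₊` and `h` on passing `z₋`, which cancels the
factors in `zPlus_mul_t` and `t_mul_zMinus`. -/
theorem commute_tau (x : DR) : Commute x tau := by
  refine commute_of_generators (fun u => ?_) ?_ ?_ ?_ x
  · rw [commute_iff_eq, tau, mul_ofUh_mul_ofUh, ← mul_assoc, ofUh_mul_t, mul_ofUh_mul_ofUh, mul_comm u]
  · rw [commute_iff_eq, tau, mul_ofUh_mul_zPlus, ← mul_assoc, zPlus_mul_t, mul_ofUh_mul_ofUh,
      shift_coe_hUnit, Units.val_mul, mul_assoc ((hUnit 4 : Uh)), Units.inv_mul, mul_one]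
    rfl
  · rw [commute_iff_eq, tau, mul_ofUh_mul_zMinus, t_mul_zMinus, mul_ofUh_mul_ofUh,
      shift_coe_hUnit, Units.val_mul, mul_assoc ((hUnit 2 : Uh)), ← mul_assoc]
    simp
  · rw [commute_iff_eq, tau, mul_ofUh_mul_t, ← mul_assoc]

theorem t_eq : t = tau * ofUh ↑(hUnit 2)⁻¹ := by
  rw [tau, mul_ofUh_mul_ofUh, Units.mul_inv, map_one, mul_one]

/-- The central element corresponding to the sum of the two Casimir elements. -/
def cas : DR := zMinus * zPlus * ofUh (4 * ↑(hUnit 3) * ↑(hUnit 2)⁻¹) + t * t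
  + ofUh ((hU + 2) ^ 2)

/-- Having the same element written through `z₋ z₊` and through `z₊ z₋` makes its centrality nearly
formal: `z₊` times the first expression matches the second times `z₊`, and similarly for `z₋`. -/
theorem cas_eq : cas = zPlus * zMinus * ofUh (4 * ↑(hUnit 1) * ↑(hUnit 0)⁻¹)
    + t * t * ofUh ((hUnit 2 * ↑(hUnit 0)⁻¹) ^ 2) + ofUh (hU ^ 2) := by
  have h0 := map_hU_ne_zero (algebraMap Uh (FractionRing Uh))
  have h1 := map_hU_add_one_ne_zero (algebraMap Uh (FractionRing Uh))
  have h2 := map_hU_add_ofNat_ne_zero (algebraMap Uh (FractionRing Uh)) 2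
  rw [zPlus_mul_zMinus, sub_mul, add_mul, mul_ofUh_mul_ofUh, mul_ofUh_mul_ofUh, ofUh_mul_ofUh, cas]
  have e1 : (↑(hUnit 0 * hUnit 3 * (hUnit 1 * hUnit 2)⁻¹) * (4 * ↑(hUnit 1) * ↑(hUnit 0)⁻¹) : Uh)
      = 4 * ↑(hUnit 3) * ↑(hUnit 2)⁻¹ := uh_ext (by
    simp only [mul_inv, Units.val_mul, map_add, map_mul, map_coe_inv_hUnit, coe_hUnit,
      map_intCast, map_ofNat]
    push_cast
    simp only [add_zero]
    field_simp)
  have e2 : ((hUnit 2 * ↑(hUnit 0)⁻¹) ^ 2 : Uh) =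
      1 + ↑(hUnit 0)⁻¹ * (4 * ↑(hUnit 1) * ↑(hUnit 0)⁻¹) := uh_ext (by
    simp only [map_add, map_mul, map_coe_inv_hUnit, coe_hUnit, map_pow, map_intCast, map_one,
      map_ofNat]
    push_cast
    simp only [add_zero]
    field_simp
    ring)
  have e3 : (hU + 2) ^ 2 = hU * (4 * ↑(hUnit 1) * ↑(hUnit 0)⁻¹) + hU ^ 2 := uh_ext (by
    simp only [map_add, map_mul, map_coe_inv_hUnit, coe_hUnit, map_pow, map_intCast, map_ofNat]
    push_cast
    simp only [add_zero]
    field_simp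
    ring)
  rw [e1, e2, e3, map_add, map_add, map_one, mul_add, mul_one]
  abel

theorem commute_cas (x : DR) : Commute x cas := by
  have hU' : ∀ u, Commute (ofUh u) cas := fun u => by
    have h1 : ofUh u * (zMinus * zPlus) = zMinus * zPlus * ofUh u := by
      rw [← mul_assoc, ofUh_mul_zMinus, mul_ofUh_mul_zPlus, shift_shift]; simp [shift_zero]
    have h2 : ofUh u * (t * t) = t * t * ofUh u := by
      rw [← mul_assoc, ofUh_mul_t, mul_ofUh_mul_t]
    have h3 : ∀ v, Commute (ofUh u) (ofUh v) := fun v => (Commute.all u v).map ofUh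
    have h1' : Commute (ofUh u) (zMinus * zPlus) := h1
    have h2' : Commute (ofUh u) (t * t) := h2
    exact ((h1'.mul_right (h3 _)).add_right h2').add_right (h3 _)
  refine commute_of_generators hU' ?_ ?_ ?_ x
  · have h1 : t * t * zPlus * ofUh ((hUnit 4 * ↑(hUnit 2)⁻¹) ^ 2) = zPlus * (t * t) := by
      rw [← mul_assoc zPlus, zPlus_mul_t, mul_ofUh_mul_t, mul_assoc t zPlus t, zPlus_mul_t,
        ← mul_assoc, ← mul_assoc, mul_ofUh_mul_ofUh, Units.val_mul, sq]
    rw [commute_iff_eq]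
    nth_rw 2 [cas_eq]
    rw [cas, add_mul, add_mul, mul_ofUh_mul_zPlus, mul_ofUh_mul_zPlus, ofUh_mul_zPlus, mul_add,
      mul_add]
    have e1 : shift 2 (4 * ↑(hUnit 1) * ↑(hUnit 0)⁻¹) = 4 * ↑(hUnit 3) * ↑(hUnit 2)⁻¹ := by
      rw [map_mul, map_mul, shift_coe_hUnit, shift_coe_inv_hUnit, map_ofNat]
      rfl
    have e2 : shift 2 (hU ^ 2) = (hU + 2) ^ 2 := by rw [map_pow, shift_hU]; norm_cast
    rw [e1, e2]
    congr 2
    · simp only [mul_assoc]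
    · rw [← h1]
      simp only [map_pow, map_mul, shift_coe_hUnit, shift_coe_inv_hUnit]
      rfl
  · have h1 : t * t * zMinus = zMinus * (t * t) * ofUh ((hUnit 2 * ↑(hUnit 0)⁻¹) ^ 2) := by
      rw [mul_assoc, t_mul_zMinus, ← mul_assoc, ← mul_assoc, t_mul_zMinus, mul_ofUh_mul_t,
        mul_ofUh_mul_ofUh, Units.val_mul, sq, mul_assoc zMinus]
    rw [commute_iff_eq]
    nth_rw 1 [cas_eq]
    rw [cas, add_mul, add_mul, mul_ofUh_mul_zMinus, h1, ofUh_mul_zMinus, mul_add, mul_add]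
    have e1 : shift (-2) (4 * ↑(hUnit 3) * ↑(hUnit 2)⁻¹) = 4 * ↑(hUnit 1) * ↑(hUnit 0)⁻¹ := by
      rw [map_mul, map_mul, shift_coe_hUnit, shift_coe_inv_hUnit, map_ofNat]
      rfl
    have e2 : shift (-2) ((hU + 2) ^ 2) = hU ^ 2 := by
      rw [map_pow, map_add, shift_hU, map_ofNat]; simp
    rw [e1, e2]
    congr 2
    · simp only [mul_assoc]
    · simp only [mul_assoc]
  · rw [t_eq]
    exact ((commute_tau cas).symm.mul_left (hU' _))

/-! ### Spanning -/

/-- The two central generators. -/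
def casOne : DR := cas + 2 * tau

/-- The two central generators. -/
def casTwo : DR := cas - 2 * tau

theorem commute_casOne (x : DR) : Commute x casOne :=
  (commute_cas x).add_right ((Commute.ofNat_right x 2).mul_right (commute_tau x))

theorem commute_casTwo (x : DR) : Commute x casTwo :=
  (commute_cas x).sub_right ((Commute.ofNat_right x 2).mul_right (commute_tau x))

/-- The evaluation at the central generators of polynomials with coefficients in `Ū(𝔥)`. -/
def ev : Uh[X][X] →+* DR :=
  eval₂RingHom' (eval₂RingHom' ofUh casOne fun _ => commute_casOne _) casTwo
    fun _ => commute_casTwo _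

theorem ev_C_C (u : Uh) : ev (C (C u)) = ofUh u := by simp [ev]

theorem ev_C_X : ev (C X) = casOne := by simp [ev]

theorem ev_X : ev X = casTwo := by simp [ev]

theorem two_mul_half : (2 : Uh) * algebraMap ℂ[X] Uh (C (1 / 2)) = 1 := by
  have : (2 : ℂ[X]) * C (1 / 2) = 1 := by rw [← C_ofNat, ← C_mul]; norm_num
  rw [← map_ofNat (algebraMap ℂ[X] Uh), ← map_mul, this, map_one]

theorem ofUh_mem_range (u : Uh) : ofUh u ∈ ev.range := ⟨_, ev_C_C u⟩

theorem half_mem_range {x : DR} (h : 2 * x ∈ ev.range) : x ∈ ev.range := by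
  have : x = ofUh (algebraMap ℂ[X] Uh (C (1 / 2))) * (2 * x) := by
    rw [← mul_assoc, ← map_ofNat ofUh, ofUh_mul_ofUh, mul_comm _ (2 : Uh), two_mul_half, map_one,
      one_mul]
  rw [this]
  exact mul_mem (ofUh_mem_range _) h

theorem cas_mem_range : cas ∈ ev.range := by
  refine half_mem_range ⟨C X + X, ?_⟩
  rw [map_add, ev_C_X, ev_X, casOne, casTwo]
  noncomm_ring

theorem tau_mem_range : tau ∈ ev.range := by
  refine half_mem_range (half_mem_range ⟨C X - X, ?_⟩)
  rw [map_sub, ev_C_X, ev_X, casOne, casTwo]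
  noncomm_ring

theorem t_mem_range : t ∈ ev.range := by
  rw [t_eq]
  exact mul_mem tau_mem_range (ofUh_mem_range _)

theorem zMinus_mul_zPlus_mem_range : zMinus * zPlus ∈ ev.range := by
  obtain ⟨u, hu⟩ : IsUnit (4 * ↑(hUnit 3) * ↑(hUnit 2)⁻¹ : Uh) := by
    have h2 : IsUnit (2 : Uh) := IsUnit.of_mul_eq_one _ two_mul_half
    have h4 : IsUnit (4 : Uh) := by convert h2.mul h2; norm_num
    exact (h4.mul (hUnit 3).isUnit).mul (hUnit 2)⁻¹.isUnit
  have : zMinus * zPlus = (cas - t * t - ofUh ((hU + 2) ^ 2)) * ofUh ↑u⁻¹ := by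
    rw [cas, ← hu, sub_right_comm, add_sub_cancel_right, add_sub_cancel_right, mul_ofUh_mul_ofUh, Units.mul_inv,
      map_one, mul_one]
  rw [this]
  exact mul_mem (sub_mem (sub_mem cas_mem_range (mul_mem t_mem_range t_mem_range))
    (ofUh_mem_range _)) (ofUh_mem_range _)

theorem zPlus_mul_zMinus_mem_range : zPlus * zMinus ∈ ev.range := by
  rw [zPlus_mul_zMinus]
  exact sub_mem (add_mem (mul_mem zMinus_mul_zPlus_mem_range (ofUh_mem_range _)) (ofUh_mem_range _))
    (mul_mem (mul_mem t_mem_range t_mem_range) (ofUh_mem_range _))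

/-- The two variables evaluate to central elements, so only the coefficients in `Ū(𝔥)` have to be
moved past `z`. -/
theorem exists_mul_ev {z : DR} (hz : ∀ u, ∃ v, z * ofUh u = ofUh v * z) (p : Uh[X][X]) :
    ∃ q, z * ev p = ev q * z := by
  have hmul : ∀ p p', (∃ q, z * ev p = ev q * z) → (∃ q, z * ev p' = ev q * z) →
      ∃ q, z * ev (p * p') = ev q * z := by
    rintro p p' ⟨q, hq⟩ ⟨q', hq'⟩
    exact ⟨q * q', by rw [map_mul, map_mul, ← mul_assoc, hq, mul_assoc, hq', mul_assoc]⟩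
  have hadd : ∀ p p', (∃ q, z * ev p = ev q * z) → (∃ q, z * ev p' = ev q * z) →
      ∃ q, z * ev (p + p') = ev q * z := by
    rintro p p' ⟨q, hq⟩ ⟨q', hq'⟩
    exact ⟨q + q', by rw [map_add, map_add, mul_add, hq, hq', add_mul]⟩
  have hX : ∃ q, z * ev (C X) = ev q * z := ⟨C X, by rw [ev_C_X, (commute_casOne z).eq]⟩
  have hY : ∃ q, z * ev X = ev q * z := ⟨X, by rw [ev_X, (commute_casTwo z).eq]⟩
  have hC : ∀ p : Uh[X], ∃ q, z * ev (C p) = ev q * z := by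
    intro p
    induction p using Polynomial.induction_on with
    | C u => obtain ⟨v, hv⟩ := hz u; exact ⟨C (C v), by rw [ev_C_C, ev_C_C, hv]⟩
    | add p q hp hq => rw [C_add]; exact hadd _ _ hp hq
    | monomial n u h =>
      rw [pow_succ, ← mul_assoc, C_mul]
      exact hmul _ _ h hX
  induction p using Polynomial.induction_on with
  | C p => exact hC p
  | add p q hp hq => exact hadd _ _ hp hq
  | monomial n u h =>
    rw [pow_succ, ← mul_assoc]
    exact hmul _ _ h hY

/-- The powers of `z₊`, and of `z₋` for negative exponents. -/
def zpw : ℤ → DR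
  | .ofNat n => zPlus ^ n
  | .negSucc n => zMinus ^ (n + 1)

theorem zpw_neg_natCast (n : ℕ) : zpw (-n) = zMinus ^ n := by
  cases n with
  | zero => simp [zpw]
  | succ n => rfl

theorem zpw_natCast (n : ℕ) : zpw n = zPlus ^ n := rfl

/-- The sum of the spaces `Ū(𝔥)[C₁, C₂] z^n`, with `z^n` as in `zpw`. -/
def sumHom : (ℤ →₀ Uh[X][X]) →+ DR :=
  Finsupp.liftAddHom fun n => (AddMonoidHom.mulRight (zpw n)).comp ev.toAddMonoidHom

theorem sumHom_apply (s : ℤ →₀ Uh[X][X]) : sumHom s = s.sum fun n p => ev p * zpw n := rfl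

/-- The sum of the spaces `Ū(𝔥)[C₁, C₂] z^n`, as an additive subgroup. -/
def sumRange : AddSubgroup DR := @AddMonoidHom.range (ℤ →₀ Uh[X][X]) _ DR _ sumHom

theorem ev_mul_zpw_mem {x : DR} (hx : x ∈ ev.range) (n : ℤ) : x * zpw n ∈ sumRange := by
  obtain ⟨p, rfl⟩ := hx
  exact ⟨Finsupp.single n p, by simp [sumHom_apply]⟩

theorem mul_mem_range_sumHom {z : DR} (h : ∀ p n, z * (ev p * zpw n) ∈ sumRange) :
    ∀ x ∈ sumRange, z * x ∈ sumRange := by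
  rintro _ ⟨s, rfl⟩
  rw [sumHom_apply, Finsupp.sum, Finset.mul_sum]
  exact sum_mem fun n _ => h _ n

theorem exists_zPlus_mul_zpw (n : ℤ) : ∃ x ∈ ev.range, ∃ m, zPlus * zpw n = x * zpw m := by
  cases n with
  | ofNat n => exact ⟨1, one_mem _, (n + 1 : ℕ), by rw [zpw_natCast, pow_succ', one_mul]; rfl⟩
  | negSucc n =>
    refine ⟨_, zPlus_mul_zMinus_mem_range, -n, ?_⟩
    rw [zpw_neg_natCast, mul_assoc, ← pow_succ']; rfl

theorem exists_zMinus_mul_zpw (n : ℤ) : ∃ x ∈ ev.range, ∃ m, zMinus * zpw n = x * zpw m := by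
  obtain ⟨n, rfl | rfl⟩ := n.eq_nat_or_neg
  · cases n with
    | zero => exact ⟨1, one_mem _, -(1 : ℕ), by rw [zpw_neg_natCast]; simp [zpw]⟩
    | succ n =>
      refine ⟨_, zMinus_mul_zPlus_mem_range, n, ?_⟩
      rw [zpw_natCast, zpw_natCast, mul_assoc, ← pow_succ']
  · exact ⟨1, one_mem _, -(n + 1 : ℕ), by rw [zpw_neg_natCast, zpw_neg_natCast, pow_succ', one_mul]⟩

/-- `DR(sl₂)` is the sum of the spaces `Ū(𝔥)[C₁, C₂] z^n`. -/
theorem sumHom_surjective : Function.Surjective sumHom := by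
  have hz : ∀ z : DR, (∀ u, ∃ v, z * ofUh u = ofUh v * z) →
      (∀ n, ∃ x ∈ ev.range, ∃ m, z * zpw n = x * zpw m) →
      ∀ x ∈ sumRange, z * x ∈ sumRange := fun z h1 h2 =>
    mul_mem_range_sumHom fun p n => by
      obtain ⟨q, hq⟩ := exists_mul_ev h1 p
      obtain ⟨x, hx, m, hm⟩ := h2 n
      rw [← mul_assoc, hq, mul_assoc, hm, ← mul_assoc]
      exact ev_mul_zpw_mem (mul_mem ⟨q, rfl⟩ hx) m
  have he : ∀ z ∈ ev.range, ∀ x ∈ sumRange, z * x ∈ sumRange := fun z h1 =>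
    mul_mem_range_sumHom fun p n => by
      rw [← mul_assoc]
      exact ev_mul_zpw_mem (mul_mem h1 ⟨p, rfl⟩) n
  -- The elements preserving the sum under left multiplication form a subring containing the
  -- generators, and `1` lies in the sum.
  let R : Subring DR :=
    { carrier := {a | ∀ x ∈ sumRange, a * x ∈ sumRange}
      mul_mem' := fun ha hb x hx => by rw [mul_assoc]; exact ha _ (hb _ hx)
      one_mem' := fun x hx => by rwa [one_mul]
      add_mem' := fun ha hb x hx => by rw [add_mul]; exact add_mem (ha _ hx) (hb _ hx)
      zero_mem' := fun x hx => by rw [zero_mul]; exact zero_mem _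
      neg_mem' := fun ha x hx => by rw [neg_mul]; exact neg_mem (ha _ hx) }
  have hR : R = ⊤ := subring_DR_eq_top R (fun u => he _ (ofUh_mem_range u))
    (hz _ (fun u => ⟨shift (-2) u, by rw [ofUh_mul_zPlus, shift_shift]; simp [shift_zero]⟩)
      exists_zPlus_mul_zpw)
    (hz _ (fun u => ⟨shift 2 u, by rw [ofUh_mul_zMinus, shift_shift]; simp [shift_zero]⟩)
      exists_zMinus_mul_zpw)
    (he _ t_mem_range)
  intro x
  have hx : x ∈ R := hR ▸ Subring.mem_top x
  have := hx 1 (by simpa [zpw] using ev_mul_zpw_mem (one_mem _) 0)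
  rwa [mul_one] at this

/-! ### Representations of `sl₂ ⊕ sl₂` -/

theorem sl_trace (x : Sl2) : x.val 1 1 = - x.val 0 0 := by
  have := x.2
  change Matrix.trace x.val = 0 at this
  rw [Matrix.trace_fin_two] at this
  linear_combination this

section LieHom

variable {B : Type*} [Ring B] [Algebra ℂ B]

/-- The homomorphism from `sl₂` to an algebra given by an `sl₂`-triple. -/
def sl2Hom (e f h : B) (hef : e * f = f * e + h) (hhe : h * e = e * h + (e + e))
    (hhf : h * f = f * h - (f + f)) : Sl2 →ₗ⁅ℂ⁆ B where
  toFun x := x.val 0 1 • e + x.val 1 0 • f + x.val 0 0 • h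
  map_add' x y := by
    have hxy : ∀ i j, (x + y).val i j = x.val i j + y.val i j := fun _ _ => rfl
    simp only [hxy]
    module
  map_smul' c x := by
    have hx : ∀ i j, (c • x).val i j = c * x.val i j := fun _ _ => rfl
    simp only [hx, RingHom.id_apply]
    module
  map_lie' {x y} := by
    simp only [LieSubalgebra.coe_bracket, Ring.lie_def, Matrix.sub_apply, Matrix.mul_apply,
      Fin.sum_univ_two, sl_trace, mul_add, add_mul, smul_mul_smul_comm, hef, hhe, hhf]
    module

theorem sl2Hom_apply {e f h : B} (hef : e * f = f * e + h) (hhe : h * e = e * h + (e + e))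
    (hhf : h * f = f * h - (f + f)) (x : Sl2) :
    sl2Hom e f h hef hhe hhf x = x.val 0 1 • e + x.val 1 0 • f + x.val 0 0 • h := rfl

/-- The homomorphism from `sl₂ ⊕ sl₂` given by two commuting homomorphisms from `sl₂`. -/
def prodHom (φ ψ : Sl2 →ₗ⁅ℂ⁆ B) (h : ∀ x y, Commute (φ x) (ψ y)) : G →ₗ⁅ℂ⁆ B where
  toFun x := φ x.1 + ψ x.2
  map_add' x y := by simp only [Prod.fst_add, Prod.snd_add, map_add]; abel
  map_smul' c x := by
    simp only [Prod.smul_fst, Prod.smul_snd, LinearMapClass.map_smul, RingHom.id_apply, smul_add]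
  map_lie' {x y} := by
    have h1 := (h x.1 y.2).eq
    have h2 := (h y.1 x.2).eq
    change φ ⁅x.1, y.1⁆ + ψ ⁅x.2, y.2⁆ = _
    rw [LieHom.map_lie, LieHom.map_lie]
    simp only [Ring.lie_def, mul_add, add_mul, h1, h2]
    abel

end LieHom

section Representation

variable {K : Type*} [Field K] [Algebra ℂ K]

/-- The space of series `∑ g n i y ^ (s + n) x ^ i`. -/
abbrev Ser (K : Type*) : Type _ := ℤ → ℤ → K

variable (s L M : K)

/-- The operator `∂_y`. -/
def opE₁ : Module.End ℂ (Ser K) where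
  toFun g n i := (s + n + 1) * g (n + 1) i
  map_add' g g' := by ext n i; simp; ring
  map_smul' c g := by ext n i; simp

/-- The operator `∂_x - ∂_y`. -/
def opE₂ : Module.End ℂ (Ser K) where
  toFun g n i := (i + 1) * g n (i + 1) - (s + n + 1) * g (n + 1) i
  map_add' g g' := by ext n i; simp; ring
  map_smul' c g := by ext n i; simp [smul_sub]

/-- The operator `L - 2 (x + y) ∂_y`. -/
def opH₁ : Module.End ℂ (Ser K) where
  toFun g n i := (L - 2 * (s + n)) * g n i - 2 * (s + n + 1) * g (n + 1) (i - 1)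
  map_add' g g' := by ext n i; simp; ring
  map_smul' c g := by ext n i; simp [smul_sub]

/-- The operator `M - 2 x (∂_x - ∂_y)`. -/
def opH₂ : Module.End ℂ (Ser K) where
  toFun g n i := (M - 2 * i) * g n i + 2 * (s + n + 1) * g (n + 1) (i - 1)
  map_add' g g' := by ext n i; simp; ring
  map_smul' c g := by ext n i; simp [smul_add]

/-- The operator `L (x + y) - (x + y) ^ 2 ∂_y`. -/
def opF₁ : Module.End ℂ (Ser K) where
  toFun g n i := (L - 2 * (s + n)) * g n (i - 1) + (L - (s + n - 1)) * g (n - 1) i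
    - (s + n + 1) * g (n + 1) (i - 2)
  map_add' g g' := by ext n i; simp; ring
  map_smul' c g := by ext n i; simp [smul_sub, smul_add]

/-- The operator `M x - x ^ 2 (∂_x - ∂_y)`. -/
def opF₂ : Module.End ℂ (Ser K) where
  toFun g n i := (M - (i - 1)) * g n (i - 1) + (s + n + 1) * g (n + 1) (i - 2)
  map_add' g g' := by ext n i; simp; ring
  map_smul' c g := by ext n i; simp [smul_add]

theorem opE₁_apply (g : Ser K) (n i : ℤ) : opE₁ s g n i = (s + n + 1) * g (n + 1) i := rfl

theorem opE₂_apply (g : Ser K) (n i : ℤ) :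
    opE₂ s g n i = (i + 1) * g n (i + 1) - (s + n + 1) * g (n + 1) i := rfl

theorem opH₁_apply (g : Ser K) (n i : ℤ) : opH₁ s L g n i =
    (L - 2 * (s + n)) * g n i - 2 * (s + n + 1) * g (n + 1) (i - 1) := rfl

theorem opH₂_apply (g : Ser K) (n i : ℤ) : opH₂ s M g n i =
    (M - 2 * i) * g n i + 2 * (s + n + 1) * g (n + 1) (i - 1) := rfl

theorem opF₁_apply (g : Ser K) (n i : ℤ) : opF₁ s L g n i =
    (L - 2 * (s + n)) * g n (i - 1) + (L - (s + n - 1)) * g (n - 1) i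
    - (s + n + 1) * g (n + 1) (i - 2) := rfl

theorem opF₂_apply (g : Ser K) (n i : ℤ) : opF₂ s M g n i =
    (M - (i - 1)) * g n (i - 1) + (s + n + 1) * g (n + 1) (i - 2) := rfl

/-- The first copy of `sl₂`, acting by differential operators. -/
def repOne : Sl2 →ₗ⁅ℂ⁆ Module.End ℂ (Ser K) :=
  sl2Hom (opE₁ s) (opF₁ s L) (opH₁ s L)
    (by
      ext g n i
      simp only [Module.End.mul_apply, LinearMap.add_apply, Pi.add_apply, opE₁_apply, opF₁_apply,
        opH₁_apply]
      push_cast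
      ring_nf)
    (by
      ext g n i
      simp only [Module.End.mul_apply, LinearMap.add_apply, Pi.add_apply, opE₁_apply, opH₁_apply]
      push_cast
      ring_nf)
    (by
      ext g n i
      simp only [Module.End.mul_apply, LinearMap.sub_apply, Pi.sub_apply, opF₁_apply,
        opH₁_apply, LinearMap.add_apply, Pi.add_apply]
      push_cast
      ring_nf)

/-- The second copy of `sl₂`, acting by differential operators. -/
def repTwo : Sl2 →ₗ⁅ℂ⁆ Module.End ℂ (Ser K) :=
  sl2Hom (opE₂ s) (opF₂ s M) (opH₂ s M)
    (by
      ext g n i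
      simp only [Module.End.mul_apply, LinearMap.add_apply, Pi.add_apply, opE₂_apply, opF₂_apply,
        opH₂_apply]
      push_cast
      ring_nf)
    (by
      ext g n i
      simp only [Module.End.mul_apply, LinearMap.add_apply, Pi.add_apply, opE₂_apply, opH₂_apply]
      push_cast
      ring_nf)
    (by
      ext g n i
      simp only [Module.End.mul_apply, LinearMap.sub_apply, Pi.sub_apply, opF₂_apply,
        opH₂_apply, LinearMap.add_apply, Pi.add_apply]
      push_cast
      ring_nf)

/-- In the coordinates `x + y` and `x` the two copies act in separate variables. -/
theorem commute_repOne_repTwo (x y : Sl2) : Commute (repOne s L x) (repTwo s M y) := by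
  have key : ∀ a ∈ ({opE₁ s, opF₁ s L, opH₁ s L} : Set (Module.End ℂ (Ser K))),
      ∀ b ∈ ({opE₂ s, opF₂ s M, opH₂ s M} : Set (Module.End ℂ (Ser K))), Commute a b := by
    rintro a (rfl | rfl | rfl) b (rfl | rfl | rfl) <;>
    · rw [commute_iff_eq]
      ext g n i
      simp only [Module.End.mul_apply, opE₁_apply, opF₁_apply, opH₁_apply, opE₂_apply, opF₂_apply,
        opH₂_apply]
      push_cast
      ring_nf
  have h1 : ∀ a ∈ ({opE₁ s, opF₁ s L, opH₁ s L} : Set (Module.End ℂ (Ser K))),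
      Commute a (repTwo s M y) := fun a ha =>
    (((key a ha _ (by simp)).smul_right _).add_right ((key a ha _ (by simp)).smul_right _)).add_right
      ((key a ha _ (by simp)).smul_right _)
  exact (((h1 _ (by simp)).smul_left _).add_left ((h1 _ (by simp)).smul_left _)).add_left
      ((h1 _ (by simp)).smul_left _)

/-- The representation of `U(sl₂ ⊕ sl₂)` by differential operators. -/
def repA : A →ₐ[ℂ] Module.End ℂ (Ser K) :=
  UniversalEnvelopingAlgebra.lift ℂ (prodHom (repOne s L) (repTwo s M) (commute_repOne_repTwo s L M))

theorem repA_diag (x : Sl2) : repA s L M (diag x) = repOne s L x + repTwo s M x :=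
  UniversalEnvelopingAlgebra.lift_ι_apply ℂ _ _

theorem repA_anti (x : Sl2) : repA s L M (anti x) = repOne s L x - repTwo s M x :=
  (UniversalEnvelopingAlgebra.lift_ι_apply ℂ _ _).trans (by
    rw [sub_eq_add_neg, ← map_neg]; rfl)

theorem repOne_slE : repOne s L slE = opE₁ s := by
  refine (sl2Hom_apply _ _ _ slE).trans ?_
  simp [slE]

theorem repOne_slF : repOne s L slF = opF₁ s L := by
  refine (sl2Hom_apply _ _ _ slF).trans ?_
  simp [slF]

theorem repOne_slH : repOne s L slH = opH₁ s L := by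
  refine (sl2Hom_apply _ _ _ slH).trans ?_
  simp [slH]

theorem repTwo_slE : repTwo s M slE = opE₂ s := by
  refine (sl2Hom_apply _ _ _ slE).trans ?_
  simp [slE]

theorem repTwo_slF : repTwo s M slF = opF₂ s M := by
  refine (sl2Hom_apply _ _ _ slF).trans ?_
  simp [slF]

theorem repTwo_slH : repTwo s M slH = opH₂ s M := by
  refine (sl2Hom_apply _ _ _ slH).trans ?_
  simp [slH]

end Representation

theorem map_shift_coe_inv_hUnit {K : Type*} [Field K] (j : Uh →+* K) (n l : ℤ) :
    j (shift n ↑(hUnit l)⁻¹) = (j hU + n + l)⁻¹ := by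
  rw [shift_coe_inv_hUnit, map_coe_inv_hUnit]; push_cast; ring_nf

theorem map_hU_sub_add_ne_zero {K : Type*} [Field K] (j : Uh →+* K)
    (n l : ℤ) : j hU - 2 * n + l ≠ 0 := by
  have := map_hU_add_ne_zero j (-2 * n + l)
  push_cast at this
  convert this using 1
  ring

/-! ### Extension of the action to `Ū(𝔥)` and `Ā` -/

section Representation

variable {K : Type*} [Field K] [Algebra ℂ K]

variable (s L M : K)

/-- Multiplication of the coefficients by elements of `K`. -/
def diagHom : (ℤ → ℤ → K) →+* Module.End ℂ (Ser K) where
  toFun c :=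
    { toFun := fun g n i => c n i * g n i
      map_add' := fun g g' => by ext n i; simp; ring
      map_smul' := fun r g => by ext n i; simp }
  map_one' := by ext g n i; simp
  map_mul' c c' := by ext g n i; simp [mul_assoc]
  map_zero' := by ext g n i; simp
  map_add' c c' := by ext g n i; simp [add_mul]

variable (j : Uh →+* K)

/-- The action of `Ū(𝔥)`. -/
def uhOp : Uh →+* Module.End ℂ (Ser K) :=
  diagHom.comp (RingHom.pi fun n => RingHom.pi fun i => j.comp (shift (-2 * (n + i))))

theorem uhOp_apply (u : Uh) (g : Ser K) (n i : ℤ) :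
    uhOp j u g n i = j (shift (-2 * (n + i)) u) * g n i := rfl

/-- The action of `U(sl₂ ⊕ sl₂)` is compatible with that of `Ū(𝔥)`. -/
structure Compatible : Prop where
  map_C : ∀ c : ℂ, j (algebraMap ℂ[X] Uh (C c)) = algebraMap ℂ K c
  add_eq : L + M = j hU + 2 * s

variable {s L M j}

theorem shift_C (n : ℤ) (c : ℂ) : shift n (algebraMap ℂ[X] Uh (C c)) = algebraMap ℂ[X] Uh (C c) := by
  simp [shift, IsLocalization.map_eq]

/-- The monomial `y ^ (s + n) x ^ i` has weight `L + M - 2 (s + n + i)`, which the compatibility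
condition turns into `j h - 2 (n + i)`. So `h` acts diagonally, through shifts of `j`. -/
theorem repA_aeval (hc : Compatible s L M j) (p : ℂ[X]) :
    repA s L M (aeval hA p) = uhOp j (algebraMap ℂ[X] Uh p) := by
  have : ((repA s L M).comp (aeval hA : ℂ[X] →ₐ[ℂ] A)).toRingHom = (uhOp j).comp (algebraMap ℂ[X] Uh) := by
    refine Polynomial.ringHom_ext (fun c => ?_) ?_
    · ext g n i
      simp [uhOp_apply, shift_C, hc.map_C, Algebra.smul_def]
    · ext g n i
      have h1 : repA s L M (aeval hA (X : ℂ[X])) = opH₁ s L + opH₂ s M := by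
        rw [aeval_X, hA, repA_diag, repOne_slH, repTwo_slH]
      have h2 : j (shift (-2 * (n + i)) hU) = j hU - 2 * (n + i) := by
        rw [shift_hU, map_add, map_intCast]; push_cast; ring
      change repA s L M (aeval hA (X : ℂ[X])) g n i = uhOp j hU g n i
      rw [h1, uhOp_apply, h2, LinearMap.add_apply, Pi.add_apply, Pi.add_apply, opH₁_apply,
        opH₂_apply]
      linear_combination g n i * hc.add_eq
  exact DFunLike.congr_fun this p

theorem isUnit_repA (hc : Compatible s L M j) (a : shiftedMonoid hA) : IsUnit (repA s L M a) := by
  obtain ⟨a, ha⟩ := a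
  induction ha using Submonoid.closure_induction with
  | mem x hx =>
    obtain ⟨l, rfl⟩ := hx
    have h1 : hA + algebraMap ℂ A (l : ℂ) = aeval hA (X + C (l : ℂ) : ℂ[X]) := by simp
    have h2 : algebraMap ℂ[X] Uh (X + C (l : ℂ)) = hUnit l := by
      simp [coe_hUnit, hU]
    change IsUnit (repA s L M (hA + algebraMap ℂ A (l : ℂ)))
    rw [h1, repA_aeval hc, h2]
    exact (hUnit l).isUnit.map (uhOp j)
  | one => simp
  | mul x y _ _ hx hy =>
    simp only [map_mul]
    exact hx.mul hy

/-- The representation of `Ā` by differential operators. -/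
def repAbar (hc : Compatible s L M j) : Abar →+* Module.End ℂ (Ser K) :=
  OreLocalization.universalHom (repA s L M).toRingHom
    (IsUnit.liftRight (((repA s L M).toRingHom : A →* Module.End ℂ (Ser K)).comp
      (shiftedMonoid hA).subtype) (isUnit_repA hc))
    (fun _ => rfl)

theorem repAbar_toAbar (hc : Compatible s L M j) (a : A) :
    repAbar hc (toAbar a) = repA s L M a :=
  OreLocalization.universalHom_commutes _ _ _

theorem repAbar_uhToAbar (hc : Compatible s L M j) (u : Uh) :
    repAbar hc (uhToAbar u) = uhOp j u := by
  have : (repAbar hc).comp uhToAbar = uhOp j := by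
    refine IsLocalization.ringHom_ext (shiftedMonoid (X : ℂ[X])) (RingHom.ext fun p => ?_)
    change repAbar hc (uhToAbar (algebraMap ℂ[X] Uh p)) = uhOp j (algebraMap ℂ[X] Uh p)
    rw [uhToAbar_algebraMap, repAbar_toAbar, repA_aeval hc]
  exact DFunLike.congr_fun this u

theorem repAbar_e_apply (hc : Compatible s L M j) (g : Ser K) (n i : ℤ) :
    repAbar hc e g n i = (i + 1) * g n (i + 1) := by
  rw [e, repAbar_toAbar, repA_diag, repOne_slE, repTwo_slE, LinearMap.add_apply, Pi.add_apply,
    Pi.add_apply, opE₁_apply, opE₂_apply]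
  ring

theorem repAbar_E_apply (hc : Compatible s L M j) (g : Ser K) (n i : ℤ) :
    repAbar hc E g n i = 2 * (s + n + 1) * g (n + 1) i - (i + 1) * g n (i + 1) := by
  rw [E, repAbar_toAbar, repA_anti, repOne_slE, repTwo_slE, LinearMap.sub_apply, Pi.sub_apply,
    Pi.sub_apply, opE₁_apply, opE₂_apply]
  ring

theorem repAbar_H_apply (hc : Compatible s L M j) (g : Ser K) (n i : ℤ) :
    repAbar hc H g n i = (L - M - 2 * (s + n) + 2 * i) * g n i
      - 4 * (s + n + 1) * g (n + 1) (i - 1) := by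
  rw [H, repAbar_toAbar, repA_anti, repOne_slH, repTwo_slH, LinearMap.sub_apply, Pi.sub_apply,
    Pi.sub_apply, opH₁_apply, opH₂_apply]
  ring

theorem repAbar_f_apply (hc : Compatible s L M j) (g : Ser K) (n i : ℤ) :
    repAbar hc f g n i = (L + M - 2 * (s + n) - (i - 1)) * g n (i - 1)
      + (L - (s + n - 1)) * g (n - 1) i := by
  rw [f, repAbar_toAbar, repA_diag, repOne_slF, repTwo_slF, LinearMap.add_apply, Pi.add_apply,
    Pi.add_apply, opF₁_apply, opF₂_apply]
  ring

theorem repAbar_F_apply (hc : Compatible s L M j) (g : Ser K) (n i : ℤ) :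
    repAbar hc F g n i = (L - M - 2 * (s + n) + (i - 1)) * g n (i - 1)
      + (L - (s + n - 1)) * g (n - 1) i - 2 * (s + n + 1) * g (n + 1) (i - 2) := by
  rw [F, repAbar_toAbar, repA_anti, repOne_slF, repTwo_slF, LinearMap.sub_apply, Pi.sub_apply,
    Pi.sub_apply, opF₁_apply, opF₂_apply]
  ring

/-! ### The representation of `DR(sl₂)` on the kernel of `e` -/

/-- The inclusion of the series in `y` alone. -/
def incl : (ℤ → K) →ₗ[ℂ] Ser K where
  toFun g n i := if i = 0 then g n else 0
  map_add' g g' := by ext n i; by_cases hi : i = 0 <;> simp [hi]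
  map_smul' c g := by ext n i; by_cases hi : i = 0 <;> simp [hi]

theorem incl_apply (g : ℤ → K) (n i : ℤ) : incl g n i = if i = 0 then g n else 0 := rfl

/-- The restriction to `x = 0`. -/
def restr : Ser K →ₗ[ℂ] (ℤ → K) where
  toFun g n := g n 0
  map_add' _ _ := rfl
  map_smul' _ _ := rfl

theorem restr_apply (g : Ser K) (n : ℤ) : restr g n = g n 0 := rfl

/-- Since `e` acts as `∂_x` and the characteristic is zero, a series in its kernel has no term with
a nonzero exponent of `x`. -/
theorem incl_restr (hc : Compatible s L M j) {g : Ser K} (hg : repAbar hc e g = 0) :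
    incl (restr g) = g := by
  ext n i
  rw [incl_apply, restr_apply]
  split_ifs with hi
  · rw [hi]
  · have h1 := congrFun (congrFun hg n) (i - 1)
    rw [repAbar_e_apply, sub_add_cancel] at h1
    have : CharZero K := charZero_of_injective_algebraMap (algebraMap ℂ K).injective
    have h2 : ((i - 1 : ℤ) : K) + 1 ≠ 0 := by
      push_cast
      simpa using hi
    exact ((mul_eq_zero.1 h1).resolve_left h2).symm

theorem repAbar_e_incl (hc : Compatible s L M j) (g : ℤ → K) : repAbar hc e (incl g) = 0 := by
  ext n i
  rw [repAbar_e_apply, incl_apply]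
  split_ifs with hi
  · have : (i : K) + 1 = 0 := by exact_mod_cast congrArg (Int.cast : ℤ → K) hi
    simp [this]
  · simp

theorem repAbar_incl_of_mem (hc : Compatible s L M j) {a : Abar} (ha : a ∈ Iplus) (g : ℤ → K) :
    repAbar hc a (incl g) = 0 := by
  obtain ⟨b, rfl⟩ := Ideal.mem_span_singleton'.1 ha
  rw [map_mul, Module.End.mul_apply, repAbar_e_incl, map_zero]

/-- For `a` in the normalizer, `e a` lies in `Ā e` and kills the kernel of `e`; thus `a` preserves
that kernel. This makes `repNorm` multiplicative. -/
theorem incl_restr_repAbar (hc : Compatible s L M j) {a : Abar} (ha : a ∈ normalizer Iplus)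
    (g : ℤ → K) : incl (restr (repAbar hc a (incl g))) = repAbar hc a (incl g) := by
  refine incl_restr hc ?_
  rw [← Module.End.mul_apply, ← map_mul]
  exact repAbar_incl_of_mem hc (mem_normalizer_span.1 ha) g

theorem restr_incl (g : ℤ → K) : restr (incl g) = g := rfl

/-- The representation of the normalizer. -/
def repNorm (hc : Compatible s L M j) : normalizer Iplus →+* Module.End ℂ (ℤ → K) where
  toFun a := restr ∘ₗ repAbar hc a ∘ₗ incl
  map_one' := by ext1 g; simp [restr_incl]
  map_mul' a b := by
    ext1 g
    simp only [Subalgebra.coe_mul, map_mul, LinearMap.comp_apply, Module.End.mul_apply]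
    rw [incl_restr_repAbar hc b.2]
  map_zero' := by ext1 g; simp
  map_add' a b := by ext1 g; simp

/-- The representation of `DR(sl₂)`. -/
def rep (hc : Compatible s L M j) : DR →+* Module.End ℂ (ℤ → K) :=
  Ideal.Quotient.lift (idealInNormalizer Iplus) (repNorm hc) fun a ha => by
    ext1 g
    change restr (repAbar hc a (incl g)) = 0
    rw [repAbar_incl_of_mem hc (a := a) ha, map_zero]

theorem rep_toDR (hc : Compatible s L M j) (a : normalizer Iplus) (g : ℤ → K) (n : ℤ) :
    rep hc (toDR a) g n = repAbar hc a (incl g) n 0 := rfl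

theorem rep_ofUh (hc : Compatible s L M j) (u : Uh) (g : ℤ → K) (n : ℤ) :
    rep hc (ofUh u) g n = j (shift (-2 * n) u) * g n := by
  rw [ofUh_apply, rep_toDR, repAbar_uhToAbar, uhOp_apply, incl_apply, if_pos rfl, add_zero]

theorem rep_zPlus (hc : Compatible s L M j) (g : ℤ → K) (n : ℤ) :
    rep hc zPlus g n = 2 * (s + n + 1) * g (n + 1) := by
  rw [zPlus, rep_toDR]
  change repAbar hc E _ _ _ = _
  rw [repAbar_E_apply]
  simp [incl_apply]

theorem repAbar_inv_hUnit (hc : Compatible s L M j) (l : ℤ) (g : Ser K) (n i : ℤ) :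
    repAbar hc (uhToAbar ↑(hUnit l)⁻¹) g n i = (j hU - 2 * (n + i) + l)⁻¹ * g n i := by
  rw [repAbar_uhToAbar, uhOp_apply, map_shift_coe_inv_hUnit]
  push_cast
  ring_nf

theorem rep_t (hc : Compatible s L M j) (g : ℤ → K) (n : ℤ) :
    rep hc t g n = (L - M) * (L + M + 2) * (j hU - 2 * n + 2)⁻¹ * g n := by
  have h1 : j hU - 2 * n + 2 ≠ 0 := by exact_mod_cast map_hU_sub_add_ne_zero j n 2
  have hL : L = j hU + 2 * s - M := by rw [← hc.add_eq]; ring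
  rw [t, rep_toDR]
  change repAbar hc tLift _ _ _ = _
  rw [tLift, two_mul, map_add uhToAbar]
  simp only [map_add, map_mul, Module.End.mul_apply, LinearMap.add_apply, Pi.add_apply,
    repAbar_H_apply, repAbar_f_apply, repAbar_E_apply, repAbar_inv_hUnit, incl_apply]
  norm_num
  rw [hL]
  field_simp
  ring

theorem rep_zMinus (hc : Compatible s L M j) (g : ℤ → K) (n : ℤ) :
    rep hc zMinus g n = 2 * (L - (s + n - 1)) * (M - (s + n - 1)) * (L + M - (s + n - 1) + 1) *
      (j hU - 2 * n + 2)⁻¹ * (j hU - 2 * n + 3)⁻¹ * g (n - 1) := by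
  have h1 : j hU - 2 * n + 2 ≠ 0 := by exact_mod_cast map_hU_sub_add_ne_zero j n 2
  have h2 : j hU - 2 * n + 3 ≠ 0 := by exact_mod_cast map_hU_sub_add_ne_zero j n 3
  have hL : L = j hU + 2 * s - M := by rw [← hc.add_eq]; ring
  rw [zMinus, rep_toDR]
  change repAbar hc zMinusLift _ _ _ = _
  rw [zMinusLift, mul_inv, Units.val_mul, map_mul uhToAbar]
  simp only [map_sub, map_mul, Module.End.mul_apply, LinearMap.sub_apply,
    Pi.sub_apply, repAbar_F_apply,
    repAbar_H_apply, repAbar_f_apply, repAbar_E_apply, repAbar_inv_hUnit, incl_apply]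
  norm_num
  have e1 : j hU - 2 * ((n : K) - 1) = j hU - 2 * n + 2 := by ring
  have e2 : j hU - 2 * (n : K) + 2 + 1 = j hU - 2 * n + 3 := by ring
  rw [e1, e2, hL]
  field_simp
  ring

end Representation

/-! ### Faithfulness -/

theorem map_shift_hUnit {K : Type*} [Field K] (j : Uh →+* K) (n l : ℤ) :
    j (shift n ↑(hUnit l)) = j hU + n + l := by
  rw [shift_coe_hUnit, coe_hUnit]; simp; ring

/-- The evaluation of polynomials over `Ū(𝔥)` in `K`. -/
def evalK {K : Type*} [Field K] (j : Uh →+* K) (a b : K) : Uh[X][X] →+* K := eval₂RingHom (eval₂RingHom j a) b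

theorem evalK_shift {K : Type*} [Field K] (j : Uh →+* K) (a b : K) (n : ℤ) :
    evalK (j.comp (shift n)) a b = (evalK j a b).comp (mapRingHom (mapRingHom (shift n))) := by
  refine Polynomial.ringHom_ext' (Polynomial.ringHom_ext (fun u => ?_) ?_) ?_ <;> simp [evalK]

section Faithful

variable {K : Type*} [Field K] [Algebra ℂ K] {s L M : K} {j : Uh →+* K}

/-- The scalar equals `(L + 1)² - (M + 1)²`. Together with `rep_cas` it shows that `casOne` and
`casTwo` act by `4 (L + 1)²` and `4 (M + 1)²`. -/
theorem rep_tau (hc : Compatible s L M j) (g : ℤ → K) (n : ℤ) :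
    rep hc tau g n = (L - M) * (L + M + 2) * g n := by
  have h1 : j hU - 2 * n + 2 ≠ 0 := by exact_mod_cast map_hU_sub_add_ne_zero j n 2
  rw [tau, map_mul, Module.End.mul_apply, rep_t, rep_ofUh, map_shift_hUnit]
  push_cast
  have e1 : j hU + -2 * (n : K) + 2 = j hU - 2 * n + 2 := by ring
  rw [e1]
  field_simp

theorem rep_cas (hc : Compatible s L M j) (g : ℤ → K) (n : ℤ) :
    rep hc cas g n = 2 * ((L + 1) ^ 2 + (M + 1) ^ 2) * g n := by
  have h1 : j hU - 2 * n + 2 ≠ 0 := by exact_mod_cast map_hU_sub_add_ne_zero j n 2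
  have h2 : j hU - 2 * n + 3 ≠ 0 := by exact_mod_cast map_hU_sub_add_ne_zero j n 3
  have hL : L = j hU + 2 * s - M := by rw [← hc.add_eq]; ring
  rw [cas, map_add (rep hc), map_add (rep hc), map_mul (rep hc), map_mul (rep hc) zMinus,
    map_mul (rep hc) t]
  simp only [Module.End.mul_apply, LinearMap.add_apply, Pi.add_apply, rep_t, rep_zMinus, rep_zPlus,
    rep_ofUh]
  simp only [map_mul, map_add, map_pow, map_shift_hUnit, map_shift_coe_inv_hUnit, map_ofNat,
    sub_add_cancel, shift_hU, map_intCast]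
  push_cast
  have e1 : j hU + -2 * (n : K) + 2 = j hU - 2 * n + 2 := by ring
  have e2 : j hU + -2 * (n : K) + 3 = j hU - 2 * n + 3 := by ring
  rw [e1, e2, hL]
  field_simp
  ring

/-- Multiplication of the coefficients by elements of `K`. -/
def diagOne : (ℤ → K) →+* Module.End ℂ (ℤ → K) where
  toFun c :=
    { toFun := fun g n => c n * g n
      map_add' := fun g g' => by ext n; simp; ring
      map_smul' := fun r g => by ext n; simp }
  map_one' := by ext1 g; ext n; simp
  map_mul' c c' := by ext1 g; ext n; simp [mul_assoc]
  map_zero' := by ext1 g; ext n; simp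
  map_add' c c' := by ext1 g; ext n; simp [add_mul]

theorem rep_ev (hc : Compatible s L M j) (p : Uh[X][X]) (g : ℤ → K) (n : ℤ) :
    rep hc (ev p) g n = evalK (j.comp (shift (-2 * n))) (4 * (L + 1) ^ 2) (4 * (M + 1) ^ 2) p * g n := by
  have : (rep hc).comp ev = diagOne.comp (RingHom.pi fun n =>
      evalK (j.comp (shift (-2 * n))) (4 * (L + 1) ^ 2) (4 * (M + 1) ^ 2)) := by
    refine Polynomial.ringHom_ext' (Polynomial.ringHom_ext (fun u => ?_) ?_) ?_
    · ext1 g; ext n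
      simp only [RingHom.comp_apply, ev_C_C, rep_ofUh]
      simp [diagOne, evalK]
    · ext1 g; ext n
      simp only [RingHom.comp_apply, ev_C_X, casOne, two_mul, map_add, LinearMap.add_apply,
        Pi.add_apply, rep_cas, rep_tau]
      simp [diagOne, evalK]
      ring
    · ext1 g; ext n
      simp only [RingHom.comp_apply, ev_X, casTwo, two_mul, map_add, map_sub, LinearMap.add_apply,
        LinearMap.sub_apply, Pi.sub_apply, Pi.add_apply, rep_cas, rep_tau]
      simp [diagOne, evalK]
      ring
  exact congrFun (DFunLike.congr_fun (DFunLike.congr_fun this p) g) n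

/-- The parameters are generic. -/
structure Generic (s L M : K) (j : Uh →+* K) : Prop extends Compatible s L M j where
  injective : Function.Injective (evalK j (4 * (L + 1) ^ 2) (4 * (M + 1) ^ 2))
  s_ne : ∀ n : ℤ, s + n + 1 ≠ 0
  L_ne : ∀ n : ℤ, L - (s + n - 1) ≠ 0
  M_ne : ∀ n : ℤ, M - (s + n - 1) ≠ 0
  add_ne : ∀ n : ℤ, L + M - (s + n - 1) + 1 ≠ 0

theorem shift_injective (n : ℤ) : Function.Injective (shift n) := by
  refine Function.LeftInverse.injective (g := shift (-n)) fun u => ?_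
  rw [shift_shift, neg_add_cancel, shift_zero]

/-- Shifting `j` amounts to shifting the coefficients of the polynomial first, and shifts are
injective; hence genericity at position `0` gives it at every position. -/
theorem Generic.injective_shift (hg : Generic s L M j) (n : ℤ) :
    Function.Injective (evalK (j.comp (shift n)) (4 * (L + 1) ^ 2) (4 * (M + 1) ^ 2)) := by
  rw [evalK_shift]
  exact hg.injective.comp (map_injective _ (map_injective _ (shift_injective n)))

/-- The coefficient of the action of `z₋`. -/
def coeffMinus (s L M η : K) (n : ℤ) : K :=
  2 * (L - (s + n - 1)) * (M - (s + n - 1)) * (L + M - (s + n - 1) + 1) *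
      (η - 2 * n + 2)⁻¹ * (η - 2 * n + 3)⁻¹

theorem rep_zMinus' (hc : Compatible s L M j) (g : ℤ → K) (n : ℤ) :
    rep hc zMinus g n = coeffMinus s L M (j hU) n * g (n - 1) := rep_zMinus hc g n

theorem Generic.charZero (_hg : Generic s L M j) : CharZero K :=
  charZero_of_injective_algebraMap (algebraMap ℂ K).injective

theorem Generic.coeffMinus_ne_zero (hg : Generic s L M j) (n : ℤ) :
    coeffMinus s L M (j hU) n ≠ 0 := by
  have := hg.charZero
  have h1 : j hU - 2 * n + 2 ≠ 0 := by exact_mod_cast map_hU_sub_add_ne_zero j n 2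
  have h2 : j hU - 2 * n + 3 ≠ 0 := by exact_mod_cast map_hU_sub_add_ne_zero j n 3
  exact mul_ne_zero (mul_ne_zero (mul_ne_zero (mul_ne_zero (mul_ne_zero two_ne_zero (hg.L_ne n))
    (hg.M_ne n)) (hg.add_ne n)) (inv_ne_zero h1)) (inv_ne_zero h2)

/-- By genericity no coefficient of `z₊` or `z₋` vanishes, so different powers move the delta
sequence at `0` to different positions and can be told apart. -/
theorem rep_zpw_single (hg : Generic s L M j) (k : ℤ) : ∃ c : K, c ≠ 0 ∧
    rep hg.toCompatible (zpw k) (Pi.single 0 1) = Pi.single (-k) c := by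
  have := hg.charZero
  have hp : ∀ (n : ℤ) (c : K), rep hg.toCompatible zPlus (Pi.single n c)
      = Pi.single (n - 1) (2 * (s + (n - 1 : ℤ) + 1) * c) := by
    intro n c
    ext m
    rw [rep_zPlus]
    rcases eq_or_ne m (n - 1) with rfl | hm
    · simp
    · rw [Pi.single_eq_of_ne hm, Pi.single_eq_of_ne (by omega), mul_zero]
  have hm : ∀ (n : ℤ) (c : K), rep hg.toCompatible zMinus (Pi.single n c)
      = Pi.single (n + 1) (coeffMinus s L M (j hU) (n + 1) * c) := by
    intro n c
    ext m
    rw [rep_zMinus']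
    rcases eq_or_ne m (n + 1) with rfl | hm
    · simp
    · rw [Pi.single_eq_of_ne hm, Pi.single_eq_of_ne (by omega), mul_zero]
  obtain ⟨k, rfl | rfl⟩ := k.eq_nat_or_neg
  · rw [zpw_natCast]
    induction k with
    | zero => exact ⟨1, one_ne_zero, by simp⟩
    | succ k ih =>
      obtain ⟨c, hc, h⟩ := ih
      refine ⟨_, mul_ne_zero (mul_ne_zero two_ne_zero (hg.s_ne (-k - 1))) hc, ?_⟩
      rw [pow_succ', map_mul, Module.End.mul_apply, h, hp]
      congr 1
      push_cast
      ring
  · rw [zpw_neg_natCast]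
    induction k with
    | zero => exact ⟨1, one_ne_zero, by simp⟩
    | succ k ih =>
      obtain ⟨c, hc, h⟩ := ih
      refine ⟨_, mul_ne_zero (hg.coeffMinus_ne_zero (- -k + 1)) hc, ?_⟩
      rw [pow_succ', map_mul, Module.End.mul_apply, h, hm]
      congr 1
      push_cast
      ring

/-- Write an element as a sum of `ev p * zpw k` and apply it to the delta sequence at `0`. Position
`-k` sees only the `k`-th term, whose value is a nonzero scalar times an injective evaluation of
`p`. -/
theorem rep_injective (hg : Generic s L M j) : Function.Injective (rep hg.toCompatible) := by
  rw [injective_iff_map_eq_zero]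
  intro x hx
  obtain ⟨p, rfl⟩ := sumHom_surjective x
  have key : ∀ k, p k = 0 := by
    intro k
    have h1 : rep hg.toCompatible (sumHom p) (Pi.single 0 1) (-k) = 0 := by rw [hx]; rfl
    rw [sumHom_apply, Finsupp.sum, map_sum, LinearMap.sum_apply, Finset.sum_apply,
      Finset.sum_eq_single k] at h1
    · obtain ⟨c, hc, h⟩ := rep_zpw_single hg k
      rw [map_mul, Module.End.mul_apply, rep_ev, h, Pi.single_eq_same] at h1
      refine hg.injective_shift (-2 * -k) ?_
      rw [map_zero]
      exact (mul_eq_zero.1 h1).resolve_right hc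
    · intro m _ hm
      obtain ⟨c, hc, h⟩ := rep_zpw_single hg m
      rw [map_mul, Module.End.mul_apply, rep_ev, h, Pi.single_eq_of_ne (by omega), mul_zero]
    · intro hk
      rw [Finsupp.notMem_support_iff.1 hk]
      simp
  have : p = 0 := Finsupp.ext key
  rw [this, map_zero]

end Faithful

/-! ### A generic field -/

/-- Scalars are constant polynomials; with the induced structure on `GenField`, the condition
`map_C` of `Compatible` holds by definition. -/
instance : Algebra ℂ Uh := ((algebraMap ℂ[X] Uh).comp C).toAlgebra

theorem algebraMap_uh (c : ℂ) : algebraMap ℂ Uh c = algebraMap ℂ[X] Uh (C c) := rfl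

/-- The field of fractions of `Ū(𝔥)[X][Y]`. -/
abbrev GenField : Type := FractionRing Uh[X][X]

/-- The embedding of `Ū(𝔥)`. -/
def genJ : Uh →+* GenField := (algebraMap Uh[X][X] GenField).comp (C.comp C)

/-- The first parameter. -/
def genL : GenField := algebraMap Uh[X][X] GenField (C X) / 2 - 1

/-- The second parameter. -/
def genM : GenField := algebraMap Uh[X][X] GenField X / 2 - 1

/-- The exponent of `y`. -/
def genS : GenField := (genL + genM - genJ hU) / 2

instance : CharZero GenField := charZero_of_injective_algebraMap (algebraMap ℂ GenField).injective

theorem genericField : Generic genS genL genM genJ where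
  map_C c := rfl
  add_eq := by rw [genS]; ring
  injective := by
    -- The parameters are chosen so that `4 (L + 1)²` and `4 (M + 1)²` are the squares of the two
    -- variables; the evaluation is then the doubling of exponents.
    have h1 : evalK genJ (4 * (genL + 1) ^ 2) (4 * (genM + 1) ^ 2) =
        (algebraMap Uh[X][X] GenField).comp ((expand Uh[X] 2).toRingHom.comp
          (mapRingHom (expand Uh 2).toRingHom)) := by
      refine Polynomial.ringHom_ext' (Polynomial.ringHom_ext (fun u => ?_) ?_) ?_
      · simp [evalK, genJ]
      · simp [evalK, genL]; ring
      · simp [evalK, genM]; ring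
    rw [h1]
    exact (IsFractionRing.injective Uh[X][X] GenField).comp
      ((expand_injective two_pos).comp (map_injective _ (expand_injective two_pos)))
  s_ne n h := by
    -- After clearing the denominator `4`, the expression is monic of degree one in the outer
    -- variable and so cannot vanish. The next three conditions are treated alike, up to sign.
    have h1 : algebraMap Uh[X][X] GenField (X + C (X + C (4 * n - 2 * hU))) = 0 := by
      simp only [genS, genL, genM, genJ, RingHom.comp_apply] at h
      simp only [map_add, map_sub, map_mul, map_ofNat, map_intCast]
      linear_combination 4 * h
    rw [map_eq_zero_iff _ (IsFractionRing.injective Uh[X][X] GenField)] at h1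
    exact X_add_C_ne_zero _ h1
  L_ne n h := by
    have h1 : algebraMap Uh[X][X] GenField (X + C (-X + C (4 * n - 4 - 2 * hU))) = 0 := by
      simp only [genS, genL, genM, genJ, RingHom.comp_apply] at h
      simp only [map_add, map_sub, map_mul, map_ofNat, map_intCast, map_neg]
      linear_combination -4 * h
    rw [map_eq_zero_iff _ (IsFractionRing.injective Uh[X][X] GenField)] at h1
    exact X_add_C_ne_zero _ h1
  M_ne n h := by
    have h1 : algebraMap Uh[X][X] GenField (X + C (-X + C (2 * hU - 4 * n + 4))) = 0 := by
      simp only [genS, genL, genM, genJ, RingHom.comp_apply] at h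
      simp only [map_add, map_sub, map_mul, map_ofNat, map_intCast, map_neg]
      linear_combination 4 * h
    rw [map_eq_zero_iff _ (IsFractionRing.injective Uh[X][X] GenField)] at h1
    exact X_add_C_ne_zero _ h1
  add_ne n h := by
    have h1 : algebraMap Uh[X][X] GenField (X + C (X + C (2 * hU - 4 * n + 4))) = 0 := by
      simp only [genS, genL, genM, genJ, RingHom.comp_apply] at h
      simp only [map_add, map_sub, map_mul, map_ofNat, map_intCast]
      linear_combination 4 * h
    rw [map_eq_zero_iff _ (IsFractionRing.injective Uh[X][X] GenField)] at h1
    exact X_add_C_ne_zero _ h1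

/-! ### The reflection `h ↦ -h - 2` -/

theorem uh_hom_ext {R : Type*} [Semiring R] {φ ψ : Uh →+* R}
    (hC : ∀ c, φ (algebraMap ℂ Uh c) = ψ (algebraMap ℂ Uh c)) (hX : φ hU = ψ hU) : φ = ψ :=
  IsLocalization.ringHom_ext (shiftedMonoid (X : ℂ[X])) (Polynomial.ringHom_ext hC hX)

/-- The reflection sends `h + l` to `-(h + (2 - l))`, so it permutes the denominators up to sign. -/
theorem isUnit_reflect (s : shiftedMonoid (X : ℂ[X])) :
    IsUnit (((algebraMap ℂ[X] Uh).comp (compRingHom (-X - 2))) s) := by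
  obtain ⟨s, hs⟩ := s
  induction hs using Submonoid.closure_induction with
  | mem x hx =>
    obtain ⟨l, rfl⟩ := hx
    have : ((algebraMap ℂ[X] Uh).comp (compRingHom (-X - 2))) (X + algebraMap ℂ ℂ[X] (l : ℂ))
        = -(hUnit (2 - l)) := by
      simp [coe_hUnit, hU, map_ofNat (algebraMap ℂ[X] Uh) 2]
      ring
    change IsUnit (((algebraMap ℂ[X] Uh).comp (compRingHom (-X - 2)))
      (X + algebraMap ℂ ℂ[X] (l : ℂ)))
    rw [this]
    exact (hUnit _).isUnit.neg
  | one => simp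
  | mul x y _ _ hx hy =>
    simp only [map_mul]
    exact hx.mul hy

/-- The reflection `u(h) ↦ u(-h - 2)` of `Ū(𝔥)`. -/
def reflectU : Uh →+* Uh := IsLocalization.lift isUnit_reflect

theorem reflectU_algebraMap (c : ℂ) : reflectU (algebraMap ℂ Uh c) = algebraMap ℂ Uh c := by
  rw [algebraMap_uh, reflectU, IsLocalization.lift_eq]
  simp

theorem reflectU_hU : reflectU hU = -hU - 2 := by
  rw [reflectU, hU, IsLocalization.lift_eq]
  simp [map_ofNat (algebraMap ℂ[X] Uh) 2]

theorem shift_algebraMap (n : ℤ) (c : ℂ) : shift n (algebraMap ℂ Uh c) = algebraMap ℂ Uh c :=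
  shift_C n c

theorem reflectU_reflectU (u : Uh) : reflectU (reflectU u) = u := by
  have : reflectU.comp reflectU = RingHom.id Uh :=
    uh_hom_ext (fun c => by simp [reflectU_algebraMap]) (by simp [reflectU_hU, map_ofNat reflectU 2])
  exact DFunLike.congr_fun this u

theorem reflectU_shift (n : ℤ) (u : Uh) : reflectU (shift n u) = shift (-n) (reflectU u) := by
  have : reflectU.comp (shift n) = (shift (-n)).comp reflectU :=
    uh_hom_ext (fun c => by simp [reflectU_algebraMap, shift_algebraMap])
      (by simp [reflectU_hU, shift_hU, map_ofNat (shift (-n)) 2]; ring)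
  exact DFunLike.congr_fun this u

/-- The reflection as an automorphism. -/
def reflectEquiv : Uh ≃+* Uh :=
  RingEquiv.ofRingHom reflectU reflectU (RingHom.ext reflectU_reflectU)
    (RingHom.ext reflectU_reflectU)

/-! ### Automorphisms of the generic field -/

/-- The extension of the reflection to `Ū(𝔥)[X][Y]`. -/
def reflectPoly : Uh[X][X] ≃+* Uh[X][X] := mapEquiv (mapEquiv reflectEquiv)

theorem reflectPoly_C_C (u : Uh) : reflectPoly (C (C u)) = C (C (reflectU u)) := by
  simp [reflectPoly]; rfl

theorem reflectPoly_C_X : reflectPoly (C X) = C X := by simp [reflectPoly]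

theorem reflectPoly_X : reflectPoly X = X := by simp [reflectPoly]

/-- The extension of an automorphism of `Ū(𝔥)[X][Y]` to the field of fractions. -/
def fieldEquiv (τ : Uh[X][X] ≃+* Uh[X][X]) : GenField ≃+* GenField :=
  IsFractionRing.ringEquivOfRingEquiv τ

theorem fieldEquiv_algebraMap (τ : Uh[X][X] ≃+* Uh[X][X]) (p : Uh[X][X]) :
    fieldEquiv τ (algebraMap Uh[X][X] GenField p) = algebraMap Uh[X][X] GenField (τ p) :=
  IsFractionRing.ringEquivOfRingEquiv_algebraMap τ p

/-- For `β = -1` the reflection is extended by the identity on the parameters, for `β = 1` it is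
extended by their exchange. -/
theorem exists_fieldEquiv {β : ℂ} (hβ : β = 1 ∨ β = -1) : ∃ σ : GenField ≃+* GenField,
    (∀ u, σ (genJ u) = genJ (reflectU u)) ∧
    ((β = -1 ∧ σ genL = genL ∧ σ genM = genM) ∨ (β = 1 ∧ σ genL = genM ∧ σ genM = genL)) := by
  rcases hβ with rfl | rfl
  · refine ⟨fieldEquiv (reflectPoly.trans (Bivariate.swap (R := Uh)).toRingEquiv), fun u => ?_,
      Or.inr ⟨rfl, ?_, ?_⟩⟩
    · change fieldEquiv _ (algebraMap Uh[X][X] GenField (C (C u))) = _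
      rw [fieldEquiv_algebraMap]
      change algebraMap Uh[X][X] GenField (Bivariate.swap (reflectPoly (C (C u)))) = _
      rw [reflectPoly_C_C, Bivariate.swap_C_C]
      rfl
    · rw [genL, genM, map_sub, map_div₀, fieldEquiv_algebraMap, map_ofNat, map_one]
      change algebraMap Uh[X][X] GenField (Bivariate.swap (reflectPoly (C X))) / 2 - 1 = _
      rw [reflectPoly_C_X, Bivariate.swap_X]
    · rw [genL, genM, map_sub, map_div₀, fieldEquiv_algebraMap, map_ofNat, map_one]
      change algebraMap Uh[X][X] GenField (Bivariate.swap (reflectPoly X)) / 2 - 1 = _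
      rw [reflectPoly_X, Bivariate.swap_Y]
  · refine ⟨fieldEquiv reflectPoly, fun u => ?_, Or.inl ⟨rfl, ?_, ?_⟩⟩
    · change fieldEquiv _ (algebraMap Uh[X][X] GenField (C (C u))) = _
      rw [fieldEquiv_algebraMap, reflectPoly_C_C]
      rfl
    · rw [genL, map_sub, map_div₀, fieldEquiv_algebraMap, map_ofNat, map_one, reflectPoly_C_X]
    · rw [genM, map_sub, map_div₀, fieldEquiv_algebraMap, map_ofNat, map_one, reflectPoly_X]

/-! ### Construction of automorphisms -/

/-- A multiplicative recursion over the integers has a solution. -/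
theorem exists_int_recursion {K : Type*} [Field K] (r : ℤ → K) (hr : ∀ n, r n ≠ 0) :
    ∃ κ : ℤ → K, (∀ n, κ n ≠ 0) ∧ ∀ n, κ (n + 1) = r n * κ n := by
  let κ : ℤ → K := fun n => match n with
    | .ofNat n => ∏ i ∈ Finset.range n, r i
    | .negSucc n => ∏ i ∈ Finset.range (n + 1), (r (-(i + 1)))⁻¹
  have h1 : ∀ n : ℕ, κ n = ∏ i ∈ Finset.range n, r i := fun n => rfl
  have h2 : ∀ n : ℕ, κ (-n) = ∏ i ∈ Finset.range n, (r (-(i + 1)))⁻¹ := fun n => by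
    cases n with
    | zero => simp [κ]
    | succ n => rfl
  refine ⟨κ, fun n => ?_, fun n => ?_⟩
  · obtain ⟨n, rfl | rfl⟩ := n.eq_nat_or_neg
    · rw [h1]; exact Finset.prod_ne_zero_iff.2 fun i _ => hr _
    · rw [h2]; exact Finset.prod_ne_zero_iff.2 fun i _ => inv_ne_zero (hr _)
  · obtain ⟨n, rfl | rfl⟩ := n.eq_nat_or_neg
    · have : ((n : ℤ) + 1) = ((n + 1 : ℕ) : ℤ) := by push_cast; rfl
      rw [this, h1, h1, Finset.prod_range_succ, mul_comm]
    · cases n with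
      | zero =>
        have : (-((0 : ℕ) : ℤ) + 1) = ((1 : ℕ) : ℤ) := by simp
        rw [this, h1, h2]; simp
      | succ n =>
        have : (-((n + 1 : ℕ) : ℤ) + 1) = -(n : ℤ) := by push_cast; ring
        rw [this, h2, h2, Finset.prod_range_succ]
        have h3 := hr (-(n + 1))
        push_cast
        field_simp

/-- A subring of `D × D` with bijective projections is the graph of an automorphism. -/
theorem exists_ringEquiv_of_graph {D : Type*} [Ring D] (Γ : Subring (D × D))
    (h1 : ∀ x, ∃ y, (x, y) ∈ Γ) (h2 : ∀ y, ∃ x, (x, y) ∈ Γ)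
    (h3 : ∀ y, ((0 : D), y) ∈ Γ → y = 0) (h4 : ∀ x, (x, (0 : D)) ∈ Γ → x = 0) :
    ∃ φ : D ≃+* D, ∀ x y, (x, y) ∈ Γ → φ x = y := by
  let p : Γ ≃+* D := RingEquiv.ofBijective ((RingHom.fst D D).comp Γ.subtype)
    ⟨(injective_iff_map_eq_zero _).2 (by
      rintro ⟨⟨x, y⟩, hxy⟩ hx
      obtain rfl : x = 0 := hx
      obtain rfl := h3 y hxy
      rfl),
    fun x => by obtain ⟨y, hy⟩ := h1 x; exact ⟨⟨_, hy⟩, rfl⟩⟩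
  let q : Γ ≃+* D := RingEquiv.ofBijective ((RingHom.snd D D).comp Γ.subtype)
    ⟨(injective_iff_map_eq_zero _).2 (by
      rintro ⟨⟨x, y⟩, hxy⟩ hx
      obtain rfl : y = 0 := hx
      obtain rfl := h4 x hxy
      rfl),
    fun y => by obtain ⟨x, hx⟩ := h2 y; exact ⟨⟨_, hx⟩, rfl⟩⟩
  refine ⟨p.symm.trans q, fun x y hxy => ?_⟩
  have : p.symm x = ⟨(x, y), hxy⟩ := p.symm_apply_eq.2 rfl
  change q (p.symm x) = y
  rw [this]
  rfl

theorem algebraMap_DR (c : ℂ) : algebraMap ℂ DR c = ofUh (algebraMap ℂ Uh c) := by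
  have h1 : algebraMap ℂ Abar c = uhToAbar (algebraMap ℂ Uh c) := by
    rw [algebraMap_uh, uhToAbar_algebraMap, aeval_C]; rfl
  exact congrArg toDR (Subtype.ext h1 : (algebraMap ℂ (normalizer Iplus) c) = ⟨_, uhToAbar_mem _⟩)

/-! ### Elements intertwined by a twisted reflection -/

section

variable {K : Type*} [Field K]

/-- The twisted reflection of the representation space. -/
def twist (σ : K ≃+* K) (κ : ℤ → K) (g : ℤ → K) : ℤ → K := fun n => κ n * σ (g (-n))

theorem twist_injective (σ : K ≃+* K) {κ : ℤ → K} (hκ : ∀ n, κ n ≠ 0) {g : ℤ → K}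
    (h : twist σ κ g = 0) : g = 0 := by
  ext n
  have := congrFun h (-n)
  simpa [twist, hκ] using this

theorem twist_surjective (σ : K ≃+* K) {κ : ℤ → K} (hκ : ∀ n, κ n ≠ 0) :
    Function.Surjective (twist σ κ) := fun g => by
  refine ⟨fun n => σ.symm ((κ (-n))⁻¹ * g (-n)), ?_⟩
  ext n
  simp [twist, hκ]

theorem twist_add (σ : K ≃+* K) (κ g g' : ℤ → K) :
    twist σ κ (g + g') = twist σ κ g + twist σ κ g' := by
  ext n; simp [twist, mul_add]

theorem twist_zero (σ : K ≃+* K) (κ : ℤ → K) : twist σ κ 0 = 0 := by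
  ext n; simp [twist]

theorem twist_neg (σ : K ≃+* K) (κ g : ℤ → K) : twist σ κ (-g) = -twist σ κ g := by
  ext n; simp [twist]

variable [Algebra ℂ K] {s L M : K} {j : Uh →+* K}

/-- The pairs of elements of `DR(sl₂)` that are intertwined by the twisted reflection. -/
def twistGraph (hc : Compatible s L M j) (σ : K ≃+* K) (κ : ℤ → K) : Subring (DR × DR) where
  carrier := {x | ∀ g, twist σ κ (rep hc x.1 g) = rep hc x.2 (twist σ κ g)}
  mul_mem' {x y} hx hy g := by
    change twist σ κ (rep hc (x.1 * y.1) g) = rep hc (x.2 * y.2) (twist σ κ g)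
    rw [map_mul, map_mul, Module.End.mul_apply, Module.End.mul_apply, hx, hy]
  one_mem' g := by simp
  add_mem' {x y} hx hy g := by
    change twist σ κ (rep hc (x.1 + y.1) g) = rep hc (x.2 + y.2) (twist σ κ g)
    rw [map_add, map_add, LinearMap.add_apply, LinearMap.add_apply, twist_add, hx, hy]
  zero_mem' g := by simp [twist_zero]
  neg_mem' {x} hx g := by
    change twist σ κ (rep hc (-x.1) g) = rep hc (-x.2) (twist σ κ g)
    rw [map_neg, map_neg, LinearMap.neg_apply, LinearMap.neg_apply, twist_neg, hx]

theorem mem_twistGraph {hc : Compatible s L M j} {σ : K ≃+* K} {κ : ℤ → K} {x y : DR} :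
    (x, y) ∈ twistGraph hc σ κ ↔ ∀ g n, κ n * σ (rep hc x g (-n)) = rep hc y (twist σ κ g) n :=
  forall_congr' fun _ => funext_iff

theorem ofUh_mem_twistGraph (hc : Compatible s L M j) {σ : K ≃+* K}
    (hσ : ∀ u, σ (j u) = j (reflectU u)) (κ : ℤ → K) (u : Uh) :
    (ofUh u, ofUh (reflectU u)) ∈ twistGraph hc σ κ := by
  refine mem_twistGraph.2 fun g n => ?_
  rw [rep_ofUh, rep_ofUh, map_mul, hσ, reflectU_shift, twist]
  simp only [mul_neg, neg_neg, neg_mul]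
  ring

/-- The sum `L + M = h + 2 s` is fixed by `σ` in both cases, so the change of `h` to `-h - 2` must
be compensated by `s`. -/
theorem map_s (hc : Compatible s L M j) {σ : K ≃+* K} (hσ : ∀ u, σ (j u) = j (reflectU u))
    (hLM : (σ L = L ∧ σ M = M) ∨ (σ L = M ∧ σ M = L)) : σ s = s + j hU + 1 := by
  have : CharZero K := charZero_of_injective_algebraMap (algebraMap ℂ K).injective
  have h1 : 2 * σ s = 2 * (s + j hU + 1) := by
    have h2 : σ L + σ M = L + M := by
      rcases hLM with ⟨h1, h2⟩ | ⟨h1, h2⟩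
      · rw [h1, h2]
      · rw [h1, h2, add_comm]
    have h3 := congrArg σ hc.add_eq
    rw [map_add, map_add, map_mul, map_ofNat, hσ, reflectU_hU, map_sub, map_neg, map_ofNat,
      h2] at h3
    linear_combination hc.add_eq - h3
  exact mul_left_cancel₀ two_ne_zero h1

/-- The left product contains the reflected scalar of `z₋ z₊` at position `-n`, the right one the
scalar of `z₊ z₋` at position `n`. They differ by the ratio of `h + 1` to `h - 1`, shifted by `-2
n`; this is the origin of the factors `h - 1` and `h + 3` in the formulas. -/
theorem map_coeffMinus (hc : Compatible s L M j) {σ : K ≃+* K}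
    (hσ : ∀ u, σ (j u) = j (reflectU u))
    (hLM : (σ L = L ∧ σ M = M) ∨ (σ L = M ∧ σ M = L)) (n : ℤ) :
    σ (coeffMinus s L M (j hU) (-n)) * σ (2 * (s + (-(n + 1) : ℤ) + 1)) * (j hU - 2 * n - 1)
      = 2 * (s + n + 1) * coeffMinus s L M (j hU) (n + 1) * (j hU - 2 * n + 1) := by
  have hs := map_s hc hσ hLM
  have hL : L = j hU + 2 * s - M := by rw [← hc.add_eq]; ring
  have h1 : j hU - 2 * n - 1 ≠ 0 := by
    have := map_hU_sub_add_ne_zero j n (-1); push_cast at this; rwa [← sub_eq_add_neg] at this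
  have h2 : j hU - 2 * n + 1 ≠ 0 := by exact_mod_cast map_hU_sub_add_ne_zero j n 1
  have h3 : j hU - 2 * n ≠ 0 := by
    have := map_hU_sub_add_ne_zero j n 0; push_cast at this; rwa [add_zero] at this
  have e1 : j hU - 2 * ((n : K) + 1) + 2 = j hU - 2 * n := by ring
  have e2 : j hU - 2 * ((n : K) + 1) + 3 = j hU - 2 * n + 1 := by ring
  have e3 : -j hU - 2 - 2 * (-n : K) + 2 = -(j hU - 2 * n) := by ring
  have e4 : -j hU - 2 - 2 * (-n : K) + 3 = -(j hU - 2 * n - 1) := by ring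
  simp only [coeffMinus, map_mul, map_add, map_sub, map_inv₀, map_intCast, map_ofNat, map_one, hσ,
    reflectU_hU, map_neg, hs]
  push_cast
  rw [e1, e2, e3, e4]
  rcases hLM with ⟨h4, h5⟩ | ⟨h4, h5⟩
  · rw [h4, h5, hL]
    field_simp
    ring
  · rw [h4, h5, hL]
    field_simp
    ring

theorem exists_twist_scaling (hg : Generic s L M j) (σ : K ≃+* K) (u : Uhˣ) : ∃ κ : ℤ → K,
    (∀ n, κ n ≠ 0) ∧ ∀ n, κ (n + 1) * σ (2 * (s + (-(n + 1) : ℤ) + 1)) =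
      coeffMinus s L M (j hU) (n + 1) * j (shift (-2 * n) u) * κ n := by
  have := hg.charZero
  have h1 : ∀ n : ℤ, σ (2 * (s + (-(n + 1) : ℤ) + 1)) ≠ 0 := fun n => by
    rw [Ne, EmbeddingLike.map_eq_zero_iff]
    exact mul_ne_zero two_ne_zero (hg.s_ne _)
  obtain ⟨κ, h2, h3⟩ := exists_int_recursion (fun n : ℤ => coeffMinus s L M (j hU) (n + 1) *
    j (shift (-2 * n) u) / σ (2 * (s + (-(n + 1) : ℤ) + 1))) fun n =>
      div_ne_zero (mul_ne_zero (hg.coeffMinus_ne_zero _)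
        ((u.isUnit.map (shift (-2 * n))).map j).ne_zero) (h1 n)
  refine ⟨κ, h2, fun n => ?_⟩
  rw [h3]
  have := h1 n
  field_simp

/-- The recursion for `κ` is precisely the intertwining condition for this pair, compared at
position `n + 1`. -/
theorem zPlus_mem_twistGraph {hc : Compatible s L M j} {σ : K ≃+* K} {κ : ℤ → K} {u : Uh}
    (hκ : ∀ n, κ (n + 1) * σ (2 * (s + (-(n + 1) : ℤ) + 1)) =
      coeffMinus s L M (j hU) (n + 1) * j (shift (-2 * n) u) * κ n) :
    (zPlus, zMinus * ofUh u) ∈ twistGraph hc σ κ := by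
  refine mem_twistGraph.2 fun g n => ?_
  obtain ⟨m, rfl⟩ : ∃ m, n = m + 1 := ⟨n - 1, by ring⟩
  rw [map_mul, Module.End.mul_apply, rep_zMinus', rep_ofUh, rep_zPlus, map_mul, ← mul_assoc, hκ,
    add_sub_cancel_right, twist]
  have : -(m + 1) + 1 = -m := by ring
  rw [this]
  ring

theorem zMinus_mem_twistGraph (hg : Generic s L M j) {σ : K ≃+* K}
    (hσ : ∀ u, σ (j u) = j (reflectU u))
    (hLM : (σ L = L ∧ σ M = M) ∨ (σ L = M ∧ σ M = L)) {κ : ℤ → K} {u v : Uh}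
    (hκ : ∀ n, κ (n + 1) * σ (2 * (s + (-(n + 1) : ℤ) + 1)) =
      coeffMinus s L M (j hU) (n + 1) * j (shift (-2 * n) u) * κ n)
    (huv : (hU - 1) * (shift (-2) v * u) = hU + 1) :
    (zMinus, zPlus * ofUh v) ∈ twistGraph hg.toCompatible σ κ := by
  have := hg.charZero
  refine mem_twistGraph.2 fun g n => ?_
  rw [map_mul, Module.End.mul_apply, rep_zPlus, rep_zMinus', rep_ofUh, map_mul, twist]
  have h1 : σ (2 * (s + (-(n + 1) : ℤ) + 1)) ≠ 0 := by
    rw [Ne, EmbeddingLike.map_eq_zero_iff]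
    exact mul_ne_zero two_ne_zero (hg.s_ne _)
  have h2 : j hU - 2 * n - 1 ≠ 0 := by
    have := map_hU_sub_add_ne_zero j n (-1); push_cast at this; rwa [← sub_eq_add_neg] at this
  have h3 : (j hU - 2 * n - 1) * (j (shift (-2 * (n + 1)) v) * j (shift (-2 * n) u)) =
      j hU - 2 * n + 1 := by
    have := congrArg (fun x => j (shift (-2 * n) x)) huv
    simp only [map_mul, map_sub, map_add, map_one, shift_hU, shift_shift, map_intCast] at this
    have e : -2 * n + -2 = -2 * (n + 1) := by ring
    rw [e] at this
    push_cast at this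
    linear_combination this
  have h4 := map_coeffMinus hg.toCompatible hσ hLM n
  -- With `κ` already fixed by `z₊`, the condition for `z₋` concerns only the product of the two
  -- coefficients, and `huv` is what balances it.
  have h5 : κ n * σ (coeffMinus s L M (j hU) (-n)) =
      2 * (s + n + 1) * j (shift (-2 * (n + 1)) v) * κ (n + 1) := by
    refine mul_right_cancel₀ h1 (mul_right_cancel₀ h2 ?_)
    linear_combination κ n * h4 - 2 * (s + n + 1) * j (shift (-2 * (n + 1)) v) *
      (j hU - 2 * n - 1) * hκ n - 2 * (s + n + 1) * coeffMinus s L M (j hU) (n + 1) * κ n * h3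
  have e : -(n + 1) = -n - 1 := by ring
  rw [← mul_assoc, h5, e]
  ring

theorem t_mem_twistGraph (hc : Compatible s L M j) {σ : K ≃+* K}
    (hσ : ∀ u, σ (j u) = j (reflectU u)) {β : ℂ}
    (hβ : (β = -1 ∧ σ L = L ∧ σ M = M) ∨ (β = 1 ∧ σ L = M ∧ σ M = L)) (κ : ℤ → K) :
    (t, β • (t * ofUh ↑(hUnit 2 * (hUnit 0)⁻¹))) ∈ twistGraph hc σ κ := by
  refine mem_twistGraph.2 fun g n => ?_
  have h1 : j hU - 2 * n + 2 ≠ 0 := by exact_mod_cast map_hU_sub_add_ne_zero j n 2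
  have h3 : j hU - 2 * n ≠ 0 := by
    have := map_hU_sub_add_ne_zero j n 0; push_cast at this; rwa [add_zero] at this
  have h4 : rep hc (t * ofUh ↑(hUnit 2 * (hUnit 0)⁻¹)) (twist σ κ g) n =
      (L - M) * (L + M + 2) * (j hU - 2 * n)⁻¹ * (κ n * σ (g (-n))) := by
    rw [map_mul, Module.End.mul_apply, rep_t, rep_ofUh, Units.val_mul, map_mul, map_mul,
      map_shift_hUnit, map_shift_coe_inv_hUnit, twist]
    push_cast
    have e1 : j hU + -2 * (n : K) + 2 = j hU - 2 * n + 2 := by ring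
    have e2 : j hU + -2 * (n : K) + 0 = j hU - 2 * n := by ring
    rw [e1, e2]
    field_simp
  -- Reflection turns the denominator `h + 2` into `-h`. This sign gives `β = -1` when `σ` fixes `L`
  -- and `M`; their exchange changes the sign of `L - M` and gives `β = 1`.
  have h5 : σ (rep hc t g (-n)) = -((σ L - σ M) * (σ L + σ M + 2) * (j hU - 2 * n)⁻¹ * σ (g (-n))) := by
    rw [rep_t]
    simp only [map_mul, map_add, map_sub, map_inv₀, hσ, reflectU_hU, map_neg, map_ofNat,
      map_intCast]
    push_cast
    have e1 : -j hU - 2 - 2 * (-n : K) + 2 = -(j hU - 2 * n) := by ring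
    rw [e1, inv_neg]
    ring
  rcases hβ with ⟨rfl, h6, h7⟩ | ⟨rfl, h6, h7⟩
  · rw [neg_one_smul, map_neg, LinearMap.neg_apply, Pi.neg_apply, h4, h5, h6, h7]
    ring
  · rw [one_smul, h4, h5, h6, h7]
    ring

theorem exists_ringEquiv (hg : Generic s L M j) {σ : K ≃+* K}
    (hσ : ∀ u, σ (j u) = j (reflectU u)) {β : ℂ}
    (hβ : (β = -1 ∧ σ L = L ∧ σ M = M) ∨ (β = 1 ∧ σ L = M ∧ σ M = L)) (γ : Uhˣ) :
    ∃ φ : DR ≃+* DR, (∀ u, φ (ofUh u) = ofUh (reflectU u)) ∧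
      φ t = β • (t * ofUh ↑(hUnit 2 * (hUnit 0)⁻¹)) ∧
      φ zPlus = zMinus * ofUh ↑(hUnit (-1) * γ)⁻¹ ∧
      φ zMinus = zPlus * ofUh (↑(hUnit 3) * shift 2 γ) := by
  have hLM : (σ L = L ∧ σ M = M) ∨ (σ L = M ∧ σ M = L) := hβ.imp And.right And.right
  obtain ⟨κ, h0, hκ⟩ := exists_twist_scaling hg σ (hUnit (-1) * γ)⁻¹
  have huv : (hU - 1) * (shift (-2) (↑(hUnit 3) * shift 2 γ) * ↑(hUnit (-1) * γ)⁻¹) = hU + 1 := by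
    have e1 : shift (-2) (↑(hUnit 3) * shift 2 (γ : Uh)) = (hU + 1) * γ := by
      rw [map_mul, shift_coe_hUnit, shift_shift, neg_add_cancel, shift_zero]
      simp [coe_hUnit]
    have e2 : hU - 1 = hUnit (-1) := by simp [coe_hUnit, sub_eq_add_neg]
    rw [e1, e2]
    have e3 : (hUnit (-1) : Uh) * γ * ↑(hUnit (-1) * γ)⁻¹ = 1 := Units.mul_inv (hUnit (-1) * γ)
    linear_combination (hU + 1) * e3
  have hU' := ofUh_mem_twistGraph hg.toCompatible hσ κ
  have hp := zPlus_mem_twistGraph (hc := hg.toCompatible) hκ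
  have hm := zMinus_mem_twistGraph hg hσ hLM hκ huv
  have ht := t_mem_twistGraph hg.toCompatible hσ hβ κ
  set Γ := twistGraph hg.toCompatible σ κ
  have h1 : Γ.map (RingHom.fst DR DR) = ⊤ :=
    subring_DR_eq_top _ (fun u => ⟨_, hU' u, rfl⟩) ⟨_, hp, rfl⟩ ⟨_, hm, rfl⟩ ⟨_, ht, rfl⟩
  -- The second components are the generators multiplied by units of `Ū(𝔥)` and, for `t`, a sign.
  -- All of `Ū(𝔥)` is attained because the reflection is an involution, so these factors can be
  -- removed.
  have h2 : Γ.map (RingHom.snd DR DR) = ⊤ := by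
    have hV : ∀ u, ofUh u ∈ Γ.map (RingHom.snd DR DR) := fun u =>
      ⟨_, hU' (reflectU u), by rw [reflectU_reflectU]; rfl⟩
    have hcancel : ∀ (x : DR) (u : Uh), IsUnit u → x * ofUh u ∈ Γ.map (RingHom.snd DR DR) →
        x ∈ Γ.map (RingHom.snd DR DR) := by
      rintro x _ ⟨u, rfl⟩ hx
      have := mul_mem hx (hV ↑u⁻¹)
      rwa [mul_ofUh_mul_ofUh, Units.mul_inv, map_one, mul_one] at this
    refine subring_DR_eq_top _ hV (hcancel _ _ ?_ ⟨_, hm, rfl⟩) (hcancel _ _ ?_ ⟨_, hp, rfl⟩)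
      (hcancel t ↑(hUnit 2 * (hUnit 0)⁻¹) (Units.isUnit _) ?_)
    · exact (hUnit 3).isUnit.mul (γ.isUnit.map (shift 2))
    · exact Units.isUnit _
    · have h3 : β • (t * ofUh ↑(hUnit 2 * (hUnit 0)⁻¹)) ∈ Γ.map (RingHom.snd DR DR) := ⟨_, ht, rfl⟩
      rcases hβ with ⟨rfl, -⟩ | ⟨rfl, -⟩
      · rw [neg_one_smul] at h3
        exact neg_mem_iff.1 h3
      · rwa [one_smul] at h3
  obtain ⟨φ, hφ⟩ := exists_ringEquiv_of_graph Γ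
    (fun x => by
      obtain ⟨⟨x', y⟩, h, rfl⟩ : x ∈ Γ.map (RingHom.fst DR DR) := h1 ▸ Subring.mem_top x
      exact ⟨y, h⟩)
    (fun y => by
      obtain ⟨⟨x, y'⟩, h, rfl⟩ : y ∈ Γ.map (RingHom.snd DR DR) := h2 ▸ Subring.mem_top y
      exact ⟨x, h⟩)
    -- An element intertwined with zero kills the range of the twist, which is everything;
    -- faithfulness makes it zero. The other component uses injectivity of the twist.
    (fun y hy => by
      refine rep_injective hg (LinearMap.ext fun g => ?_)
      obtain ⟨g, rfl⟩ := twist_surjective σ h0 g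
      rw [← hy g]
      simp [twist_zero])
    (fun x hx => by
      refine rep_injective hg (LinearMap.ext fun g => ?_)
      have := hx g
      simp only [map_zero, LinearMap.zero_apply] at this
      rw [twist_injective σ h0 this]
      simp)
  exact ⟨φ, fun u => hφ _ _ (hU' u), hφ _ _ ht, hφ _ _ hp, hφ _ _ hm⟩

end

/-! ### Existence and rigidity of the automorphisms -/

theorem exists_hasForm {β : ℂ} (hβ : β = 1 ∨ β = -1) (γ : Uhˣ) :
    ∃ φ : DR ≃ₐ[ℂ] DR, HasForm β γ φ := by
  obtain ⟨σ, hσ, h1⟩ := exists_fieldEquiv hβ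
  obtain ⟨φ, h2, h3, h4, h5⟩ := exists_ringEquiv genericField hσ h1 γ
  refine ⟨AlgEquiv.ofRingEquiv (f := φ) fun c => ?_, ?_, h3, h4, h5⟩
  · rw [algebraMap_DR, h2, reflectU_algebraMap]
  · change φ (ofUh hU) = -ofUh hU - 2
    rw [h2, reflectU_hU, map_sub, map_neg, map_ofNat]

theorem map_ofUh_eq {φ ψ : DR ≃ₐ[ℂ] DR} (h0 : φ h = ψ h) (u : Uh) : φ (ofUh u) = ψ (ofUh u) := by
  have : (φ : DR →+* DR).comp ofUh = (ψ : DR →+* DR).comp ofUh := by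
    refine uh_hom_ext (fun c => ?_) h0
    simp only [RingHom.comp_apply, ← algebraMap_DR]
    exact (φ.commutes c).trans (ψ.commutes c).symm
  exact DFunLike.congr_fun this u

theorem algEquiv_ext {φ ψ : DR ≃ₐ[ℂ] DR} (h0 : φ h = ψ h) (h1 : φ zPlus = ψ zPlus)
    (h2 : φ zMinus = ψ zMinus) (h3 : φ t = ψ t) : φ = ψ := by
  have := subring_DR_eq_top (RingHom.eqLocus (φ : DR →+* DR) (ψ : DR →+* DR))
    (map_ofUh_eq h0) h1 h2 h3
  ext x
  have hx : x ∈ RingHom.eqLocus (φ : DR →+* DR) (ψ : DR →+* DR) := this ▸ Subring.mem_top x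
  exact hx

/-- Apply `φ` to the weight equation: the constant `-2` in `-h - 2` drops out of the commutator, and
the sign of `h` remains. -/
theorem HasForm.reversesWeights {β : ℂ} {γ : Uhˣ} {φ : DR ≃ₐ[ℂ] DR} (hφ : HasForm β γ φ) :
    ReversesWeights φ := by
  intro μ x hx
  have h1 := congrArg φ hx
  rw [map_sub, map_mul, map_mul, hφ.1, map_smul] at h1
  rw [neg_smul, ← h1]
  noncomm_ring

theorem smul_mul_ofUh (β : ℂ) (x : DR) (u : Uh) :
    β • (x * ofUh u) = x * ofUh (algebraMap ℂ Uh β * u) := by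
  rw [Algebra.smul_def, map_mul, ← algebraMap_DR, ← mul_assoc, ← mul_assoc, Algebra.commutes]

theorem HasForm.linearInGenerators {β : ℂ} {γ : Uhˣ} {φ : DR ≃ₐ[ℂ] DR} (hφ : HasForm β γ φ) :
    LinearInGenerators φ := by
  obtain ⟨h0, h1, h2, h3⟩ := hφ
  refine ⟨⟨-hU - 2, ?_⟩, ⟨0, ↑(hUnit (-1) * γ)⁻¹, 0, ?_⟩, ⟨↑(hUnit 3) * shift 2 γ, 0, 0, ?_⟩,
    ⟨0, 0, algebraMap ℂ Uh β * ↑(hUnit 2 * (hUnit 0)⁻¹), ?_⟩⟩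
  · rw [h0, map_sub, map_neg, map_ofNat]; rfl
  · rw [h2]; simp
  · rw [h3]; simp
  · rw [h1, smul_mul_ofUh]; simp

/-! ### Linear independence over `Ū(𝔥)` -/

theorem ev_injective : Function.Injective ev := by
  rw [injective_iff_map_eq_zero]
  intro p hp
  have h1 := rep_ev genericField.toCompatible p (fun _ => 1) 0
  rw [hp, map_zero, mul_one, mul_zero] at h1
  have h2 : genJ.comp (shift 0) = genJ := RingHom.ext fun u => congrArg genJ (shift_zero u)
  rw [h2] at h1
  exact (injective_iff_map_eq_zero _).1 genericField.injective p h1.symm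

theorem ofUh_injective : Function.Injective ofUh := by
  intro u v huv
  rw [← ev_C_C, ← ev_C_C] at huv
  exact C_injective (C_injective (ev_injective huv))

theorem eq_zero_of_cas_tau {a b c : Uh}
    (h : 2 * cas * ofUh a + (4 * tau) * (4 * tau) * ofUh b + ofUh c = 0) :
    a = 0 ∧ b = 0 ∧ c = 0 := by
  have h1 : (C X + X) * C (C a) + (C X - X) * (C X - X) * C (C b) + C (C c) = (0 : Uh[X][X]) := by
    apply ev_injective
    rw [map_zero, ← h]
    simp only [map_add, map_mul, map_sub, ev_C_X, ev_X, ev_C_C]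
    have e1 : casOne + casTwo = 2 * cas := by rw [casOne, casTwo]; noncomm_ring
    have e2 : casOne - casTwo = 4 * tau := by rw [casOne, casTwo]; noncomm_ring
    rw [e1, e2]
  -- The three coefficients are separated by specializing the two central variables at `(0, 0)`,
  -- `(1, 1)` and at a point where just one of them is `1`.
  have hc := congrArg (fun p => (p.eval (C 0)).eval 0) h1
  have ha := congrArg (fun p => (p.eval (C 1)).eval 1) h1
  have hb := congrArg (fun p => (p.eval (C 0)).eval 1) h1
  simp at hc ha hb
  subst hc
  have ha' : a = 0 := by
    rcases mul_eq_zero.1 (by linear_combination ha : (2 : Uh) * a = 0) with h2 | h2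
    · have := two_mul_half
      rw [h2, zero_mul] at this
      exact absurd this zero_ne_one
    · exact h2
  subst ha'
  exact ⟨rfl, by simpa using hb, rfl⟩

theorem coe_hUnit_ne_zero (l : ℤ) : (hUnit l : Uh) ≠ 0 := (hUnit l).ne_zero

/-- Both `z₋ z₊` and `t²` can be expressed through `cas`, `tau²` and `Ū(𝔥)`, which reduces the claim
to the algebraic independence of the central elements. -/
theorem eq_zero_of_zMinus_zPlus_t {u v w : Uh}
    (h : zMinus * zPlus * ofUh u + t * t * ofUh v + ofUh w = 0) : u = 0 ∧ v = 0 ∧ w = 0 := by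
  have h3 := coe_hUnit_ne_zero 3
  have h2 := coe_hUnit_ne_zero 2
  have hi : (↑(hUnit 2)⁻¹ : Uh) * hUnit 2 = 1 := Units.inv_mul _
  have ht : tau * tau = t * t * ofUh (hUnit 2 * hUnit 2) := by
    rw [tau, ← mul_assoc, mul_ofUh_mul_t, mul_ofUh_mul_ofUh]
  -- This is the relation multiplied by `64 (h + 3) (h + 2)²`, which clears all denominators and
  -- produces the multiples `2 cas` and `4 tau`.
  have key : 2 * cas * ofUh (8 * u * hUnit 2 ^ 3)
      + (4 * tau) * (4 * tau) * ofUh (4 * hUnit 3 * v - u * hUnit 2)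
      + ofUh (64 * hUnit 3 * hUnit 2 ^ 2 * w - 16 * u * hUnit 2 ^ 5) = 0 := by
    have e4 : (4 * tau) * (4 * tau) = 16 * (tau * tau) := by noncomm_ring
    have e1 : 2 * cas * ofUh (8 * u * hUnit 2 ^ 3)
        = zMinus * zPlus * ofUh (u * (64 * hUnit 3 * hUnit 2 ^ 2))
          + t * t * ofUh (16 * u * hUnit 2 ^ 3) + ofUh (16 * u * hUnit 2 ^ 5) := by
      have : (2 : DR) * cas * ofUh (8 * u * hUnit 2 ^ 3) = cas * ofUh (16 * u * hUnit 2 ^ 3) := by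
        rw [show (16 : Uh) * u * hUnit 2 ^ 3 = 2 * (8 * u * hUnit 2 ^ 3) by ring, map_mul ofUh 2,
          map_ofNat, ← mul_assoc, two_mul, mul_two]
      rw [this, cas, add_mul, add_mul, mul_ofUh_mul_ofUh, ofUh_mul_ofUh]
      have e5 : (4 * ↑(hUnit 3) * ↑(hUnit 2)⁻¹ * (16 * u * hUnit 2 ^ 3) : Uh)
          = u * (64 * hUnit 3 * hUnit 2 ^ 2) := by
        linear_combination 64 * u * hUnit 3 * hUnit 2 ^ 2 * hi
      have e6 : ((hU + 2) ^ 2 * (16 * u * hUnit 2 ^ 3) : Uh) = 16 * u * hUnit 2 ^ 5 := by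
        rw [coe_hUnit 2]; push_cast; ring
      rw [e5, e6]
    have e2 : (16 : DR) * (tau * tau) * ofUh (4 * hUnit 3 * v - u * hUnit 2)
        = t * t * ofUh (v * (64 * hUnit 3 * hUnit 2 ^ 2) - 16 * u * hUnit 2 ^ 3) := by
      have : (16 : DR) * (tau * tau) = tau * tau * ofUh 16 := by
        rw [map_ofNat]; exact (Commute.ofNat_left _ _).eq
      rw [this, ht, mul_ofUh_mul_ofUh, mul_ofUh_mul_ofUh]
      congr 2
      ring
    rw [e4, e1, e2]
    have := congrArg (· * ofUh (64 * hUnit 3 * hUnit 2 ^ 2)) h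
    simp only [add_mul, mul_ofUh_mul_ofUh, ofUh_mul_ofUh, zero_mul] at this
    rw [← this, map_sub, map_sub, mul_sub, mul_comm (64 * (hUnit 3 : Uh) * hUnit 2 ^ 2) w]
    abel
  obtain ⟨ha, hb, hc⟩ := eq_zero_of_cas_tau key
  have unit_two : ∀ x : Uh, 2 * x = 0 → x = 0 := fun x hx => by
    linear_combination algebraMap ℂ[X] Uh (C (1 / 2)) * hx - x * two_mul_half
  have hu : u = 0 := by
    have : u * hUnit 2 ^ 3 = 0 := unit_two _ (unit_two _ (unit_two _ (by linear_combination ha)))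
    exact (mul_eq_zero.1 this).resolve_right (pow_ne_zero 3 h2)
  subst hu
  have hv : v = 0 := by
    have : hUnit 3 * v = 0 := unit_two _ (unit_two _ (by linear_combination hb))
    exact (mul_eq_zero.1 this).resolve_left h3
  subst hv
  refine ⟨rfl, rfl, ?_⟩
  exact ofUh_injective (by simpa using h)

theorem t_mul_ofUh_eq_zero {u : Uh} (h : t * ofUh u = 0) : u = 0 :=
  (eq_zero_of_zMinus_zPlus_t (u := 0) (v := u) (w := 0)
    (by rw [mul_assoc t t, h, map_zero]; simp)).2.1

theorem zMinus_mul_eq_zero {x : DR} (h : zMinus * x = 0) : x = 0 := by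
  have hg := genericField
  refine rep_injective hg (LinearMap.ext fun g => funext fun n => ?_)
  have h1 : rep hg.toCompatible (zMinus * x) g (n + 1) = 0 := by rw [h, map_zero]; rfl
  rw [map_mul, Module.End.mul_apply, rep_zMinus', add_sub_cancel_right] at h1
  rw [(mul_eq_zero.1 h1).resolve_left (hg.coeffMinus_ne_zero _), map_zero]
  rfl

theorem zPlus_mul_eq_zero {x : DR} (h : zPlus * x = 0) : x = 0 := by
  have hg := genericField
  have := hg.charZero
  refine rep_injective hg (LinearMap.ext fun g => funext fun n => ?_)
  have h1 : rep hg.toCompatible (zPlus * x) g (n - 1) = 0 := by rw [h, map_zero]; rfl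
  rw [map_mul, Module.End.mul_apply, rep_zPlus, sub_add_cancel] at h1
  rw [(mul_eq_zero.1 h1).resolve_left (mul_ne_zero two_ne_zero (hg.s_ne _)), map_zero]
  rfl

theorem eq_zero_of_ofUh_eq_zero {u : Uh} (h : ofUh u = 0) : u = 0 :=
  ofUh_injective (by rw [h, map_zero])

/-! ### Weights -/

theorem h_mul_zPlus : h * zPlus = zPlus * h + 2 * zPlus := by
  rw [h, ofUh_mul_zPlus, shift_hU]
  rw [Int.cast_ofNat, map_add, map_ofNat, mul_add, (Commute.ofNat_right zPlus 2).eq]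

theorem h_mul_zMinus : h * zMinus = zMinus * h - 2 * zMinus := by
  rw [h, ofUh_mul_zMinus, shift_hU]
  rw [Int.cast_neg, Int.cast_ofNat, map_add, map_neg, map_ofNat, mul_add, mul_neg,
    (Commute.ofNat_right zMinus 2).eq, sub_eq_add_neg]

theorem weight_zPlus : h * zPlus - zPlus * h = (2 : ℂ) • zPlus := by
  rw [h_mul_zPlus, add_sub_cancel_left, two_smul, two_mul]

theorem weight_zMinus : h * zMinus - zMinus * h = (-2 : ℂ) • zMinus := by
  rw [h_mul_zMinus, sub_sub_cancel_left, neg_smul, two_smul, two_mul]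

theorem weight_t : h * t - t * h = (0 : ℂ) • t := by
  rw [h, ofUh_mul_t, sub_self, zero_smul]

theorem weight_mul_ofUh {μ : ℂ} {x : DR} (hx : h * x - x * h = μ • x) (u : Uh) :
    h * (x * ofUh u) - x * ofUh u * h = μ • (x * ofUh u) := by
  have : ofUh u * h = h * ofUh u := by rw [h, ← map_mul, ← map_mul, mul_comm]
  rw [mul_assoc x, this, ← mul_assoc, ← mul_assoc, ← sub_mul, hx, smul_mul_assoc]

theorem weight_linear (a b c : Uh) :
    h * (zPlus * ofUh a + zMinus * ofUh b + t * ofUh c)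
      - (zPlus * ofUh a + zMinus * ofUh b + t * ofUh c) * h
      = (2 : ℂ) • (zPlus * ofUh a) - (2 : ℂ) • (zMinus * ofUh b) := by
  have h1 := weight_mul_ofUh weight_zPlus a
  have h2 := weight_mul_ofUh weight_zMinus b
  have h3 := weight_mul_ofUh weight_t c
  rw [mul_add, mul_add, add_mul, add_mul, add_sub_add_comm, add_sub_add_comm, h1, h2, h3]
  module

/-- The three terms have the distinct weights `2`, `-2`, `0`. Taking the commutator with `h` once
and twice isolates the first two, and the third is what remains. -/
theorem eq_zero_of_linear {a b c : Uh} (h0 : zPlus * ofUh a + zMinus * ofUh b + t * ofUh c = 0) :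
    a = 0 ∧ b = 0 ∧ c = 0 := by
  have h1 := weight_linear a b c
  rw [h0, mul_zero, zero_mul, sub_zero] at h1
  have h2 : h * ((2 : ℂ) • (zPlus * ofUh a) - (2 : ℂ) • (zMinus * ofUh b))
      - ((2 : ℂ) • (zPlus * ofUh a) - (2 : ℂ) • (zMinus * ofUh b)) * h
      = (4 : ℂ) • (zPlus * ofUh a) + (4 : ℂ) • (zMinus * ofUh b) := by
    have h3 := weight_mul_ofUh weight_zPlus a
    have h4 := weight_mul_ofUh weight_zMinus b
    rw [mul_sub, sub_mul, mul_smul_comm, mul_smul_comm, smul_mul_assoc, smul_mul_assoc]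
    linear_combination (norm := module) (2 : ℂ) • h3 - (2 : ℂ) • h4
  rw [← h1, mul_zero, zero_mul, sub_zero] at h2
  have ha : zPlus * ofUh a = 0 := by
    linear_combination (norm := module) (-1 / 4 : ℂ) • h1 - (1 / 8 : ℂ) • h2
  have hb : zMinus * ofUh b = 0 := by
    linear_combination (norm := module) (1 / 4 : ℂ) • h1 - (1 / 8 : ℂ) • h2
  rw [ha, hb, zero_add, zero_add] at h0
  exact ⟨eq_zero_of_ofUh_eq_zero (zPlus_mul_eq_zero ha),
    eq_zero_of_ofUh_eq_zero (zMinus_mul_eq_zero hb), t_mul_ofUh_eq_zero h0⟩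

/-- In an element linear in the generators and of weight `μ`, only a generator of weight `μ`
occurs. -/
theorem eq_zero_of_weight_linear {μ : ℂ} {a b c : Uh}
    (hw : h * (zPlus * ofUh a + zMinus * ofUh b + t * ofUh c)
      - (zPlus * ofUh a + zMinus * ofUh b + t * ofUh c) * h
      = μ • (zPlus * ofUh a + zMinus * ofUh b + t * ofUh c)) :
    (2 - μ) • a = 0 ∧ (2 + μ) • b = 0 ∧ μ • c = 0 := by
  rw [weight_linear] at hw
  have key : zPlus * ofUh ((2 - μ) • a) + zMinus * ofUh (-((2 + μ) • b)) + t * ofUh (-(μ • c)) = 0 := by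
    rw [map_neg, map_neg, Algebra.smul_def, Algebra.smul_def, Algebra.smul_def, mul_neg, mul_neg,
      ← smul_mul_ofUh, ← smul_mul_ofUh, ← smul_mul_ofUh]
    linear_combination (norm := module) hw
  obtain ⟨ha, hb, hc⟩ := eq_zero_of_linear key
  exact ⟨ha, neg_eq_zero.1 hb, neg_eq_zero.1 hc⟩

theorem uh_eq_zero_of_smul {c : ℂ} (hc : c ≠ 0) {u : Uh} (h : c • u = 0) : u = 0 := by
  have := congrArg (c⁻¹ • ·) h
  simpa [smul_smul, hc] using this

theorem IsLinear.exists_eq_zPlus_mul {x : DR} (hx : IsLinear x)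
    (hw : h * x - x * h = (2 : ℂ) • x) : ∃ a, x = zPlus * ofUh a := by
  obtain ⟨a, b, c, rfl⟩ := hx
  obtain ⟨-, hb, hc⟩ := eq_zero_of_weight_linear hw
  rw [uh_eq_zero_of_smul (by norm_num) hb, uh_eq_zero_of_smul (by norm_num) hc]
  exact ⟨a, by simp⟩

theorem IsLinear.exists_eq_zMinus_mul {x : DR} (hx : IsLinear x)
    (hw : h * x - x * h = (-2 : ℂ) • x) : ∃ b, x = zMinus * ofUh b := by
  obtain ⟨a, b, c, rfl⟩ := hx
  obtain ⟨ha, -, hc⟩ := eq_zero_of_weight_linear hw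
  rw [uh_eq_zero_of_smul (by norm_num) ha, uh_eq_zero_of_smul (by norm_num) hc]
  exact ⟨b, by simp⟩

theorem IsLinear.exists_eq_t_mul {x : DR} (hx : IsLinear x)
    (hw : h * x - x * h = (0 : ℂ) • x) : ∃ c, x = t * ofUh c := by
  obtain ⟨a, b, c, rfl⟩ := hx
  obtain ⟨ha, hb, -⟩ := eq_zero_of_weight_linear hw
  rw [uh_eq_zero_of_smul (by norm_num) ha, uh_eq_zero_of_smul (by norm_num) hb]
  exact ⟨c, by simp⟩

/-! ### Automorphisms linear in the generators -/

theorem map_ofUh_hUnit {φ : DR ≃ₐ[ℂ] DR} {u : Uh} (hu : φ h = ofUh u) (l : ℤ) :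
    φ (ofUh ↑(hUnit l)) = ofUh (u + l) := by
  have : ofUh ↑(hUnit l) = h + l := by rw [coe_hUnit, map_add, map_intCast, h]
  rw [this, map_add, map_intCast, hu, map_add, map_intCast]

theorem add_intCast_ne_zero {φ : DR ≃ₐ[ℂ] DR} {u : Uh} (hu : φ h = ofUh u) (l : ℤ) :
    u + (l : Uh) ≠ 0 := by
  intro h0
  have := map_ofUh_hUnit hu l
  rw [h0, map_zero, EmbeddingLike.map_eq_zero_iff] at this
  exact coe_hUnit_ne_zero l (eq_zero_of_ofUh_eq_zero this)

/-- This is the image under `φ` of `h z₊ = z₊ h + 2 z₊`, with `z₋` and then `b` cancelled. -/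
theorem shift_neg_two_of_map {φ : DR ≃ₐ[ℂ] DR} {u b : Uh} (hu : φ h = ofUh u)
    (hb : φ zPlus = zMinus * ofUh b) (hb0 : b ≠ 0) : shift (-2) u = u + 2 := by
  have h1 := congrArg φ h_mul_zPlus
  have h2 : (2 : DR) * (zMinus * ofUh b) = zMinus * ofUh (b * 2) := by
    rw [(Commute.ofNat_left _ _).eq, mul_assoc, map_mul, map_ofNat]
  simp only [map_add, map_mul, map_ofNat, hu, hb] at h1
  rw [← mul_assoc, ofUh_mul_zMinus, mul_ofUh_mul_ofUh, mul_ofUh_mul_ofUh, h2, ← mul_add,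
    ← map_add, ← sub_eq_zero, ← mul_sub, ← map_sub] at h1
  have h3 := eq_zero_of_ofUh_eq_zero (zMinus_mul_eq_zero h1)
  exact mul_left_cancel₀ hb0 (by linear_combination h3)

/-- Relations for the coefficients of an automorphism linear in the generators, from the relation
expressing `z₊ z₋` through `z₋ z₊`. -/
theorem coeff_relations {φ : DR ≃ₐ[ℂ] DR} {u a b c : Uh} (hu : φ h = ofUh u)
    (hp : φ zPlus = zMinus * ofUh b) (hm : φ zMinus = zPlus * ofUh a) (ht : φ t = t * ofUh c) :
    hU * (shift (-2) a * b) * (u + 3) = - ((u + 1) * (u + 2)) ∧ (c * hU) ^ 2 = u ^ 2 := by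
  set P := shift (-2) a * b with hP
  -- Denominators are cleared first, so that `φ` has to be evaluated only on the factors `h + l`,
  -- where it gives `u + l`.
  have hrel : zPlus * zMinus * ofUh (hUnit 0 * hUnit 1 * hUnit 2)
      = zMinus * zPlus * ofUh (hUnit 0 * hUnit 0 * hUnit 3)
        + ofUh (hUnit 0 * hUnit 0 * hUnit 1 * hUnit 2) - t * t * ofUh (hUnit 1 * hUnit 2) := by
    have i0 : (↑(hUnit 0)⁻¹ : Uh) * hUnit 0 = 1 := Units.inv_mul _
    have i1 : (↑(hUnit 1)⁻¹ : Uh) * hUnit 1 = 1 := Units.inv_mul _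
    have i2 : (↑(hUnit 2)⁻¹ : Uh) * hUnit 2 = 1 := Units.inv_mul _
    rw [zPlus_mul_zMinus, sub_mul, add_mul, mul_ofUh_mul_ofUh, mul_ofUh_mul_ofUh, ofUh_mul_ofUh]
    have e1 : (↑(hUnit 0 * hUnit 3 * (hUnit 1 * hUnit 2)⁻¹) * (hUnit 0 * hUnit 1 * hUnit 2) : Uh)
        = hUnit 0 * hUnit 0 * hUnit 3 := by
      simp only [Units.val_mul, mul_inv]
      linear_combination (hUnit 0 * hUnit 0 * hUnit 3 : Uh) * i1
        + (hUnit 0 * hUnit 0 * hUnit 3 * hUnit 1 * ↑(hUnit 1)⁻¹ : Uh) * i2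
    have e2 : (hU * (hUnit 0 * hUnit 1 * hUnit 2) : Uh) = hUnit 0 * hUnit 0 * hUnit 1 * hUnit 2 := by
      rw [coe_hUnit 0]; push_cast; ring
    have e3 : (↑(hUnit 0)⁻¹ * (hUnit 0 * hUnit 1 * hUnit 2) : Uh) = hUnit 1 * hUnit 2 := by
      linear_combination (hUnit 1 * hUnit 2 : Uh) * i0
    rw [e1, e2, e3]
  have h1 := congrArg φ hrel
  simp only [map_add, map_sub, map_mul, hp, hm, ht, map_ofUh_hUnit hu] at h1
  simp only [← map_mul ofUh, ← map_add ofUh] at h1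
  have e1 : zMinus * ofUh b * (zPlus * ofUh a) = zMinus * zPlus * ofUh (shift 2 P) := by
    rw [← mul_assoc, mul_ofUh_mul_zPlus, mul_ofUh_mul_ofUh, hP, map_mul (shift 2), shift_neg_shift,
      mul_comm a]
  have e2 : zPlus * ofUh a * (zMinus * ofUh b) = zPlus * zMinus * ofUh P := by
    rw [← mul_assoc, mul_ofUh_mul_zMinus, mul_ofUh_mul_ofUh]
  have e3 : t * ofUh c * (t * ofUh c) = t * t * ofUh (c * c) := by
    rw [← mul_assoc, mul_ofUh_mul_t, mul_ofUh_mul_ofUh]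
  have e4 : ∀ x, zPlus * zMinus * ofUh x
      = zMinus * zPlus * ofUh (↑(hUnit 0 * hUnit 3 * (hUnit 1 * hUnit 2)⁻¹) * x) + ofUh (hU * x)
        - t * t * ofUh (↑(hUnit 0)⁻¹ * x) := fun x => by
    rw [zPlus_mul_zMinus, sub_mul, add_mul, mul_ofUh_mul_ofUh, mul_ofUh_mul_ofUh, ofUh_mul_ofUh]
  rw [e1, e2, e3, mul_ofUh_mul_ofUh, mul_ofUh_mul_ofUh, mul_ofUh_mul_ofUh, e4] at h1
  simp only [← mul_assoc] at h1
  -- After `z₊ z₋` is eliminated, the image of the relation is a combination of `z₋ z₊`, `t²` and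
  -- `1`. Only the last two coefficients are used.
  have h2 : zMinus * zPlus * ofUh (shift 2 P * ((u + (0 : ℤ)) * (u + (1 : ℤ)) * (u + (2 : ℤ)))
      - ↑(hUnit 0 * hUnit 3 * (hUnit 1 * hUnit 2)⁻¹) * P
        * ((u + (0 : ℤ)) * (u + (0 : ℤ)) * (u + (3 : ℤ))))
      + t * t * ofUh (↑(hUnit 0)⁻¹ * P * ((u + (0 : ℤ)) * (u + (0 : ℤ)) * (u + (3 : ℤ)))
        + c * c * ((u + (1 : ℤ)) * (u + (2 : ℤ))))
      + ofUh (-(hU * P * ((u + (0 : ℤ)) * (u + (0 : ℤ)) * (u + (3 : ℤ)))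
        + (u + (0 : ℤ)) * (u + (0 : ℤ)) * (u + (1 : ℤ)) * (u + (2 : ℤ)))) = 0 := by
    rw [map_sub ofUh, map_add ofUh, map_neg ofUh, map_add ofUh, mul_sub (zMinus * zPlus),
      mul_add (t * t)]
    simp only [← mul_assoc]
    rw [h1]
    abel
  obtain ⟨-, h3, h4⟩ := eq_zero_of_zMinus_zPlus_t h2
  have n0 := add_intCast_ne_zero hu 0
  have n1 := add_intCast_ne_zero hu 1
  have n2 := add_intCast_ne_zero hu 2
  have i0 : (↑(hUnit 0)⁻¹ : Uh) * hU = 1 := by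
    have := Units.inv_mul (hUnit 0)
    rwa [coe_hUnit, Int.cast_zero, add_zero] at this
  push_cast at h3 h4 n0 n1 n2
  rw [add_zero] at n0
  have r1 : hU * P * (u + 3) = - ((u + 1) * (u + 2)) := by
    apply mul_left_cancel₀ (pow_ne_zero 2 n0)
    linear_combination -h4
  refine ⟨r1, mul_right_cancel₀ (mul_ne_zero n1 n2) ?_⟩
  linear_combination hU ^ 2 * h3 - u ^ 2 * r1 - (P * hU * u ^ 2 * (u + 3)) * i0

/-- Apply `φ` to `z₊ t (h + 2) = t z₊ (h + 4)` and bring both sides to the form `z₋ t` times an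
element of `Ū(𝔥)`. -/
theorem coeff_t_relation {φ : DR ≃ₐ[ℂ] DR} {u b c : Uh} (hu : φ h = ofUh u)
    (hp : φ zPlus = zMinus * ofUh b) (ht : φ t = t * ofUh c) (hb0 : b ≠ 0) :
    c * (u + 2) * hU = (hU + 2) * shift (-2) c * (u + 4) := by
  have i0 : (↑(hUnit 0)⁻¹ : Uh) * hU = 1 := by
    have := Units.inv_mul (hUnit 0)
    rwa [coe_hUnit, Int.cast_zero, add_zero] at this
  have hrel : zPlus * t * ofUh (hUnit 2) = t * zPlus * ofUh (hUnit 4) := by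
    rw [zPlus_mul_t, mul_ofUh_mul_ofUh, Units.val_mul, mul_assoc (hUnit 4 : Uh),
      Units.inv_mul, mul_one]
  have h1 := congrArg φ hrel
  simp only [map_mul, hp, ht, map_ofUh_hUnit hu] at h1
  rw [← mul_assoc, mul_ofUh_mul_t, mul_ofUh_mul_ofUh, mul_ofUh_mul_ofUh,
    ← mul_assoc (t * ofUh c), mul_ofUh_mul_zMinus, mul_ofUh_mul_ofUh, mul_ofUh_mul_ofUh, t_mul_zMinus, mul_ofUh_mul_ofUh,
    ← sub_eq_zero, ← mul_sub, ← map_sub, mul_assoc] at h1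
  have h2 := t_mul_ofUh_eq_zero (zMinus_mul_eq_zero h1)
  rw [Units.val_mul, coe_hUnit 2] at h2
  push_cast at h2
  apply mul_left_cancel₀ hb0
  linear_combination hU * h2 + (hU + 2) * (shift (-2) c * b) * (u + 4) * i0

theorem hasForm_of_linearInGenerators {φ : DR ≃ₐ[ℂ] DR} (hw : ReversesWeights φ)
    (hl : LinearInGenerators φ) : ∃ (β : ℂ) (γ : Uhˣ), (β = 1 ∨ β = -1) ∧ HasForm β γ φ := by
  obtain ⟨⟨u, hu⟩, lp, lm, lt⟩ := hl
  obtain ⟨b, hp⟩ := lp.exists_eq_zMinus_mul (hw _ _ weight_zPlus)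
  obtain ⟨a, hm⟩ := lm.exists_eq_zPlus_mul (by simpa using hw _ _ weight_zMinus)
  obtain ⟨c, ht⟩ := lt.exists_eq_t_mul (by simpa using hw _ _ weight_t)
  have hb0 : b ≠ 0 := by
    rintro rfl
    rw [map_zero, mul_zero, EmbeddingLike.map_eq_zero_iff] at hp
    exact one_ne_zero (eq_zero_of_ofUh_eq_zero (u := 1)
      (zPlus_mul_eq_zero (by rw [hp, zero_mul])))
  have hs := shift_neg_two_of_map hu hp hb0
  obtain ⟨r1, r2⟩ := coeff_relations hu hp hm ht
  have r3 := coeff_t_relation hu hp ht hb0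
  have n2 : u + 2 ≠ 0 := by exact_mod_cast add_intCast_ne_zero hu 2
  obtain ⟨ε, hε, hc⟩ : ∃ ε : ℂ, (ε = 1 ∨ ε = -1) ∧ c * hU = algebraMap ℂ Uh ε * u := by
    rcases sq_eq_sq_iff_eq_or_eq_neg.1 r2 with h1 | h1
    · exact ⟨1, Or.inl rfl, by simpa using h1⟩
    · exact ⟨-1, Or.inr rfl, by simpa using h1⟩
  have hε0 : algebraMap ℂ Uh ε ≠ 0 := by rcases hε with rfl | rfl <;> simp
  have hc' : shift (-2) c * (hU - 2) = algebraMap ℂ Uh ε * (u + 2) := by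
    have := congrArg (shift (-2)) hc
    rw [map_mul, map_mul, hs, shift_hU, algebraMap_uh, shift_C, ← algebraMap_uh] at this
    rw [← this]
    push_cast
    ring
  -- Substituting `c h = ε u` and its shift into `r3` and cancelling `ε (u + 2)` leaves `(h - 2) u =
  -- (h + 2) (u + 4)`, which is linear in `u`.
  have hU' : u = -hU - 2 := by
    have h4 : (4 : Uh) * (u + hU + 2) = 0 := by
      apply mul_left_cancel₀ (mul_ne_zero hε0 n2)
      linear_combination (2 - hU) * r3 + (u + 2) * (hU - 2) * hc - (hU + 2) * (u + 4) * hc'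
    have h5 : (4 : ℂ) • (u + hU + 2) = 0 := by
      rw [Algebra.smul_def, map_ofNat, h4]
    linear_combination uh_eq_zero_of_smul (by norm_num) h5
  subst hU'
  have i0 : hU * (↑(hUnit 0)⁻¹ : Uh) = 1 := by
    have := Units.mul_inv (hUnit 0)
    rwa [coe_hUnit, Int.cast_zero, add_zero] at this
  have i1 : (hUnit 1 : Uh) * (↑(hUnit 1)⁻¹ : Uh) = 1 := Units.mul_inv (hUnit 1)
  have hU0 : hU ≠ 0 := by simpa [coe_hUnit] using coe_hUnit_ne_zero 0
  -- This is `r1` at `u = -h - 2` after cancelling `h`. As `h + 1` is a unit, it also makes `b` a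
  -- unit.
  have hP : shift (-2) a * (b * hUnit (-1)) = hUnit 1 := by
    rw [coe_hUnit, coe_hUnit]
    push_cast
    apply mul_left_cancel₀ hU0
    linear_combination -r1
  obtain ⟨b, rfl⟩ : IsUnit b := by
    refine IsUnit.of_mul_eq_one (shift (-2) a * hUnit (-1) * ↑(hUnit 1)⁻¹) ?_
    linear_combination (↑(hUnit 1)⁻¹ : Uh) * hP + i1
  -- Here `c = ε u / h = -ε (h + 2) / h`, whence `β = -ε`; and `γ` is read off from `b = ((h - 1)
  -- γ)⁻¹`.
  refine ⟨-ε, (hUnit (-1) * b)⁻¹, by rcases hε with rfl | rfl <;> simp, ?_, ?_, ?_, ?_⟩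
  · rw [hu, map_sub, map_neg, map_ofNat, h]
  · rw [ht, smul_mul_ofUh]
    congr 2
    rw [Units.val_mul, coe_hUnit 2, map_neg]
    push_cast
    linear_combination (↑(hUnit 0)⁻¹ : Uh) * hc - c * i0
  · rw [hp, mul_inv, inv_inv, inv_mul_cancel_left]
  · have ha : shift (-2) a = hUnit 1 * ↑(hUnit (-1) * b)⁻¹ := by
      have := Units.mul_inv (hUnit (-1) * b)
      rw [Units.val_mul] at this
      linear_combination (↑(hUnit (-1) * b)⁻¹ : Uh) * hP - shift (-2) a * this
    have := congrArg (shift 2) ha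
    rw [shift_neg_shift, map_mul, shift_coe_hUnit] at this
    rw [hm, this]
    rfl

end

end DiagonalReduction

/-! ### The classification -/

theorem mainTheorem8 :
    (∀ φ : DiagonalReduction.DR ≃ₐ[ℂ] DiagonalReduction.DR,
      DiagonalReduction.ReversesWeights φ → DiagonalReduction.LinearInGenerators φ →
        ∃ (β : ℂ) (γ : DiagonalReduction.Uhˣ),
          (β = 1 ∨ β = -1) ∧ DiagonalReduction.HasForm β γ φ) ∧
    (∀ (β : ℂ) (γ : DiagonalReduction.Uhˣ), β = 1 ∨ β = -1 →
      ∃! φ : DiagonalReduction.DR ≃ₐ[ℂ] DiagonalReduction.DR,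
        DiagonalReduction.HasForm β γ φ ∧
          DiagonalReduction.ReversesWeights φ ∧ DiagonalReduction.LinearInGenerators φ) := by
  refine ⟨fun φ hw hl => DiagonalReduction.hasForm_of_linearInGenerators hw hl, fun β γ hβ => ?_⟩
  obtain ⟨φ, hφ⟩ := DiagonalReduction.exists_hasForm hβ γ
  refine ⟨φ, ⟨hφ, hφ.reversesWeights, hφ.linearInGenerators⟩, ?_⟩
  rintro ψ ⟨⟨h0, h1, h2, h3⟩, -, -⟩
  obtain ⟨k0, k1, k2, k3⟩ := hφ
  exact DiagonalReduction.algEquiv_ext (h0.trans k0.symm) (h2.trans k2.symm) (h3.trans k3.symm)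
    (h1.trans k1.symm)
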